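/- **Setting.** Let $\mathcal Z,\mathcal V$ be real Hilbert spaces and $\mathcal X$ a real Banach space with $\mathcal Z\hookrightarrow\mathcal V\hookrightarrow\mathcal X$ continuously, where $\mathcal Z\hookrightarrow\mathcal V$ is dense and compact and $\|z\|_{\mathcal V}\le\|z\|_{\mathcal Z}$ for all $z\in\mathcal Z$. Let $T>0$ and $$\mathcal I(t,z)=\tfrac12\langle Az,z\rangle+\mathcal F(z)-\langle \ell(t),z\rangle ,\qquad t\in[0,T],\ z\in\mathcal Z,$$ where - $A\in\mathcal L(\mathcal Z,\mathcal Z^*)$ is self-adjoint with $\langle Az,z\rangle\ge\alpha\|z\|_{\mathcal Z}^2$ for some $\alpha>0$; - $\mathcal F\in C^2(\mathcal Z;\mathbb R)$, $\mathcal F\ge 0$, $D_z\mathcal F\in C^1(\mathcal Z,\mathcal V^*)$, and $\|D_z^2\mathcal F(z)v\|_{\mathcal V^*}\le C_{\mathcal F}(1+\|z\|_{\mathcal Z}^q)\|v\|_{\mathcal Z}$ for some $C_{\mathcal F}$ and $q\ge1$; - $\mathcal I(t,\cdot)\in C^{2,1}_{loc}$: for all $r>0$ there is $C(r)\ge0$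 with $\langle[D_z^2\mathcal I(t,z_1)-D_z^2\mathcal I(t,z_2)]v,v\rangle\le C(r)\|z_1-z_2\|_{\mathcal Z}\|v\|_{\mathcal Z}^2$ whenever $\|z_1\|_{\mathcal Z},\|z_2\|_{\mathcal Z}<r$ and $v\in\mathcal Z$; - $\mathcal I$ is $\kappa$-uniformly convex with $\kappa>0$: $\langle D_z^2\mathcal I(t,z)v,v\rangle\ge\kappa\|v\|_{\mathcal Z}^2$ for all $t\in[0,T]$, $z,v\in\mathcal Z$; - $\ell\in W^{1,\infty}([0,T];\mathcal V^*)$ with $\ell'\in BV([0,T];\mathcal V^*)$, and for some $\delta\in(0,\kappa]$ the Lipschitz constant of $\ell:[0,T]\to\mathcal V^*$ satisfies $|\ell|_{Lip}\le\kappa-\delta$. Let $\mathcal R:\mathcal V\to[0,\infty)$ be convex, lower semicontinuous and positively homogeneous of degree one, with $\underline\rho\|v\|_{\mathcal X}\le\mathcal R(v)\le\overline\rho\|v\|_{\mathcal V}$ for some constants $\underline\rho,\overline\rho>0$, and let $z_0\in\mathcal Z$ satisfy $0\in\partial\mathcal R(0)+D_z\mathcal I(0,z_0)$. A *differential solution*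 is a function $z\in W^{1,1}(0,T;\mathcal Z)$ with $z(0)=z_0$ and $0\in\partial\mathcal R(z'(t))+D_z\mathcal I(t,z(t))$ for almost all $t\in[0,T]$. For $\tau>0$, *iterates* of the local incremental minimization scheme are sequences with $t_0=0$, initial state $z_0$ and, for $k\ge1$, $$z_k\in\operatorname{argmin}\{\mathcal I(t_{k-1},z)+\mathcal R(z-z_{k-1}) : z\in\mathcal Z,\ \|z-z_{k-1}\|_{\mathcal V}\le\tau\},\qquad t_k=\min\{t_{k-1}+\tau-\|z_k-z_{k-1}\|_{\mathcal V},\,T\}.$$ Let $N(\tau)$ be the first index with $t_{N(\tau)}=T$, put $s_k=k\tau$ and $S_\tau=s_{N(\tau)}$, and let $\hat z_\tau,\hat t_\tau$ be the continuous piecewise affine functions on $[0,S_\tau]$ with $\hat z_\tau(s_k)=z_k$, $\hat t_\tau(s_k)=t_k$. If $\hat t_\tau$ is a bijection from $[0,S_\tau]$ onto $[0,T]$, with inverse $s_\tau$, put $z_\tau(t)=\hat z_\tau(s_\tau(t))$ for $t\in[0,T]$. **Theorem.** Under these assumptions there is a unique differential solution $z$. For every $\tau>0$ iterates exist, and for every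 choice of iterates $T$ is reached after finitely many steps and $\hat t_\tau:[0,S_\tau]\to[0,T]$ is a strictly increasing bijection, so that $z_\tau$ is defined. There is a constant $K>0$, independent of $\tau$ and of the choice of the iterates, such that $$\|z_\tau(t)-z(t)\|_{\mathcal Z}\le K\tau\qquad\text{for all } t\in[0,T] \text{ and all } \tau>0 .$$ In particular $z_\tau\to z$ in $\mathcal Z$, uniformly on $[0,T]$, as $\tau\searrow0$. For fixed spaces and embeddings, $K$ depends only on $\alpha,\kappa,\ell,z_0,T,\mathcal F$ and $\|A\|_{\mathcal L(\mathcal Z,\mathcal Z^*)}$; in particular it does not depend on $\mathcal R$. -/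

import Mathlib

open Set Filter Topology MeasureTheory
open scoped ENNReal

noncomputable section

namespace RIS

section Spaces

variable {Z V X : Type*}
  [NormedAddCommGroup Z] [InnerProductSpace ℝ Z]
  [NormedAddCommGroup V] [InnerProductSpace ℝ V]
  [NormedAddCommGroup X] [NormedSpace ℝ X]

/-- The compact and dense embedding of `Z` into `V`, with embedding constant one. -/
structure IsCompactDenseEmbedding (ι : Z →L[ℝ] V) : Prop where
  injective : Function.Injective ι
  denseRange : DenseRange ι
  compact : IsCompactOperator ι
  norm_le : ∀ z, ‖ι z‖ ≤ ‖z‖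

/-- `g` is the derivative of `u ∈ W^{1,p}(0,T;E)`, where `u` is the continuous representative:
`g ∈ L^p(0,T;E)` and `u` is a primitive of `g` on `[0,T]`. -/
structure IsSobolevDeriv {E : Type*} [NormedAddCommGroup E] [NormedSpace ℝ E]
    (p : ℝ≥0∞) (T : ℝ) (u g : ℝ → E) : Prop where
  memLp : MemLp g p (volume.restrict (Icc 0 T))
  eq_primitive : ∀ t ∈ Icc 0 T, u t = u 0 + ∫ s in (0 : ℝ)..t, g s

/-- `ℓ ∈ W^{1,∞}([0,T];V*)` with `ℓ' ∈ BV([0,T];V*)`: some representative `m` of the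
derivative has finite variation on `[0,T]`. -/
def IsLoadBV (T : ℝ) (ℓ : ℝ → StrongDual ℝ V) : Prop :=
  ∃ m : ℝ → StrongDual ℝ V, IsSobolevDeriv ∞ T ℓ m ∧ BoundedVariationOn m (Icc 0 T)

/-- The standing assumptions on the quadratic part: `A` is self-adjoint and coercive with
constant `α`. -/
structure IsCoerciveSymm (α : ℝ) (A : Z →L[ℝ] StrongDual ℝ Z) : Prop where
  symm : ∀ x y, A x y = A y x
  coercive : ∀ z, α * ‖z‖ ^ 2 ≤ A z z

/-- The standing assumptions on the non-quadratic part: `F ∈ C²(Z;ℝ)` is nonnegative, its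
derivative is (the restriction to `Z` of) a map `G ∈ C¹(Z;V*)`, and the derivative of `G` has
polynomial growth. -/
structure IsLowerOrder (ι : Z →L[ℝ] V) (F : Z → ℝ) : Prop where
  contDiff : ContDiff ℝ 2 F
  nonneg : ∀ z, 0 ≤ F z
  lower_order : ∃ G : Z → StrongDual ℝ V, ContDiff ℝ 1 G ∧
    (∀ z, fderiv ℝ F z = (G z).comp ι) ∧
    ∃ C q : ℝ, 1 ≤ q ∧ ∀ z v, ‖fderiv ℝ G z v‖ ≤ C * (1 + ‖z‖ ^ q) * ‖v‖

/-- The standing assumptions on the dissipation potential `R : V → [0,∞)`; here `j` is the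
embedding of `V` into `X`. -/
structure IsDissipation (j : V →L[ℝ] X) (R : V → ℝ) : Prop where
  nonneg : ∀ v, 0 ≤ R v
  lsc : LowerSemicontinuous R
  convex : ConvexOn ℝ univ R
  homogeneous : ∀ c : ℝ, 0 < c → ∀ v, R (c • v) = c * R v
  bounded : ∃ ρ₁ ρ₂ : ℝ, 0 < ρ₁ ∧ 0 < ρ₂ ∧ ∀ v, ρ₁ * ‖j v‖ ≤ R v ∧ R v ≤ ρ₂ * ‖v‖

/-- The semilinear energy `I(t,z) = ½⟨Az,z⟩ + F(z) - ⟨ℓ(t),z⟩`. -/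
def energy (ι : Z →L[ℝ] V) (A : Z →L[ℝ] StrongDual ℝ Z) (F : Z → ℝ)
    (ℓ : ℝ → StrongDual ℝ V) (t : ℝ) (z : Z) : ℝ :=
  1 / 2 * A z z + F z - ℓ t (ι z)

/-- `I(t,·) ∈ C^{2,1}_loc`: the second derivative is Lipschitz on balls, as a quadratic form. -/
def IsC21loc (I : Z → ℝ) : Prop :=
  ∀ r : ℝ, 0 < r → ∃ C : ℝ, 0 ≤ C ∧ ∀ z₁ ∈ Metric.ball (0 : Z) r, ∀ z₂ ∈ Metric.ball (0 : Z) r,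
    ∀ v : Z, (fderiv ℝ (fderiv ℝ I) z₁ - fderiv ℝ (fderiv ℝ I) z₂) v v
      ≤ C * ‖z₁ - z₂‖ * ‖v‖ ^ 2

/-- `κ`-uniform convexity of `I(t,·)`, through the second derivative. -/
def IsUniformlyConvex (κ : ℝ) (I : Z → ℝ) : Prop :=
  ∀ z v : Z, κ * ‖v‖ ^ 2 ≤ fderiv ℝ (fderiv ℝ I) z v v

/-- The convex subdifferential `∂R(v) ⊆ V*`. -/
def subdifferential (R : V → ℝ) (v : V) : Set (StrongDual ℝ V) :=
  {ξ | ∀ w, R v + ξ (w - v) ≤ R w}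

/-- The inclusion `0 ∈ ∂R(v) + DI(z)` in `Z*`, for `v, z ∈ Z` and an energy `I` on `Z`;
functionals on `V` are restricted to `Z`. -/
def Inclusion (ι : Z →L[ℝ] V) (R : V → ℝ) (I : Z → ℝ) (v z : Z) : Prop :=
  ∃ ξ ∈ subdifferential R (ι v), ξ.comp ι + fderiv ℝ I z = 0

/-- Differential solutions: `z ∈ W^{1,1}(0,T;Z)`, `z(0) = z₀` and
`0 ∈ ∂R(z'(t)) + D_zI(t,z(t))` for almost all `t ∈ [0,T]`. -/
def IsDifferentialSolution (ι : Z →L[ℝ] V) (R : V → ℝ) (I : ℝ → Z → ℝ) (T : ℝ) (z₀ : Z)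
    (z : ℝ → Z) : Prop :=
  ∃ z' : ℝ → Z, IsSobolevDeriv 1 T z z' ∧ z 0 = z₀ ∧
    ∀ᵐ t ∂(volume.restrict (Icc 0 T)), Inclusion ι R (I t) (z' t) (z t)

/-- `(z_k, t_k)` are iterates of the local incremental minimization scheme with step size `τ`
(the iteration is simply continued once the final time has been reached). -/
structure IsLocalMinScheme (ι : Z →L[ℝ] V) (R : V → ℝ) (I : ℝ → Z → ℝ) (T : ℝ) (z₀ : Z)
    (τ : ℝ) (z : ℕ → Z) (t : ℕ → ℝ) : Prop where
  z_zero : z 0 = z₀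
  t_zero : t 0 = 0
  mem_argmin : ∀ k, ‖ι (z (k + 1) - z k)‖ ≤ τ ∧
    ∀ w : Z, ‖ι (w - z k)‖ ≤ τ →
      I (t k) (z (k + 1)) + R (ι (z (k + 1) - z k)) ≤ I (t k) w + R (ι (w - z k))
  t_update : ∀ k, t (k + 1) = min (t k + τ - ‖ι (z (k + 1) - z k)‖) T

/-- The number `N(τ)` of steps to reach the final time. -/
def finalIndex (T : ℝ) (t : ℕ → ℝ) : ℕ := sInf {k | t k = T}

/-- The piecewise affine interpolant of the values `x_k` at the artificial times `s_k = kτ`: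
for `s ∈ [s_k, s_{k+1})` it is `x_k + (s - s_k)/(s_{k+1} - s_k) (x_{k+1} - x_k)`. -/
def affineInterpolant {E : Type*} [NormedAddCommGroup E] [NormedSpace ℝ E]
    (τ : ℝ) (x : ℕ → E) (s : ℝ) : E :=
  x ⌊s / τ⌋₊ + ((s - ⌊s / τ⌋₊ * τ) / τ) • (x (⌊s / τ⌋₊ + 1) - x ⌊s / τ⌋₊)

/-- The artificial time interval `[0, S_τ]`, with `S_τ = s_{N(τ)}`. -/
def artificialInterval (T τ : ℝ) (t : ℕ → ℝ) : Set ℝ := Icc 0 (finalIndex T t * τ)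

/-- The retransformed discrete solution `z_τ(t) = ẑ_τ(s_τ(t))`, where
`s_τ : [0,T] → [0,S_τ]` is the inverse of the interpolated time `t̂_τ`. -/
def retransformed (T τ : ℝ) (z : ℕ → Z) (t : ℕ → ℝ) (r : ℝ) : Z :=
  affineInterpolant τ z
    (Function.invFunOn (affineInterpolant τ t) (artificialInterval T τ t) r)

end Spaces

end RIS

end

/-!
For the driving force `σ = -D_z I(t,z)`, the inclusion says that `σ` is stable, `σ ∈ ∂R(0)`, and
satisfies the power balance `R(z') = ⟨σ, z'⟩`. If both hold for `y₁` and `y₂` up to a defect of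
order `β` on `[0,T]`, then stability of each force, tested with the velocity of the other solution,
shows that the Hessian form of the energy at `y₁`, evaluated at `y₁ - y₂`, has right increments
bounded by a multiple of itself plus the defects. Gronwall's inequality gives `‖y₁ - y₂‖² ≤ c β`,
where `c` does not depend on `R`. This yields uniqueness, and existence as the limit of approximate
solutions.

Since the Lipschitz constant of `ℓ` is smaller than `κ`, the states of the scheme move more slowly
than the time, so that the constraint `‖z - z_{k-1}‖ ≤ τ` is never active, and the iterates, shifted
by one step, solve an implicit incremental problem on the grid of the `t_k`. The defect of its
piecewise affine interpolant consists of the time integral of the interpolation error of the force,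
and of the sum of the changes of the force tested with the increments of the state. Both are
`O(τ²)`, because `ℓ'` has bounded variation; hence the error is `O(τ)`.
-/

namespace RIS

/-! ### Gronwall inequality for right increments -/

section Dini

theorem eventually_right_mem_Icc {a b s : ℝ} (hs : s ∈ Ico a b) :
    ∀ᶠ t in 𝓝[>] s, s < t ∧ t ∈ Icc a b := by
  filter_upwards [Ioo_mem_nhdsGT hs.2] with t ht
  exact ⟨ht.1, hs.1.trans ht.1.le, ht.2.le⟩

theorem eventually_right_le_of_continuous {g : ℝ → ℝ} (hg : Continuous g) {s ε : ℝ} (h0 : g s = 0)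
    (hε : 0 < ε) : ∀ᶠ t in 𝓝[>] s, g t ≤ ε :=
  ((hg.tendsto s).mono_left nhdsWithin_le_nhds).eventually (eventually_le_nhds (by rwa [h0]))

theorem le_of_right_increments {f : ℝ → ℝ} {a b : ℝ} (hab : a ≤ b)
    (hf : ContinuousOn f (Icc a b))
    (h : ∀ s ∈ Ico a b, ∀ ε > 0, ∀ᶠ t in 𝓝[>] s, f t - f s ≤ ε * (t - s)) : f b ≤ f a := by
  refine image_le_of_liminf_slope_right_le_deriv_boundary (B := fun _ => f a) (B' := fun _ => 0)
    hf le_rfl continuousOn_const (fun x _ => hasDerivWithinAt_const _ _ _) ?_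
    (right_mem_Icc.2 hab)
  intro x hx ε hε
  refine Eventually.frequently ?_
  filter_upwards [h x hx (ε / 2) (half_pos hε), self_mem_nhdsWithin] with t ht htx
  have hxt : 0 < t - x := sub_pos.2 htx
  rw [slope_def_field, div_lt_iff₀ hxt]
  nlinarith

theorem gronwall_of_right_increments {f G : ℝ → ℝ} {c T : ℝ} (hc : 0 ≤ c)
    (hf : ContinuousOn f (Icc 0 T)) (hG : ContinuousOn G (Icc 0 T))
    (hf0 : ∀ t ∈ Icc 0 T, 0 ≤ f t) (hGmono : ∀ s ∈ Ico 0 T, ∀ᶠ t in 𝓝[>] s, G s ≤ G t)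
    (h : ∀ s ∈ Ico 0 T, ∀ ε > 0, ∀ᶠ t in 𝓝[>] s,
      f t - f s ≤ c * (t - s) * f s + (G t - G s) + ε * (t - s)) {b : ℝ} (hb : b ∈ Icc 0 T) :
    f b ≤ Real.exp (c * b) * (f 0 + (G b - G 0)) := by
  suffices key : Real.exp (-(c * b)) * f b - G b ≤ Real.exp (-(c * 0)) * f 0 - G 0 by
    rw [mul_zero, neg_zero, Real.exp_zero, one_mul, Real.exp_neg] at key
    rw [← inv_mul_le_iff₀ (Real.exp_pos _)]
    linarith
  have hexp : Continuous fun t : ℝ => Real.exp (-(c * t)) := by fun_prop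
  refine le_of_right_increments (f := fun t => Real.exp (-(c * t)) * f t - G t) hb.1
    ((hexp.continuousOn.mul (hf.mono (Icc_subset_Icc_right hb.2))).sub
      (hG.mono (Icc_subset_Icc_right hb.2))) fun s hs ε hε => ?_
  have hsT : s ∈ Ico 0 T := ⟨hs.1, hs.2.trans_le hb.2⟩
  filter_upwards [hGmono s hsT, h s hsT ε hε, eventually_right_mem_Icc hsT]
    with t hGst hfst ⟨hst, ht⟩
  have hexp_pos := Real.exp_pos (-(c * t))
  have hexp_le : Real.exp (-(c * t)) ≤ 1 :=
    Real.exp_le_one_iff.2 (neg_nonpos.2 (mul_nonneg hc ht.1))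
  have hexp_step : Real.exp (-(c * t)) * (1 + c * (t - s)) ≤ Real.exp (-(c * s)) := by
    calc Real.exp (-(c * t)) * (1 + c * (t - s))
        ≤ Real.exp (-(c * t)) * Real.exp (c * (t - s)) :=
          mul_le_mul_of_nonneg_left (by linarith [Real.add_one_le_exp (c * (t - s))])
            hexp_pos.le
      _ = Real.exp (-(c * s)) := by rw [← Real.exp_add]; ring_nf
  have hrest : Real.exp (-(c * t)) * ((G t - G s) + ε * (t - s)) ≤ (G t - G s) + ε * (t - s) :=
    mul_le_of_le_one_left
      (add_nonneg (sub_nonneg.2 hGst) (mul_nonneg hε.le (sub_pos.2 hst).le)) hexp_le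
  have hstep := mul_le_mul_of_nonneg_right hexp_step (hf0 s ⟨hsT.1, hsT.2.le⟩)
  have hinc := mul_le_mul_of_nonneg_left hfst hexp_pos.le
  linarith

end Dini

section Lipschitz

variable {E : Type*} [NormedAddCommGroup E] {f : ℝ → E} {S : Set ℝ}

theorem continuousOn_of_norm_sub_le {E' : Type*} [NormedAddCommGroup E'] {f : E' → E}
    {S : Set E'} {c : ℝ} (h : ∀ s ∈ S, ∀ t ∈ S, ‖f s - f t‖ ≤ c * ‖s - t‖) :
    ContinuousOn f S := by
  refine LipschitzOnWith.continuousOn (K := c.toNNReal) (.of_dist_le_mul fun s hs t ht => ?_)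
  rw [dist_eq_norm, dist_eq_norm]
  exact (h s hs t ht).trans (mul_le_mul_of_nonneg_right (Real.le_coe_toNNReal c) (norm_nonneg _))

theorem lipschitzOnWith_one_iff :
    LipschitzOnWith 1 f S ↔ ∀ s ∈ S, ∀ t ∈ S, s ≤ t → ‖f t - f s‖ ≤ t - s := by
  simp only [lipschitzOnWith_iff_dist_le_mul, dist_eq_norm, NNReal.coe_one, one_mul]
  refine ⟨fun h s hs t ht hst => ?_, fun h s hs t ht => ?_⟩
  · simpa only [Real.norm_of_nonneg (sub_nonneg.2 hst)] using h t ht s hs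
  · rcases le_total s t with hst | hst
    · rw [norm_sub_rev, norm_sub_rev s]
      exact (h s hs t ht hst).trans (le_abs_self _)
    · exact (h t ht s hs hst).trans (le_abs_self _)

theorem lipschitzOnWith_one_of_right_increments {a b : ℝ} (hf : ContinuousOn f (Icc a b))
    (h : ∀ s ∈ Ico a b, ∀ᶠ t in 𝓝[>] s, ‖f t - f s‖ ≤ t - s) : LipschitzOnWith 1 f (Icc a b) := by
  refine lipschitzOnWith_one_iff.2 fun s hs t ht hst => ?_
  have key := le_of_right_increments (f := fun x => ‖f x - f s‖ - x) hst
    (((hf.mono (Icc_subset_Icc hs.1 ht.2)).sub continuousOn_const).norm.sub continuousOn_id) ?_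
  · rw [sub_self, norm_zero] at key
    linarith
  intro x hx ε hε
  filter_upwards [h x ⟨hs.1.trans hx.1, hx.2.trans_le ht.2⟩, self_mem_nhdsWithin] with u hu hxu
  have := norm_sub_le_norm_sub_add_norm_sub (f u) (f x) (f s)
  have := mul_pos hε (sub_pos.2 hxu)
  linarith

theorem norm_le_of_lipschitzOnWith_one {T : ℝ} (hf : LipschitzOnWith 1 f (Icc 0 T)) {t : ℝ}
    (ht : t ∈ Icc 0 T) : ‖f t‖ ≤ ‖f 0‖ + T := by
  have h := lipschitzOnWith_one_iff.1 hf 0 (left_mem_Icc.2 (ht.1.trans ht.2)) t ht ht.1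
  linarith [norm_le_norm_add_norm_sub' (f t) (f 0), ht.2]

end Lipschitz

section Dual

variable {E : Type*} [NormedAddCommGroup E] [NormedSpace ℝ E]

theorem dual_apply_le (f : StrongDual ℝ E) (x : E) : f x ≤ ‖f‖ * ‖x‖ :=
  (le_abs_self _).trans (f.le_opNorm x)

theorem bilin_apply_self_le (f : E →L[ℝ] StrongDual ℝ E) (x : E) : f x x ≤ ‖f‖ * ‖x‖ ^ 2 := by
  rw [sq, ← mul_assoc]
  exact (le_abs_self _).trans (f.le_opNorm₂ x x)

end Dual

/-! ### Stability estimate for approximate solutions -/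

section EnergyDeriv

variable {Z : Type*} [NormedAddCommGroup Z] [NormedSpace ℝ Z]

/-- `D` is the derivative of a `κ`-uniformly convex function with Hessian `H`, which on the closed
ball of radius `r` is bounded by `Λ` and Lipschitz with constant `C`. The function itself does not
occur: adding a time-dependent linear load to it changes neither `H` nor increments of `D`. -/
structure IsEnergyDeriv (r Λ C κ : ℝ) (D : Z → StrongDual ℝ Z) (H : Z → Z →L[ℝ] StrongDual ℝ Z) :
    Prop where
  pos : 0 < κ
  nonneg : 0 ≤ C
  hasFDerivAt : ∀ x, HasFDerivAt D (H x) x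
  symm : ∀ x u v, H x u v = H x v u
  coercive : ∀ x v, κ * ‖v‖ ^ 2 ≤ H x v v
  bound : ∀ x, ‖x‖ ≤ r → ‖H x‖ ≤ Λ
  lipschitz : ∀ x y, ‖x‖ ≤ r → ‖y‖ ≤ r → ‖H x - H y‖ ≤ C * ‖x - y‖

variable {r Λ C κ : ℝ} {D : Z → StrongDual ℝ Z} {H : Z → Z →L[ℝ] StrongDual ℝ Z}

namespace IsEnergyDeriv

theorem bound_nonneg (hD : IsEnergyDeriv r Λ C κ D H) {x : Z} (hx : ‖x‖ ≤ r) : 0 ≤ Λ :=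
  (norm_nonneg (H x)).trans (hD.bound x hx)

theorem continuous (hD : IsEnergyDeriv r Λ C κ D H) : Continuous D :=
  continuous_iff_continuousAt.2 fun x => (hD.hasFDerivAt x).continuousAt

theorem continuousOn_hessian (hD : IsEnergyDeriv r Λ C κ D H) :
    ContinuousOn H (Metric.closedBall 0 r) :=
  continuousOn_of_norm_sub_le (E := Z →L[ℝ] StrongDual ℝ Z) fun x hx y hy =>
    hD.lipschitz x y (mem_closedBall_zero_iff.1 hx) (mem_closedBall_zero_iff.1 hy)

theorem norm_sub_le (hD : IsEnergyDeriv r Λ C κ D H) {x y : Z}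
    (hx : ‖x‖ ≤ r) (hy : ‖y‖ ≤ r) : ‖D x - D y‖ ≤ Λ * ‖x - y‖ :=
  (convex_closedBall (0 : Z) r).norm_image_sub_le_of_norm_hasFDerivWithin_le
    (fun z _ => (hD.hasFDerivAt z).hasFDerivWithinAt)
    (fun z hz => hD.bound z (mem_closedBall_zero_iff.1 hz))
    (mem_closedBall_zero_iff.2 hy) (mem_closedBall_zero_iff.2 hx)

theorem norm_taylor_le (hD : IsEnergyDeriv r Λ C κ D H) {x y : Z}
    (hx : ‖x‖ ≤ r) (hy : ‖y‖ ≤ r) : ‖D x - D y - H y (x - y)‖ ≤ C * ‖x - y‖ ^ 2 := by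
  have hball : segment ℝ y x ⊆ Metric.closedBall 0 r :=
    (convex_closedBall (0 : Z) r).segment_subset (mem_closedBall_zero_iff.2 hy)
      (mem_closedBall_zero_iff.2 hx)
  have hbound : ∀ z ∈ segment ℝ y x, ‖H z - H y‖ ≤ C * ‖x - y‖ := fun z hz =>
    (hD.lipschitz z y (mem_closedBall_zero_iff.1 (hball hz)) hy).trans
      (mul_le_mul_of_nonneg_left (norm_sub_le_of_mem_segment hz) hD.nonneg)
  have h := (convex_segment y x).norm_image_sub_le_of_norm_hasFDerivWithin_le'
    (fun z _ => (hD.hasFDerivAt z).hasFDerivWithinAt) hbound (left_mem_segment ℝ y x)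
    (right_mem_segment ℝ y x)
  rwa [mul_assoc, ← sq] at h

theorem monotone (hD : IsEnergyDeriv r Λ C κ D H) (x y : Z) :
    κ * ‖x - y‖ ^ 2 ≤ (D x - D y) (x - y) := by
  set w := x - y with hw
  have hder : ∀ s : ℝ, HasDerivAt (fun s : ℝ => D (y + s • w) w - κ * s * ‖w‖ ^ 2)
      (H (y + s • w) w w - κ * ‖w‖ ^ 2) s := fun s => by
    have hline : HasDerivAt (fun s : ℝ => y + s • w) w s := by
      simpa using ((hasDerivAt_id s).smul_const w).const_add y
    have hD_line : HasDerivAt (fun s : ℝ => D (y + s • w)) (H (y + s • w) w) s :=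
      (hD.hasFDerivAt (y + s • w)).comp_hasDerivAt s hline
    have hD_apply := hD_line.clm_apply (hasDerivAt_const s w)
    rw [map_zero, add_zero] at hD_apply
    have h := hD_apply.sub (((hasDerivAt_id' s).const_mul κ).mul_const (‖w‖ ^ 2))
    rwa [mul_one] at h
  have hmono : Monotone fun s : ℝ => D (y + s • w) w - κ * s * ‖w‖ ^ 2 :=
    monotone_of_deriv_nonneg (fun s => (hder s).differentiableAt) fun s => by
      rw [(hder s).deriv]
      exact sub_nonneg.2 (hD.coercive _ _)
  have h := hmono (zero_le_one' ℝ)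
  simp only [zero_smul, add_zero, one_smul, mul_zero, zero_mul, sub_zero, mul_one, hw,
    add_sub_cancel] at h
  rw [_root_.sub_apply]
  linarith

theorem hessian_apply_le (hD : IsEnergyDeriv r Λ C κ D H) {x u : Z} (hx : ‖x‖ ≤ r)
    (hu : ‖u‖ ≤ r) (d : Z) : H x (x - u) d ≤ (D x - D u) d + C * ‖x - u‖ ^ 2 * ‖d‖ := by
  have h := (dual_apply_le (D u - D x - H x (u - x)) d).trans
    (mul_le_mul_of_nonneg_right (hD.norm_taylor_le hu hx) (norm_nonneg d))
  rw [norm_sub_rev, ← neg_sub x u] at h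
  simp only [map_neg, _root_.sub_apply, _root_.neg_apply] at h ⊢
  linarith

/-- The first-order part is the driving force tested with the increment of `x - u`, since the
Hessian at `x` maps `x - u` to `D x - D u` up to a quadratic error. -/
theorem quadratic_increment_le (hD : IsEnergyDeriv r Λ C κ D H) {x x' u u' : Z} {h : ℝ}
    (hx : ‖x‖ ≤ r) (hx' : ‖x'‖ ≤ r) (hu : ‖u‖ ≤ r) (hxh : ‖x' - x‖ ≤ h) (huh : ‖u' - u‖ ≤ h) :
    H x' (x' - u') (x' - u') - H x (x - u) (x - u) ≤
      2 * (D x - D u) ((x' - u') - (x - u)) + 6 * C * h * ‖x - u‖ ^ 2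
        + (8 * C * h ^ 3 + 4 * Λ * h ^ 2) := by
  set w := x - u
  set w' := x' - u'
  obtain ⟨d, hd⟩ : ∃ d, w' = w + d := ⟨w' - w, (add_sub_cancel _ _).symm⟩
  have hh : 0 ≤ h := (norm_nonneg _).trans hxh
  have hdnorm : ‖d‖ ≤ 2 * h := by
    have : d = (x' - x) - (u' - u) := by
      rw [eq_sub_of_add_eq' hd.symm]
      simp only [w, w']
      abel
    rw [this]
    linarith [_root_.norm_sub_le (x' - x) (u' - u)]
  have hw' : ‖w'‖ ^ 2 ≤ 2 * ‖w‖ ^ 2 + 8 * h ^ 2 := by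
    have : ‖w'‖ ≤ ‖w‖ + 2 * h := hd ▸ (norm_add_le _ _).trans (by linarith)
    nlinarith [norm_nonneg w', norm_nonneg w, sq_nonneg (‖w‖ - 2 * h)]
  have hexpand : H x' w' w' - H x w w = (H x' - H x) w' w' + 2 * H x w d + H x d d := by
    have := hD.symm x d w
    simp only [hd, map_add, _root_.sub_apply, _root_.add_apply] at this ⊢
    linarith
  have hhess : (H x' - H x) w' w' ≤ C * h * (2 * ‖w‖ ^ 2 + 8 * h ^ 2) := by
    have hnorm : ‖H x' - H x‖ ≤ C * h :=
      (hD.lipschitz _ _ hx' hx).trans (mul_le_mul_of_nonneg_left hxh hD.nonneg)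
    exact (bilin_apply_self_le _ _).trans
      (mul_le_mul hnorm hw' (sq_nonneg _) (mul_nonneg hD.nonneg hh))
  have hquad : H x d d ≤ Λ * (2 * h) ^ 2 :=
    (bilin_apply_self_le _ _).trans (mul_le_mul (hD.bound x hx)
      (pow_le_pow_left₀ (norm_nonneg d) hdnorm 2) (sq_nonneg _) (hD.bound_nonneg hx))
  have hmixed : H x w d ≤ (D x - D u) d + C * ‖w‖ ^ 2 * (2 * h) :=
    (hD.hessian_apply_le hx hu d).trans (add_le_add_right (mul_le_mul_of_nonneg_left hdnorm
      (mul_nonneg hD.nonneg (sq_nonneg _))) _)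
  rw [hexpand, hd, add_sub_cancel_left, ← hd]
  linarith

end IsEnergyDeriv

end EnergyDeriv

section Approx

variable {Z : Type*} [NormedAddCommGroup Z] [NormedSpace ℝ Z]

/-- `y` is a solution on `[0,T]`, with initial state `z₀`, of the rate-independent system
`0 ∈ ∂R(y') + D(y) - L` up to defects: the stable force `σ` differs from the driving force
`L - D ∘ y` by at most `η`, and the increments of `B`, whose total is at most `β`, dominate both
the time integral of this difference and the defect of the power balance for `σ`. -/
structure IsApproxSolution (T : ℝ) (z₀ : Z) (L : ℝ → StrongDual ℝ Z) (D : Z → StrongDual ℝ Z)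
    (R : Z → ℝ) (η β : ℝ) (y : ℝ → Z) (σ : ℝ → StrongDual ℝ Z) (B : ℝ → ℝ) : Prop where
  init : y 0 = z₀
  lipschitz : LipschitzOnWith 1 y (Icc 0 T)
  stable : ∀ t ∈ Icc 0 T, ∀ w, σ t w ≤ R w
  force : ∀ t ∈ Icc 0 T, ‖σ t - (L t - D (y t))‖ ≤ η
  continuousOn_defect : ContinuousOn B (Icc 0 T)
  defect_zero : B 0 = 0
  defect_le : ∀ t ∈ Icc 0 T, B t ≤ β
  right_force : ∀ s ∈ Ico 0 T, ∀ᶠ t in 𝓝[>] s,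
    ‖σ s - (L s - D (y s))‖ * (t - s) ≤ B t - B s
  right_power : ∀ s ∈ Ico 0 T, ∀ ε > 0, ∀ᶠ t in 𝓝[>] s,
    R (y t - y s) ≤ σ s (y t - y s) + (B t - B s) + ε * (t - s)

namespace IsApproxSolution

variable {T Λ C κ η η₁ η₂ β β₁ β₂ : ℝ} {z₀ : Z} {L : ℝ → StrongDual ℝ Z}
  {D : Z → StrongDual ℝ Z} {H : Z → Z →L[ℝ] StrongDual ℝ Z} {R : Z → ℝ} {y y₁ y₂ : ℝ → Z}
  {σ σ₁ σ₂ : ℝ → StrongDual ℝ Z} {B B₁ B₂ : ℝ → ℝ}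

theorem norm_le (hy : IsApproxSolution T z₀ L D R η β y σ B) {t : ℝ} (ht : t ∈ Icc 0 T) :
    ‖y t‖ ≤ ‖z₀‖ + T :=
  hy.init ▸ norm_le_of_lipschitzOnWith_one hy.lipschitz ht

theorem norm_sub_le (hy : IsApproxSolution T z₀ L D R η β y σ B) {s t : ℝ} (hs : s ∈ Icc 0 T)
    (ht : t ∈ Icc 0 T) (hst : s ≤ t) : ‖y t - y s‖ ≤ t - s :=
  lipschitzOnWith_one_iff.1 hy.lipschitz s hs t ht hst

theorem eventually_defect_le (hy : IsApproxSolution T z₀ L D R η β y σ B) {s : ℝ}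
    (hs : s ∈ Ico 0 T) : ∀ᶠ t in 𝓝[>] s, B s ≤ B t := by
  filter_upwards [hy.right_force s hs, self_mem_nhdsWithin] with t ht hst
  exact sub_nonneg.1 ((mul_nonneg (norm_nonneg _) (sub_pos.2 hst).le).trans ht)

/-- Up to the defects, `D ∘ y₁ - D ∘ y₂` is `σ₂ - σ₁`; each solution dissipates at least the power
of the other's stable force. -/
theorem eventually_deriv_increment_le (h₁ : IsApproxSolution T z₀ L D R η₁ β₁ y₁ σ₁ B₁)
    (h₂ : IsApproxSolution T z₀ L D R η₂ β₂ y₂ σ₂ B₂) {s : ℝ} (hs : s ∈ Ico 0 T) {ε : ℝ}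
    (hε : 0 < ε) : ∀ᶠ t in 𝓝[>] s,
      (D (y₁ s) - D (y₂ s)) ((y₁ t - y₂ t) - (y₁ s - y₂ s)) ≤
        3 * ((B₁ t - B₁ s) + (B₂ t - B₂ s)) + ε * (t - s) := by
  have hsT := Ico_subset_Icc_self hs
  filter_upwards [h₁.right_force s hs, h₂.right_force s hs, h₁.right_power s hs _ (half_pos hε),
    h₂.right_power s hs _ (half_pos hε), eventually_right_mem_Icc hs]
    with t hforce₁ hforce₂ hpower₁ hpower₂ ⟨hst, ht⟩
  set d₁ := y₁ t - y₁ s with hd₁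
  set d₂ := y₂ t - y₂ s with hd₂
  set e₁ := σ₁ s - (L s - D (y₁ s)) with he₁
  set e₂ := σ₂ s - (L s - D (y₂ s)) with he₂
  have hd : (y₁ t - y₂ t) - (y₁ s - y₂ s) = d₁ - d₂ := by rw [hd₁, hd₂]; abel
  have hDσ : D (y₁ s) - D (y₂ s) = (σ₂ s - σ₁ s) + (e₁ - e₂) := by rw [he₁, he₂]; abel
  have hstable : (σ₂ s - σ₁ s) (d₁ - d₂) ≤ (B₁ t - B₁ s) + (B₂ t - B₂ s) + ε * (t - s) := by
    have := h₂.stable s hsT d₁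
    have := h₁.stable s hsT d₂
    rw [map_sub, _root_.sub_apply, _root_.sub_apply]
    linarith
  have hdefect : (e₁ - e₂) (d₁ - d₂) ≤ 2 * ((B₁ t - B₁ s) + (B₂ t - B₂ s)) := by
    have hnorm : ‖d₁ - d₂‖ ≤ 2 * (t - s) := by
      linarith [_root_.norm_sub_le d₁ d₂, h₁.norm_sub_le hsT ht hst.le,
        h₂.norm_sub_le hsT ht hst.le]
    have := (dual_apply_le (e₁ - e₂) (d₁ - d₂)).trans
      (mul_le_mul (_root_.norm_sub_le e₁ e₂) hnorm (norm_nonneg _) (by positivity))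
    linarith
  rw [hd, hDσ, _root_.add_apply]
  linarith

theorem eventually_hessian_increment_le (hD : IsEnergyDeriv (‖z₀‖ + T) Λ C κ D H)
    (h₁ : IsApproxSolution T z₀ L D R η₁ β₁ y₁ σ₁ B₁)
    (h₂ : IsApproxSolution T z₀ L D R η₂ β₂ y₂ σ₂ B₂) {s : ℝ} (hs : s ∈ Ico 0 T) {ε : ℝ}
    (hε : 0 < ε) : ∀ᶠ t in 𝓝[>] s,
      H (y₁ t) (y₁ t - y₂ t) (y₁ t - y₂ t) - H (y₁ s) (y₁ s - y₂ s) (y₁ s - y₂ s) ≤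
        6 * C / κ * (t - s) * H (y₁ s) (y₁ s - y₂ s) (y₁ s - y₂ s)
          + (6 * (B₁ t + B₂ t) - 6 * (B₁ s + B₂ s)) + ε * (t - s) := by
  have hsT := Ico_subset_Icc_self hs
  have hsmall : ∀ᶠ t in 𝓝[>] s, 8 * C * (t - s) ^ 2 + 4 * Λ * (t - s) ≤ ε / 2 :=
    eventually_right_le_of_continuous (by fun_prop) (by ring) (half_pos hε)
  filter_upwards [h₁.eventually_deriv_increment_le h₂ hs (ε := ε / 4) (by positivity), hsmall,
    eventually_right_mem_Icc hs] with t hderiv hrem ⟨hst, ht⟩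
  have hquad := hD.quadratic_increment_le (h₁.norm_le hsT) (h₁.norm_le ht) (h₂.norm_le hsT)
    (h₁.norm_sub_le hsT ht hst.le) (h₂.norm_sub_le hsT ht hst.le)
  have hrem' := mul_le_mul_of_nonneg_right hrem (sub_pos.2 hst).le
  have hcoercive : 6 * C * (t - s) * ‖y₁ s - y₂ s‖ ^ 2
      ≤ 6 * C / κ * (t - s) * H (y₁ s) (y₁ s - y₂ s) (y₁ s - y₂ s) := by
    have := sub_pos.2 hst
    have := hD.pos
    have := hD.nonneg
    calc 6 * C * (t - s) * ‖y₁ s - y₂ s‖ ^ 2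
        = 6 * C / κ * (t - s) * (κ * ‖y₁ s - y₂ s‖ ^ 2) := by field_simp
      _ ≤ _ := mul_le_mul_of_nonneg_left (hD.coercive _ _) (by positivity)
  linarith

theorem sq_norm_sub_le (hD : IsEnergyDeriv (‖z₀‖ + T) Λ C κ D H)
    (h₁ : IsApproxSolution T z₀ L D R η₁ β₁ y₁ σ₁ B₁)
    (h₂ : IsApproxSolution T z₀ L D R η₂ β₂ y₂ σ₂ B₂) {t : ℝ} (ht : t ∈ Icc 0 T) :
    ‖y₁ t - y₂ t‖ ^ 2 ≤ 6 * Real.exp (6 * C / κ * T) / κ * (β₁ + β₂) := by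
  set f : ℝ → ℝ := fun t => H (y₁ t) (y₁ t - y₂ t) (y₁ t - y₂ t) with hf
  have hκ := hD.pos
  have hc : 0 ≤ 6 * C / κ := div_nonneg (mul_nonneg (by norm_num) hD.nonneg) hκ.le
  have hf0 : ∀ t, 0 ≤ f t := fun t => (by positivity : 0 ≤ κ * ‖y₁ t - y₂ t‖ ^ 2).trans
    (hD.coercive _ _)
  have hycont : ContinuousOn (fun t => y₁ t - y₂ t) (Icc 0 T) :=
    h₁.lipschitz.continuousOn.sub h₂.lipschitz.continuousOn
  have hfcont : ContinuousOn f (Icc 0 T) :=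
    ((hD.continuousOn_hessian.comp h₁.lipschitz.continuousOn fun t ht =>
      mem_closedBall_zero_iff.2 (h₁.norm_le ht)).clm_apply hycont).clm_apply hycont
  have hgronwall := gronwall_of_right_increments (G := fun t => 6 * (B₁ t + B₂ t)) hc hfcont
    ((h₁.continuousOn_defect.add h₂.continuousOn_defect).const_mul 6) (fun t _ => hf0 t)
    (fun s hs => by
      filter_upwards [h₁.eventually_defect_le hs, h₂.eventually_defect_le hs] with t hB₁ hB₂
      exact mul_le_mul_of_nonneg_left (add_le_add hB₁ hB₂) (by norm_num))
    (fun s hs ε hε => h₁.eventually_hessian_increment_le hD h₂ hs hε) ht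
  simp only [hf, h₁.init, h₂.init, sub_self, map_zero, h₁.defect_zero, h₂.defect_zero, add_zero,
    mul_zero, sub_zero, zero_add] at hgronwall
  rw [div_mul_eq_mul_div, le_div_iff₀ hκ, mul_comm _ κ]
  have hB : B₁ t + B₂ t ≤ β₁ + β₂ := add_le_add (h₁.defect_le t ht) (h₂.defect_le t ht)
  have hB0 : 0 ≤ Real.exp (6 * C / κ * t) * (6 * (B₁ t + B₂ t)) := (hf0 t).trans hgronwall
  calc κ * ‖y₁ t - y₂ t‖ ^ 2 ≤ f t := hD.coercive _ _
    _ ≤ Real.exp (6 * C / κ * t) * (6 * (B₁ t + B₂ t)) := hgronwall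
    _ ≤ Real.exp (6 * C / κ * T) * (6 * (β₁ + β₂)) := mul_le_mul
        (Real.exp_le_exp.2 (mul_le_mul_of_nonneg_left ht.2 hc)) (by linarith)
        (nonneg_of_mul_nonneg_right hB0 (Real.exp_pos _)) (Real.exp_pos _).le
    _ = 6 * Real.exp (6 * C / κ * T) * (β₁ + β₂) := by ring

end IsApproxSolution

end Approx

section Sublinear

variable {E : Type*} [NormedAddCommGroup E] [NormedSpace ℝ E] {ρ : ℝ} {R : E → ℝ}

/-- Nonnegative sublinear functionals with linear growth, such as dissipation potentials. -/
structure IsSublinear (ρ : ℝ) (R : E → ℝ) : Prop where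
  nonneg : ∀ v, 0 ≤ R v
  homogeneous : ∀ c : ℝ, 0 < c → ∀ v, R (c • v) = c * R v
  subadditive : ∀ u v, R (u + v) ≤ R u + R v
  growth : ∀ v, R v ≤ ρ * ‖v‖

namespace IsSublinear

theorem map_zero (hR : IsSublinear ρ R) : R 0 = 0 := by
  have := hR.homogeneous 2 two_pos 0
  rw [smul_zero] at this
  linarith

theorem sub_le (hR : IsSublinear ρ R) (u v : E) : R u - R v ≤ ρ * ‖u - v‖ := by
  have := hR.subadditive (u - v) v
  rw [sub_add_cancel] at this
  linarith [hR.growth (u - v)]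

theorem continuous (hR : IsSublinear ρ R) : Continuous R := by
  refine (LipschitzWith.of_dist_le_mul (K := ρ.toNNReal) fun u v => ?_).continuous
  rw [Real.dist_eq, dist_eq_norm]
  refine (abs_sub_le_iff.2 ⟨hR.sub_le u v, ?_⟩).trans
    (mul_le_mul_of_nonneg_right (Real.le_coe_toNNReal ρ) (norm_nonneg _))
  rw [norm_sub_rev]
  exact hR.sub_le v u

theorem norm_le_of_le (hR : IsSublinear ρ R) {g : E →ₗ[ℝ] ℝ} (hg : ∀ x, g x ≤ R x) (x : E) :
    ‖g x‖ ≤ ρ * ‖x‖ := by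
  have h := (hg (-x)).trans (hR.growth (-x))
  rw [map_neg, norm_neg] at h
  exact abs_le.2 ⟨by linarith, (hg x).trans (hR.growth x)⟩

theorem exists_support (hR : IsSublinear ρ R) (u : E) :
    ∃ ξ : StrongDual ℝ E, (∀ w, ξ w ≤ R w) ∧ ξ u = R u := by
  rcases eq_or_ne u 0 with rfl | hu
  · exact ⟨0, hR.nonneg, hR.map_zero.symm⟩
  let l : E →ₗ.[ℝ] ℝ := LinearPMap.mkSpanSingleton u (R u) hu
  have hle : ∀ x : l.domain, l x ≤ R x := by
    rintro ⟨x, hx⟩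
    obtain ⟨c, rfl⟩ := Submodule.mem_span_singleton.1 hx
    change LinearPMap.mkSpanSingleton' _ _ _ _ ≤ _
    rw [LinearPMap.mkSpanSingleton'_apply, smul_eq_mul]
    change c * R u ≤ R (c • u)
    rcases le_or_gt c 0 with hc | hc
    · exact (mul_nonpos_of_nonpos_of_nonneg hc (hR.nonneg u)).trans (hR.nonneg _)
    · rw [hR.homogeneous c hc]
  obtain ⟨g, hgl, hgR⟩ := exists_extension_of_le_sublinear l R hR.homogeneous hR.subadditive hle
  refine ⟨g.mkContinuous ρ (hR.norm_le_of_le hgR), hgR, ?_⟩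
  have := hgl ⟨u, Submodule.mem_span_singleton_self u⟩
  rwa [LinearPMap.mkSpanSingleton_apply] at this

end IsSublinear

end Sublinear

/-! ### Strong solutions -/

section Primitive

theorem exists_weak_limit {ι E : Type*} [NormedAddCommGroup E] [InnerProductSpace ℝ E]
    [CompleteSpace E] (l : Ultrafilter ι) {u : ι → E} {M : ℝ} (hu : ∀ i, ‖u i‖ ≤ M) :
    ∃ x, ∀ w, Tendsto (fun i => inner ℝ w (u i)) l (𝓝 (inner ℝ w x)) := by
  let φ : ι → WeakDual ℝ E := fun i =>
    StrongDual.toWeakDual (InnerProductSpace.toDual ℝ E (u i))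
  have hφ : (l.map φ : Filter (WeakDual ℝ E)) ≤
      𝓟 (WeakDual.toStrongDual ⁻¹' Metric.closedBall (0 : StrongDual ℝ E) M) := by
    refine le_principal_iff.2 (Eventually.of_forall (p := fun i => φ i ∈ _) fun i => ?_)
    exact mem_closedBall_zero_iff.2 (((InnerProductSpace.toDual ℝ E).norm_map _).trans_le (hu i))
  obtain ⟨x, -, hx⟩ := (WeakDual.isCompact_closedBall (𝕜 := ℝ)
    (0 : StrongDual ℝ E) M).ultrafilter_le_nhds _ hφ
  refine ⟨(InnerProductSpace.toDual ℝ E).symm (WeakDual.toStrongDual x), fun w => ?_⟩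
  have hlim : Tendsto (fun i => φ i w) l (𝓝 (x w)) :=
    ((WeakDual.eval_continuous w).tendsto x).comp hx
  have hx_inner : inner ℝ w ((InnerProductSpace.toDual ℝ E).symm (WeakDual.toStrongDual x))
      = x w := by
    rw [real_inner_comm, InnerProductSpace.toDual_symm_apply]
    rfl
  rw [hx_inner]
  exact hlim.congr fun i => real_inner_comm _ _

theorem tendsto_integral_diff_quotient {E : Type*} [NormedAddCommGroup E] [NormedSpace ℝ E]
    [CompleteSpace E] {z : ℝ → E} (hz : Continuous z) (t : ℝ) :
    Tendsto (fun n : ℕ => ∫ s in (0 : ℝ)..t, ((n : ℝ) + 1) • (z (s + 1 / ((n : ℝ) + 1)) - z s))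
      atTop (𝓝 (z t - z 0)) := by
  have hint : ∀ a b : ℝ, IntervalIntegrable z volume a b := fun a b => hz.intervalIntegrable a b
  have hmean : ∀ a : ℝ, Tendsto (fun n : ℕ => ((n : ℝ) + 1) • ∫ s in a..(a + 1 / ((n : ℝ) + 1)),
      z s) atTop (𝓝 (z a)) := fun a => by
    have hslope := hasDerivAt_iff_tendsto_slope_zero.1
      (intervalIntegral.integral_hasDerivAt_right (hint a a)
        (hz.stronglyMeasurableAtFilter _ _) hz.continuousAt)
    have hstep : Tendsto (fun n : ℕ => 1 / ((n : ℝ) + 1)) atTop (𝓝[≠] 0) :=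
      tendsto_nhdsWithin_iff.2 ⟨tendsto_one_div_add_atTop_nhds_zero_nat,
        Eventually.of_forall fun n => ne_of_gt (by positivity)⟩
    refine (hslope.comp hstep).congr fun n => ?_
    simp only [Function.comp_apply, one_div, inv_inv, intervalIntegral.integral_same, sub_zero]
  refine ((hmean t).sub (hmean 0)).congr fun n => ?_
  rw [intervalIntegral.integral_smul, ← smul_sub]
  congr 1
  set h := 1 / ((n : ℝ) + 1)
  rw [intervalIntegral.integral_sub (f := fun x => z (x + h))
    ((hz.comp (continuous_add_const h)).intervalIntegrable _ _) (hint _ _),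
    intervalIntegral.integral_comp_add_right z,
    intervalIntegral.integral_interval_sub_interval_comm' (hint _ _) (hint _ _) (hint _ _)]

theorem norm_diff_quotient_le_one {E : Type*} [NormedAddCommGroup E] [NormedSpace ℝ E]
    {z : ℝ → E} (hz : LipschitzWith 1 z) (s : ℝ) {h : ℝ} (hh : 0 < h) :
    ‖h⁻¹ • (z (s + h) - z s)‖ ≤ 1 := by
  have hzh := hz.dist_le_mul (s + h) s
  rw [dist_eq_norm, dist_eq_norm, NNReal.coe_one, one_mul, add_sub_cancel_left,
    Real.norm_of_nonneg hh.le] at hzh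
  rwa [norm_smul, norm_inv, Real.norm_of_nonneg hh.le, inv_mul_le_iff₀ hh, mul_one]

theorem exists_weak_limit_setIntegral {α ι E : Type*} [MeasurableSpace α] {μ : Measure α}
    [IsFiniteMeasure μ] [NormedAddCommGroup E] [InnerProductSpace ℝ E] [CompleteSpace E]
    (l : Ultrafilter ι) {g : ι → α → E} (hg : ∀ i, AEStronglyMeasurable (g i) μ) {M : NNReal}
    (hM : ∀ i x, ‖g i x‖ ≤ M) :
    ∃ G, MemLp G 2 μ ∧ ∀ S, MeasurableSet S → ∀ c,
      Tendsto (fun i => inner ℝ c (∫ x in S, g i x ∂μ)) l (𝓝 (inner ℝ c (∫ x in S, G x ∂μ))) := by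
  have hgL : ∀ i, MemLp (g i) 2 μ := fun i =>
    MemLp.of_bound (hg i) M (Eventually.of_forall (hM i))
  obtain ⟨G, hG⟩ := exists_weak_limit l (u := fun i => (hgL i).toLp (g i)) fun i =>
    Lp.norm_le_of_ae_bound M.coe_nonneg ((hgL i).coeFn_toLp.mono fun x hx => hx ▸ hM i x)
  refine ⟨G, Lp.memLp G, fun S hS c => ?_⟩
  have hinner : ∀ f : Lp E 2 μ, inner ℝ (indicatorConstLp 2 hS (measure_ne_top μ _) c) f
      = inner ℝ c (∫ x in S, f x ∂μ) := fun f =>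
    L2.inner_indicatorConstLp_eq_inner_setIntegral ℝ hS (measure_ne_top μ _) c f
  have h := hG (indicatorConstLp 2 hS (measure_ne_top μ _) c)
  simp only [hinner] at h
  refine h.congr fun i => congrArg _ (setIntegral_congr_ae hS ?_)
  exact (hgL i).coeFn_toLp.mono fun x hx _ => hx

/-- The derivative is a weak limit of difference quotients. -/
theorem exists_isSobolevDeriv_of_lipschitzWith {E : Type*} [NormedAddCommGroup E]
    [InnerProductSpace ℝ E] [CompleteSpace E] {T : ℝ} {z : ℝ → E} (hz : LipschitzWith 1 z) :
    ∃ g, IsSobolevDeriv 1 T z g := by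
  have hcont := hz.continuous
  have hbound : ∀ (n : ℕ) s, ‖((n : ℝ) + 1) • (z (s + 1 / ((n : ℝ) + 1)) - z s)‖ ≤ (1 : NNReal) :=
    fun n s => by
      simpa only [one_div, inv_inv, NNReal.coe_one] using
        norm_diff_quotient_le_one hz s (h := 1 / ((n : ℝ) + 1)) (by positivity)
  obtain ⟨G, hG, hlim⟩ := exists_weak_limit_setIntegral (μ := volume.restrict (Icc 0 T))
    (hyperfilter ℕ) (fun n => Continuous.aestronglyMeasurable (by fun_prop)) hbound
  refine ⟨G, hG.mono_exponent one_le_two, fun t ht => ?_⟩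
  have hint : ∀ f : ℝ → E, ∫ s in Ioc 0 t, f s ∂(volume.restrict (Icc 0 T))
      = ∫ s in (0 : ℝ)..t, f s := fun f => by
    rw [intervalIntegral.integral_of_le ht.1, Measure.restrict_restrict measurableSet_Ioc,
      inter_eq_left.2 (Ioc_subset_Icc_self.trans (Icc_subset_Icc_right ht.2))]
  have hprim : ∫ s in (0 : ℝ)..t, G s = z t - z 0 := ext_inner_left ℝ fun c => by
    have hweak := hlim _ (measurableSet_Ioc (a := 0) (b := t)) c
    simp only [hint] at hweak
    exact tendsto_nhds_unique hweak ((tendsto_const_nhds.inner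
      (tendsto_integral_diff_quotient hcont t)).mono_left Nat.hyperfilter_le_atTop)
  rw [hprim, add_sub_cancel]

theorem exists_isSobolevDeriv {E : Type*} [NormedAddCommGroup E] [InnerProductSpace ℝ E]
    [CompleteSpace E] {T : ℝ} (hT : 0 ≤ T) {z : ℝ → E} (hz : LipschitzOnWith 1 z (Icc 0 T)) :
    ∃ g, IsSobolevDeriv 1 T z g := by
  have hext : LipschitzWith (1 * 1) (IccExtend hT ((Icc 0 T).domRestrict z)) :=
    hz.to_restrict.comp (LipschitzWith.projIcc hT)
  rw [mul_one] at hext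
  have heq : ∀ t ∈ Icc 0 T, IccExtend hT ((Icc 0 T).domRestrict z) t = z t :=
    fun t ht => IccExtend_of_mem hT _ ht
  obtain ⟨g, hg⟩ := exists_isSobolevDeriv_of_lipschitzWith (T := T) hext
  refine ⟨g, hg.memLp, fun t ht => ?_⟩
  rw [← heq t ht, ← heq 0 (left_mem_Icc.2 hT)]
  exact hg.eq_primitive t ht

end Primitive

section Sobolev

variable {E : Type*} [NormedAddCommGroup E] [NormedSpace ℝ E] {T : ℝ} {z g : ℝ → E}

namespace IsSobolevDeriv

theorem intervalIntegrable (h : IsSobolevDeriv 1 T z g) {s t : ℝ} (hs : s ∈ Icc 0 T)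
    (ht : t ∈ Icc 0 T) : IntervalIntegrable g volume s t := by
  have hg : IntegrableOn g (Icc 0 T) := memLp_one_iff_integrable.1 h.memLp
  exact (hg.mono_set (uIcc_subset_Icc hs ht)).intervalIntegrable

theorem sub_eq (h : IsSobolevDeriv 1 T z g) {s t : ℝ} (hs : s ∈ Icc 0 T) (ht : t ∈ Icc 0 T) :
    z t - z s = ∫ r in s..t, g r := by
  have h0 : (0 : ℝ) ∈ Icc 0 T := left_mem_Icc.2 (hs.1.trans hs.2)
  rw [h.eq_primitive t ht, h.eq_primitive s hs, add_sub_add_left_eq_sub,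
    intervalIntegral.integral_interval_sub_left (h.intervalIntegrable h0 ht)
      (h.intervalIntegrable h0 hs)]

theorem continuousOn (hT : 0 ≤ T) (h : IsSobolevDeriv 1 T z g) : ContinuousOn z (Icc 0 T) := by
  have hg : IntegrableOn g (uIcc 0 T) := by
    rw [uIcc_of_le hT]
    exact memLp_one_iff_integrable.1 h.memLp
  have hprim := intervalIntegral.continuousOn_primitive_interval hg
  rw [uIcc_of_le hT] at hprim
  exact (continuousOn_const.add hprim).congr h.eq_primitive

theorem ae_hasDerivAt [CompleteSpace E] (hT : 0 ≤ T) (h : IsSobolevDeriv 1 T z g) :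
    ∀ᵐ t ∂(volume.restrict (Icc 0 T)), t ∈ Ioo 0 T ∧ HasDerivAt z (g t) t := by
  have h0 : (0 : ℝ) ∈ Icc 0 T := left_mem_Icc.2 hT
  have hprim := (h.intervalIntegrable h0 (right_mem_Icc.2 hT)).ae_hasDerivAt_integral
  rw [uIcc_of_le hT] at hprim
  rw [← restrict_Ioo_eq_restrict_Icc, ae_restrict_iff' measurableSet_Ioo]
  filter_upwards [hprim] with t hderiv ht
  refine ⟨ht, ((hderiv (Ioo_subset_Icc_self ht) 0 h0).const_add (z 0)).congr_of_eventuallyEq ?_⟩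
  filter_upwards [Icc_mem_nhds ht.1 ht.2] with s hs
  exact h.eq_primitive s hs

end IsSobolevDeriv

end Sobolev

section StrongSolution

variable {Z : Type*} [NormedAddCommGroup Z] [NormedSpace ℝ Z] {r Λ C κ M ρ T η β : ℝ}
  {D : Z → StrongDual ℝ Z} {H : Z → Z →L[ℝ] StrongDual ℝ Z} {L σ : ℝ → StrongDual ℝ Z}
  {R : Z → ℝ} {z₀ : Z} {y z z' : ℝ → Z} {B : ℝ → ℝ}

/-- Strong solutions of `0 ∈ ∂R(z') + D(z) - L`, for sublinear `R`, in terms of stability and power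
balance. -/
def IsStrongSolution (T : ℝ) (z₀ : Z) (L : ℝ → StrongDual ℝ Z) (D : Z → StrongDual ℝ Z)
    (R : Z → ℝ) (z : ℝ → Z) : Prop :=
  ∃ z' : ℝ → Z, IsSobolevDeriv 1 T z z' ∧ z 0 = z₀ ∧
    ∀ᵐ t ∂(volume.restrict (Icc 0 T)),
      (∀ w, (L t - D (z t)) w ≤ R w) ∧ R (z' t) ≤ (L t - D (z t)) (z' t)

theorem IsEnergyDeriv.norm_force_sub_le (hD : IsEnergyDeriv r Λ C κ D H)
    (hL : ∀ s ∈ Icc 0 T, ∀ t ∈ Icc 0 T, ‖L s - L t‖ ≤ M * |s - t|)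
    (hz : LipschitzOnWith 1 z (Icc 0 T)) (hball : ∀ t ∈ Icc 0 T, ‖z t‖ ≤ r) {s t : ℝ}
    (hs : s ∈ Icc 0 T) (ht : t ∈ Icc 0 T) (hst : s ≤ t) :
    ‖(L t - D (z t)) - (L s - D (z s))‖ ≤ (M + Λ) * (t - s) := by
  have hL_ts := hL t ht s hs
  rw [abs_of_nonneg (sub_nonneg.2 hst)] at hL_ts
  have hD_ts := (hD.norm_sub_le (hball t ht) (hball s hs)).trans
    (mul_le_mul_of_nonneg_left (lipschitzOnWith_one_iff.1 hz s hs t ht hst)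
      (hD.bound_nonneg (hball t ht)))
  rw [sub_sub_sub_comm]
  linarith [_root_.norm_sub_le (L t - L s) (D (z t) - D (z s))]

theorem stable_of_ae_stable (hT : 0 < T) (hσ : ContinuousOn σ (Icc 0 T))
    (h : ∀ᵐ t ∂(volume.restrict (Icc 0 T)), ∀ w, σ t w ≤ R w) {t : ℝ} (ht : t ∈ Icc 0 T) (w : Z) :
    σ t w ≤ R w := by
  have hae : (fun t => max (σ t w - R w) 0) =ᵐ[volume.restrict (Icc 0 T)] fun _ => 0 :=
    h.mono fun s hs => max_eq_right (sub_nonpos.2 (hs w))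
  have hcont : ContinuousOn (fun t => max (σ t w - R w) 0) (Icc 0 T) :=
    ((hσ.clm_apply continuousOn_const).sub continuousOn_const).sup continuousOn_const
  exact sub_nonpos.1 (max_eq_right_iff.1
    (Measure.eqOn_Icc_of_ae_eq volume hT.ne hae hcont continuousOn_const ht))

/-- By stability at earlier times, `s ↦ (L s - D (z s)) v` is maximal at `t`, so the left derivative
of `s ↦ D (z s) v` there is at most `κ * ‖v‖`. -/
theorem IsEnergyDeriv.norm_velocity_le_one (hD : IsEnergyDeriv r Λ C κ D H)
    (hL : ∀ s ∈ Icc 0 T, ∀ t ∈ Icc 0 T, ‖L s - L t‖ ≤ κ * |s - t|)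
    (hstable : ∀ t ∈ Icc 0 T, ∀ w, (L t - D (z t)) w ≤ R w) {t : ℝ} (ht : t ∈ Ioo 0 T) {v : Z}
    (hz : HasDerivAt z v t) (hpower : R v ≤ (L t - D (z t)) v) : ‖v‖ ≤ 1 := by
  have hderiv : HasDerivAt (fun s => D (z s) v) (H (z t) v v) t := by
    have hDz : HasDerivAt (fun s => D (z s)) (H (z t) v) t :=
      (hD.hasFDerivAt (z t)).comp_hasDerivAt t hz
    have h := hDz.clm_apply (hasDerivAt_const t v)
    rwa [map_zero, add_zero] at h
  have hslope := (hasDerivAt_iff_tendsto_slope.1 hderiv).mono_left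
    (nhdsWithin_mono t fun s (hs : s < t) => ne_of_lt hs : 𝓝[<] t ≤ 𝓝[≠] t)
  have hle : H (z t) v v ≤ κ * ‖v‖ := by
    refine le_of_tendsto hslope ?_
    filter_upwards [Ioo_mem_nhdsLT ht.1] with s hs
    have hsT : s ∈ Icc 0 T := ⟨hs.1.le, hs.2.le.trans ht.2.le⟩
    have hst : 0 < t - s := sub_pos.2 hs.2
    have hmax := (hstable s hsT v).trans hpower
    have hload := (dual_apply_le (L t - L s) v).trans
      (mul_le_mul_of_nonneg_right (hL t (Ioo_subset_Icc_self ht) s hsT) (norm_nonneg v))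
    rw [abs_of_pos hst] at hload
    rw [slope_comm, slope_def_field, div_le_iff₀ hst]
    simp only [_root_.sub_apply] at hmax hload
    linarith
  have hcoercive := (hD.coercive (z t) v).trans hle
  by_contra! hv
  nlinarith [mul_pos hD.pos (by linarith : 0 < ‖v‖)]

theorem IsSobolevDeriv.lipschitzOnWith_one (h : IsSobolevDeriv 1 T z z')
    (hz' : ∀ᵐ t ∂(volume.restrict (Icc 0 T)), ‖z' t‖ ≤ 1) : LipschitzOnWith 1 z (Icc 0 T) := by
  refine lipschitzOnWith_one_iff.2 fun s hs t ht hst => ?_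
  rw [ae_restrict_iff' measurableSet_Icc] at hz'
  have hint : ‖∫ x in s..t, z' x‖ ≤ 1 * |t - s| :=
    intervalIntegral.norm_integral_le_of_norm_le_const_ae <| hz'.mono fun x hx hxst => by
      rw [uIoc_of_le hst] at hxst
      exact hx ⟨hs.1.trans hxst.1.le, hxst.2.trans ht.2⟩
  rwa [one_mul, abs_of_nonneg (sub_nonneg.2 hst), ← h.sub_eq hs ht] at hint

/-- Integrate the pointwise power balance against a subgradient of `R` at the increment. -/
theorem IsSobolevDeriv.dissipation_le [CompleteSpace Z] (h : IsSobolevDeriv 1 T z z')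
    (hR : IsSublinear ρ R) (hz' : ∀ᵐ t ∂(volume.restrict (Icc 0 T)), ‖z' t‖ ≤ 1)
    (hpower : ∀ᵐ t ∂(volume.restrict (Icc 0 T)), R (z' t) ≤ σ t (z' t))
    {s t : ℝ} (hs : s ∈ Icc 0 T) (ht : t ∈ Icc 0 T) (hst : s ≤ t) {c : ℝ}
    (hσ : ∀ x ∈ Icc s t, ‖σ x - σ s‖ ≤ c) : R (z t - z s) ≤ σ s (z t - z s) + c * (t - s) := by
  obtain ⟨ξ, hξ_le, hξ_eq⟩ := hR.exists_support (z t - z s)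
  have hint := h.intervalIntegrable hs ht
  have hc : 0 ≤ c := (norm_nonneg _).trans (hσ s (left_mem_Icc.2 hst))
  have hsub : Ioc s t ⊆ Icc 0 T := fun x hx => ⟨hs.1.trans hx.1.le, hx.2.trans ht.2⟩
  have hpointwise : ∀ᵐ x ∂(volume.restrict (Ioc s t)), (ξ - σ s) (z' x) ≤ c := by
    filter_upwards [ae_restrict_of_ae_restrict_of_subset hsub hpower,
      ae_restrict_of_ae_restrict_of_subset hsub hz', ae_restrict_mem measurableSet_Ioc]
      with x hpower_x hz'_x hx
    have hforce := (dual_apply_le (σ x - σ s) (z' x)).trans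
      (mul_le_mul (hσ x (Ioc_subset_Icc_self hx)) hz'_x (norm_nonneg _) hc)
    simp only [_root_.sub_apply] at hforce ⊢
    linarith [hξ_le (z' x)]
  have hintegral : (ξ - σ s) (z t - z s) ≤ c * (t - s) :=
    calc (ξ - σ s) (z t - z s) = ∫ x in s..t, (ξ - σ s) (z' x) := by
          rw [h.sub_eq hs ht, ContinuousLinearMap.intervalIntegral_comp_comm _ hint]
      _ ≤ ∫ _ in s..t, c := by
          rw [intervalIntegral.integral_of_le hst, intervalIntegral.integral_of_le hst]
          exact setIntegral_mono_ae_restrict (ContinuousLinearMap.integrable_comp _ hint.1)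
            continuous_const.integrableOn_Ioc hpointwise
      _ = c * (t - s) := by rw [intervalIntegral.integral_const, smul_eq_mul, mul_comm]
  rw [_root_.sub_apply, hξ_eq] at hintegral
  linarith

theorem IsStrongSolution.isApproxSolution [CompleteSpace Z]
    (hD : IsEnergyDeriv (‖z₀‖ + T) Λ C κ D H) (hR : IsSublinear ρ R) (hT : 0 < T)
    (hL : ∀ s ∈ Icc 0 T, ∀ t ∈ Icc 0 T, ‖L s - L t‖ ≤ κ * |s - t|)
    (hz : IsStrongSolution T z₀ L D R z) :
    IsApproxSolution T z₀ L D R 0 0 z (fun t => L t - D (z t)) 0 := by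
  obtain ⟨z', hz', hz0, hae⟩ := hz
  have hcont : ContinuousOn (fun t => L t - D (z t)) (Icc 0 T) :=
    (continuousOn_of_norm_sub_le hL).sub (hD.continuous.comp_continuousOn (hz'.continuousOn hT.le))
  have hstable : ∀ t ∈ Icc 0 T, ∀ w, (L t - D (z t)) w ≤ R w := fun t ht =>
    stable_of_ae_stable hT hcont (hae.mono fun t ht => ht.1) ht
  have hvelocity : ∀ᵐ t ∂(volume.restrict (Icc 0 T)), ‖z' t‖ ≤ 1 := by
    filter_upwards [hae, hz'.ae_hasDerivAt hT.le] with t ⟨_, hpower⟩ ⟨ht, hderiv⟩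
    exact hD.norm_velocity_le_one hL hstable ht hderiv hpower
  have hlip := hz'.lipschitzOnWith_one hvelocity
  have hball : ∀ t ∈ Icc 0 T, ‖z t‖ ≤ ‖z₀‖ + T := fun t ht =>
    hz0 ▸ norm_le_of_lipschitzOnWith_one hlip ht
  have hM : 0 ≤ κ + Λ := add_nonneg hD.pos.le (hD.bound_nonneg (hball 0 (left_mem_Icc.2 hT.le)))
  refine ⟨hz0, hlip, hstable, fun t _ => by rw [sub_self, norm_zero], continuousOn_const, rfl,
    fun t _ => le_rfl, fun s _ => .of_forall fun t => by simp, fun s hs ε hε => ?_⟩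
  have hsmall : ∀ᶠ t in 𝓝[>] s, (κ + Λ) * (t - s) ≤ ε :=
    eventually_right_le_of_continuous (by fun_prop) (by ring) hε
  filter_upwards [eventually_right_mem_Icc hs, hsmall] with t ⟨hst, ht⟩ hε_le
  have hpower := hz'.dissipation_le hR hvelocity (hae.mono fun t ht => ht.2)
    (Ico_subset_Icc_self hs) ht hst.le fun x hx =>
      ((hD.norm_force_sub_le hL hlip hball (Ico_subset_Icc_self hs)
        ⟨hs.1.trans hx.1, hx.2.trans ht.2⟩ hx.1).trans
        (mul_le_mul_of_nonneg_left (sub_le_sub_right hx.2 s) hM)).trans hε_le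
  simpa only [Pi.zero_apply, sub_self, add_zero] using hpower

theorem isStrongSolution_of_dissipation_le {E : Type*} [NormedAddCommGroup E]
    [InnerProductSpace ℝ E] [CompleteSpace E] {D : E → StrongDual ℝ E} {L : ℝ → StrongDual ℝ E}
    {R : E → ℝ} {z₀ : E} {z : ℝ → E} (hR : IsSublinear ρ R) (hT : 0 ≤ T)
    (hz : LipschitzOnWith 1 z (Icc 0 T)) (hz0 : z 0 = z₀)
    (hstable : ∀ t ∈ Icc 0 T, ∀ w, (L t - D (z t)) w ≤ R w)
    (hpower : ∀ s ∈ Icc 0 T, ∀ t ∈ Icc 0 T, s ≤ t →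
      R (z t - z s) ≤ (L s - D (z s)) (z t - z s) + M * (t - s) * (t - s)) :
    IsStrongSolution T z₀ L D R z := by
  obtain ⟨z', hz'⟩ := exists_isSobolevDeriv hT hz
  refine ⟨z', hz', hz0, ?_⟩
  filter_upwards [hz'.ae_hasDerivAt hT] with t ⟨ht, hderiv⟩
  have htT := Ioo_subset_Icc_self ht
  refine ⟨hstable t htT, ?_⟩
  have hslope := (hasDerivAt_iff_tendsto_slope.1 hderiv).mono_left
    (nhdsWithin_mono t fun s (hs : t < s) => ne_of_gt hs : 𝓝[>] t ≤ 𝓝[≠] t)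
  have herror : Tendsto (fun s => M * (s - t)) (𝓝[>] t) (𝓝 0) := by
    have hcont : Continuous fun s => M * (s - t) := by fun_prop
    simpa only [sub_self, mul_zero] using (hcont.tendsto t).mono_left nhdsWithin_le_nhds
  have hforce := (((L t - D (z t)).continuous.tendsto _).comp hslope).add herror
  rw [add_zero] at hforce
  refine le_of_tendsto_of_tendsto ((hR.continuous.tendsto _).comp hslope) hforce ?_
  filter_upwards [Ioo_mem_nhdsGT ht.2] with s hs
  have hst : 0 < s - t := sub_pos.2 hs.1
  have hslope_eq : z s - z t = (s - t) • slope z t s := by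
    rw [slope_def_module, smul_inv_smul₀ hst.ne']
  have h := hpower t htT s ⟨ht.1.le.trans hs.1.le, hs.2.le⟩ hs.1.le
  rw [hslope_eq, hR.homogeneous _ hst, map_smul, smul_eq_mul] at h
  refine le_of_mul_le_mul_left ?_ hst
  simp only [Function.comp_apply]
  linarith

end StrongSolution

section Limit

variable {Z : Type*} [NormedAddCommGroup Z] [NormedSpace ℝ Z] {Λ C κ M ρ T : ℝ}
  {D : Z → StrongDual ℝ Z} {H : Z → Z →L[ℝ] StrongDual ℝ Z} {L : ℝ → StrongDual ℝ Z}
  {R : Z → ℝ} {z₀ : Z}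

namespace IsApproxSolution

theorem norm_stable_force_sub_le {η β : ℝ} {y : ℝ → Z} {σ : ℝ → StrongDual ℝ Z} {B : ℝ → ℝ}
    (hy : IsApproxSolution T z₀ L D R η β y σ B) (hD : IsEnergyDeriv (‖z₀‖ + T) Λ C κ D H)
    (hL : ∀ s ∈ Icc 0 T, ∀ t ∈ Icc 0 T, ‖L s - L t‖ ≤ M * |s - t|) {s t : ℝ}
    (hs : s ∈ Icc 0 T) (ht : t ∈ Icc 0 T) (hst : s ≤ t) :
    ‖σ t - σ s‖ ≤ (M + Λ) * (t - s) + 2 * η := by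
  have hforce := hD.norm_force_sub_le hL hy.lipschitz (fun t ht => hy.norm_le ht) hs ht hst
  have hdefect := norm_sub_le_norm_sub_add_norm_sub (σ t) (L t - D (y t)) (σ s)
  have hforce_s := norm_sub_le_norm_sub_add_norm_sub (L t - D (y t)) (L s - D (y s)) (σ s)
  have hη := hy.force s hs
  rw [norm_sub_rev] at hη
  linarith [hy.force t ht]

theorem dissipation_le {η β : ℝ} {y : ℝ → Z} {σ : ℝ → StrongDual ℝ Z} {B : ℝ → ℝ}
    (hy : IsApproxSolution T z₀ L D R η β y σ B) (hR : IsSublinear ρ R) {s t : ℝ}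
    (hs : s ∈ Icc 0 T) (ht : t ∈ Icc 0 T) (hst : s ≤ t) {c : ℝ}
    (hσ : ∀ x ∈ Icc s t, ‖σ x - σ s‖ ≤ c) :
    R (y t - y s) ≤ σ s (y t - y s) + (B t - B s) + c * (t - s) := by
  have hsub : Icc s t ⊆ Icc 0 T := Icc_subset_Icc hs.1 ht.2
  have hycont : ContinuousOn (fun x => y x - y s) (Icc s t) :=
    (hy.lipschitz.continuousOn.mono hsub).sub continuousOn_const
  have key := le_of_right_increments
    (f := fun x => R (y x - y s) - σ s (y x - y s) - B x - c * x) hst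
    ((((hR.continuous.comp_continuousOn hycont).sub (continuousOn_const.clm_apply hycont)).sub
      (hy.continuousOn_defect.mono hsub)).sub (continuousOn_const.mul continuousOn_id)) ?_
  · simp only [sub_self, hR.map_zero, _root_.map_zero] at key
    linarith
  intro x hx ε hε
  have hxT : x ∈ Ico 0 T := ⟨hs.1.trans hx.1, hx.2.trans_le ht.2⟩
  filter_upwards [hy.right_power x hxT ε hε, eventually_right_mem_Icc hxT] with u hpower ⟨hxu, hu⟩
  have htriangle := hR.subadditive (y u - y x) (y x - y s)
  rw [sub_add_sub_cancel] at htriangle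
  have hforce := (dual_apply_le (σ x - σ s) (y u - y x)).trans
    (mul_le_mul (hσ x (Ico_subset_Icc_self hx))
      (hy.norm_sub_le (Ico_subset_Icc_self hxT) hu hxu.le) (norm_nonneg _)
      ((norm_nonneg _).trans (hσ x (Ico_subset_Icc_self hx))))
  have hsplit : σ s (y u - y s) - σ s (y x - y s) = σ s (y u - y x) := by
    rw [← map_sub, sub_sub_sub_cancel_right]
  rw [_root_.sub_apply] at hforce
  linarith

theorem defect_nonneg {η β : ℝ} {y : ℝ → Z} {σ : ℝ → StrongDual ℝ Z} {B : ℝ → ℝ}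
    (hy : IsApproxSolution T z₀ L D R η β y σ B) {t : ℝ} (ht : t ∈ Icc 0 T) : 0 ≤ B t := by
  have h := le_of_right_increments (f := fun x => -B x) ht.1
    (hy.continuousOn_defect.mono (Icc_subset_Icc_right ht.2)).neg fun s hs ε hε => by
      filter_upwards [hy.eventually_defect_le ⟨hs.1, hs.2.trans_le ht.2⟩, self_mem_nhdsWithin]
        with u hB hsu
      linarith [mul_pos hε (sub_pos.2 hsu)]
  rw [hy.defect_zero] at h
  linarith

variable {η β : ℕ → ℝ} {y : ℕ → ℝ → Z} {σ : ℕ → ℝ → StrongDual ℝ Z} {B : ℕ → ℝ → ℝ} {z : ℝ → Z}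

theorem cauchySeq (hD : IsEnergyDeriv (‖z₀‖ + T) Λ C κ D H)
    (hy : ∀ n, IsApproxSolution T z₀ L D R (η n) (β n) (y n) (σ n) (B n))
    (hβ : Tendsto β atTop (𝓝 0)) {t : ℝ} (ht : t ∈ Icc 0 T) : CauchySeq fun n => y n t := by
  rw [cauchySeq_iff_tendsto_dist_atTop_0]
  have hβ₂ : Tendsto (fun n : ℕ × ℕ => √(6 * Real.exp (6 * C / κ * T) / κ * (β n.1 + β n.2)))
      atTop (𝓝 0) := by
    rw [← prod_atTop_atTop_eq]
    simpa only [add_zero, mul_zero, Real.sqrt_zero, Function.comp_apply] using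
      (((hβ.comp tendsto_fst).add (hβ.comp tendsto_snd)).const_mul _).sqrt
  refine squeeze_zero (fun _ => dist_nonneg) (fun n => ?_) hβ₂
  rw [dist_eq_norm]
  exact Real.le_sqrt_of_sq_le ((hy n.1).sq_norm_sub_le hD (hy n.2) ht)

theorem lipschitzOnWith_one_of_tendsto
    (hy : ∀ n, IsApproxSolution T z₀ L D R (η n) (β n) (y n) (σ n) (B n))
    (hz : ∀ t ∈ Icc 0 T, Tendsto (fun n => y n t) atTop (𝓝 (z t))) :
    LipschitzOnWith 1 z (Icc 0 T) :=
  lipschitzOnWith_one_iff.2 fun s hs t ht hst => le_of_tendsto ((hz t ht).sub (hz s hs)).norm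
    (Eventually.of_forall fun n => (hy n).norm_sub_le hs ht hst)

theorem tendsto_stable_force (hD : Continuous D)
    (hy : ∀ n, IsApproxSolution T z₀ L D R (η n) (β n) (y n) (σ n) (B n))
    (hη : Tendsto η atTop (𝓝 0)) {t : ℝ} (ht : t ∈ Icc 0 T) {x : Z}
    (hx : Tendsto (fun n => y n t) atTop (𝓝 x)) :
    Tendsto (fun n => σ n t) atTop (𝓝 (L t - D x)) := by
  have hdefect : Tendsto (fun n => σ n t - (L t - D (y n t))) atTop (𝓝 0) :=
    squeeze_zero_norm (fun n => (hy n).force t ht) hη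
  simpa only [sub_add_cancel, zero_add, Function.comp_apply] using
    hdefect.add ((tendsto_const_nhds (x := L t)).sub ((hD.tendsto x).comp hx))

theorem dissipation_le_of_tendsto (hD : IsEnergyDeriv (‖z₀‖ + T) Λ C κ D H)
    (hR : IsSublinear ρ R) (hL : ∀ s ∈ Icc 0 T, ∀ t ∈ Icc 0 T, ‖L s - L t‖ ≤ M * |s - t|)
    (hM : 0 ≤ M) (hy : ∀ n, IsApproxSolution T z₀ L D R (η n) (β n) (y n) (σ n) (B n))
    (hη : Tendsto η atTop (𝓝 0)) (hβ : Tendsto β atTop (𝓝 0))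
    (hz : ∀ t ∈ Icc 0 T, Tendsto (fun n => y n t) atTop (𝓝 (z t))) {s t : ℝ}
    (hs : s ∈ Icc 0 T) (ht : t ∈ Icc 0 T) (hst : s ≤ t) :
    R (z t - z s) ≤ (L s - D (z s)) (z t - z s) + (M + Λ) * (t - s) * (t - s) := by
  have hincr := (hz t ht).sub (hz s hs)
  have hpower : Tendsto (fun n => σ n s (y n t - y n s)) atTop
      (𝓝 ((L s - D (z s)) (z t - z s))) :=
    (isBoundedBilinearMap_apply.continuous.tendsto _).comp
      ((tendsto_stable_force hD.continuous hy hη hs (hz s hs)).prodMk_nhds hincr)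
  have hlim := (hpower.add hβ).add
    (((tendsto_const_nhds (x := (M + Λ) * (t - s))).add (hη.const_mul 2)).mul_const (t - s))
  simp only [mul_zero, add_zero] at hlim
  refine le_of_tendsto_of_tendsto ((hR.continuous.tendsto _).comp hincr) hlim
    (Eventually.of_forall fun n => ?_)
  have hMΛ : 0 ≤ M + Λ := add_nonneg hM (hD.bound_nonneg ((hy n).norm_le hs))
  have hn := (hy n).dissipation_le hR hs ht hst fun x hx =>
    ((hy n).norm_stable_force_sub_le hD hL hs ⟨hs.1.trans hx.1, hx.2.trans ht.2⟩ hx.1).trans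
      (add_le_add_left (mul_le_mul_of_nonneg_left (sub_le_sub_right hx.2 s) hMΛ) _)
  simp only [Function.comp_apply]
  linarith [(hy n).defect_le t ht, (hy n).defect_nonneg hs]

end IsApproxSolution

theorem exists_isStrongSolution {E : Type*} [NormedAddCommGroup E]
    [InnerProductSpace ℝ E] [CompleteSpace E] {D : E → StrongDual ℝ E}
    {H : E → E →L[ℝ] StrongDual ℝ E} {L : ℝ → StrongDual ℝ E} {R : E → ℝ} {z₀ : E}
    (hD : IsEnergyDeriv (‖z₀‖ + T) Λ C κ D H) (hR : IsSublinear ρ R) (hT : 0 ≤ T)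
    (hL : ∀ s ∈ Icc 0 T, ∀ t ∈ Icc 0 T, ‖L s - L t‖ ≤ M * |s - t|) (hM : 0 ≤ M)
    {η β : ℕ → ℝ} (hη : Tendsto η atTop (𝓝 0)) (hβ : Tendsto β atTop (𝓝 0))
    (h : ∀ n, ∃ y σ B, IsApproxSolution T z₀ L D R (η n) (β n) y σ B) :
    ∃ z, IsStrongSolution T z₀ L D R z := by
  choose y σ B hy using h
  have hlim : ∀ t ∈ Icc 0 T, Tendsto (fun n => y n t) atTop (𝓝 (limUnder atTop fun n => y n t)) :=
    fun t ht => (IsApproxSolution.cauchySeq hD hy hβ ht).tendsto_limUnder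
  have h0 : (0 : ℝ) ∈ Icc 0 T := left_mem_Icc.2 hT
  refine ⟨_, isStrongSolution_of_dissipation_le hR hT
    (IsApproxSolution.lipschitzOnWith_one_of_tendsto hy hlim) ?_ (fun t ht w => ?_)
    fun s hs t ht hst =>
      IsApproxSolution.dissipation_le_of_tendsto hD hR hL hM hy hη hβ hlim hs ht hst⟩
  · exact tendsto_nhds_unique (hlim 0 h0) (tendsto_const_nhds.congr fun n => (hy n).init.symm)
  · exact le_of_tendsto (((ContinuousLinearMap.apply ℝ ℝ w).continuous.tendsto _).comp
      (IsApproxSolution.tendsto_stable_force hD.continuous hy hη ht (hlim t ht)))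
      (Eventually.of_forall fun n => (hy n).stable t ht w)

end Limit

/-! ### Implicit incremental schemes -/

section Interp

variable {E : Type*} [NormedAddCommGroup E] [NormedSpace ℝ E]

/-- The continuous, piecewise affine function with value `x k` at the grid point `t k` for
`k ≤ N`. The increments are switched on one after the other, which makes continuity evident. -/
noncomputable def interp (t : ℕ → ℝ) (N : ℕ) (x : ℕ → E) (r : ℝ) : E :=
  x 0 + ∑ i ∈ Finset.range N, max 0 (min 1 ((r - t i) / (t (i + 1) - t i))) • (x (i + 1) - x i)

variable {t : ℕ → ℝ} {N : ℕ}

theorem continuous_interp (t : ℕ → ℝ) (N : ℕ) (x : ℕ → E) : Continuous (interp t N x) := by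
  unfold interp
  fun_prop

theorem grid_le (ht : ∀ k < N, t k < t (k + 1)) {i j : ℕ} (hij : i ≤ j) (hj : j ≤ N) :
    t i ≤ t j := by
  induction j, hij using Nat.le_induction with
  | base => exact le_rfl
  | succ k _ ih => exact (ih (by omega)).trans (ht k (by omega)).le

theorem grid_ratio_mem (ht : ∀ k < N, t k < t (k + 1)) {k : ℕ} (hk : k < N) {r : ℝ}
    (hr : r ∈ Icc (t k) (t (k + 1))) : (r - t k) / (t (k + 1) - t k) ∈ Icc (0 : ℝ) 1 :=
  unitInterval.div_mem (sub_nonneg.2 hr.1) (sub_pos.2 (ht k hk)).le (sub_le_sub_right hr.2 _)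

theorem interp_of_mem (ht : ∀ k < N, t k < t (k + 1)) (x : ℕ → E) {k : ℕ} (hk : k < N) {r : ℝ}
    (hr : r ∈ Icc (t k) (t (k + 1))) :
    interp t N x r = x k + ((r - t k) / (t (k + 1) - t k)) • (x (k + 1) - x k) := by
  have hbefore : ∀ i ∈ Finset.range k, max 0 (min 1 ((r - t i) / (t (i + 1) - t i))) •
      (x (i + 1) - x i) = x (i + 1) - x i := by
    intro i hi
    have hik := Finset.mem_range.1 hi
    have hge : 1 ≤ (r - t i) / (t (i + 1) - t i) := by
      rw [one_le_div (sub_pos.2 (ht i (hik.trans hk)))]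
      linarith [grid_le ht hik hk.le, hr.1]
    rw [min_eq_left hge, max_eq_right zero_le_one, one_smul]
  have hafter : ∀ i ∈ Finset.range N, i ∉ Finset.range (k + 1) →
      max 0 (min 1 ((r - t i) / (t (i + 1) - t i))) • (x (i + 1) - x i) = 0 := by
    intro i hi hik
    rw [Finset.mem_range] at hi hik
    have hle : (r - t i) / (t (i + 1) - t i) ≤ 0 := div_nonpos_of_nonpos_of_nonneg
      (by linarith [grid_le ht (not_lt.1 hik) hi.le, hr.2]) (sub_pos.2 (ht i hi)).le
    rw [max_eq_left ((min_le_right _ _).trans hle), zero_smul]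
  obtain ⟨h0, h1⟩ := grid_ratio_mem ht hk hr
  rw [interp, ← Finset.sum_subset (Finset.range_subset_range.2 hk) hafter, Finset.sum_range_succ,
    Finset.sum_congr rfl hbefore, Finset.sum_range_sub, min_eq_right h1, max_eq_right h0,
    ← add_assoc, add_sub_cancel]

theorem interp_sub_of_mem (ht : ∀ k < N, t k < t (k + 1)) (x : ℕ → E) {k : ℕ} (hk : k < N)
    {r s : ℝ} (hr : r ∈ Icc (t k) (t (k + 1))) (hs : s ∈ Icc (t k) (t (k + 1))) :
    interp t N x r - interp t N x s = ((r - s) / (t (k + 1) - t k)) • (x (k + 1) - x k) := by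
  rw [interp_of_mem ht x hk hr, interp_of_mem ht x hk hs, add_sub_add_left_eq_sub, ← sub_smul,
    ← sub_div, sub_sub_sub_cancel_right]

theorem interp_left (ht : ∀ k < N, t k < t (k + 1)) (x : ℕ → E) {k : ℕ} (hk : k < N) :
    interp t N x (t k) = x k := by
  rw [interp_of_mem ht x hk (left_mem_Icc.2 (ht k hk).le), sub_self, zero_div, zero_smul, add_zero]

theorem exists_cell {s : ℝ} (hs : s ∈ Ico (t 0) (t N)) :
    ∃ k < N, s ∈ Ico (t k) (t (k + 1)) := by
  by_contra! hcell
  have hle : ∀ k ≤ N, t k ≤ s := fun k => by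
    induction k with
    | zero => exact fun _ => hs.1
    | succ k ih => exact fun hk => not_lt.1 fun hlt => hcell k hk ⟨ih (by omega), hlt⟩
  exact (hle N le_rfl).not_gt hs.2

theorem exists_closed_cell (ht : ∀ k < N, t k < t (k + 1)) (hN : 0 < N) {s : ℝ}
    (hs : s ∈ Icc (t 0) (t N)) : ∃ k < N, s ∈ Icc (t k) (t (k + 1)) := by
  rcases hs.2.eq_or_lt with rfl | h
  · obtain ⟨k, rfl⟩ := Nat.exists_eq_succ_of_ne_zero hN.ne'
    exact ⟨k, k.lt_succ_self, right_mem_Icc.2 (ht k k.lt_succ_self).le⟩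
  · obtain ⟨k, hk, hsk⟩ := exists_cell ⟨hs.1, h⟩
    exact ⟨k, hk, Ico_subset_Icc_self hsk⟩

theorem interp_mem_of_convex (ht : ∀ k < N, t k < t (k + 1)) (hN : 0 < N) {x : ℕ → E}
    {S : Set E} (hS : Convex ℝ S) (hx : ∀ k ≤ N, x k ∈ S) {s : ℝ} (hs : s ∈ Icc (t 0) (t N)) :
    interp t N x s ∈ S := by
  obtain ⟨k, hk, hsk⟩ := exists_closed_cell ht hN hs
  rw [interp_of_mem ht x hk hsk]
  exact hS.add_smul_sub_mem (hx k hk.le) (hx (k + 1) hk) (grid_ratio_mem ht hk hsk)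

theorem lipschitzOnWith_one_interp (ht : ∀ k < N, t k < t (k + 1)) {x : ℕ → E}
    (hx : ∀ k < N, ‖x (k + 1) - x k‖ ≤ t (k + 1) - t k) :
    LipschitzOnWith 1 (interp t N x) (Icc (t 0) (t N)) := by
  refine lipschitzOnWith_one_of_right_increments (continuous_interp t N x).continuousOn
    fun s hs => ?_
  obtain ⟨k, hk, hsk⟩ := exists_cell hs
  filter_upwards [eventually_right_mem_Icc hsk] with u ⟨hsu, huk⟩
  have hpos := sub_pos.2 (ht k hk)
  rw [interp_sub_of_mem ht x hk huk (Ico_subset_Icc_self hsk), norm_smul,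
    Real.norm_of_nonneg (div_nonneg (sub_nonneg.2 hsu.le) hpos.le), div_mul_eq_mul_div,
    div_le_iff₀ hpos]
  exact mul_le_mul_of_nonneg_left (hx k hk) (sub_nonneg.2 hsu.le)

theorem norm_affine_sub_le {a₀ a₁ x g : E} {θ M : ℝ} (hθ : θ ∈ Icc (0 : ℝ) 1)
    (h₁ : ‖a₁ - a₀ - g‖ ≤ M) (hx : ‖x - a₀ - θ • g‖ ≤ M) : ‖a₀ + θ • (a₁ - a₀) - x‖ ≤ 2 * M := by
  have hsplit : a₀ + θ • (a₁ - a₀) - x = θ • (a₁ - a₀ - g) - (x - a₀ - θ • g) := by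
    simp only [smul_sub]
    abel
  have hθM : ‖θ • (a₁ - a₀ - g)‖ ≤ M := by
    rw [norm_smul, Real.norm_of_nonneg hθ.1]
    exact (mul_le_of_le_one_left (norm_nonneg _) hθ.2).trans h₁
  rw [hsplit]
  linarith [norm_sub_le (θ • (a₁ - a₀ - g)) (x - a₀ - θ • g)]

end Interp

section Incremental

variable {Z : Type*} [NormedAddCommGroup Z] [NormedSpace ℝ Z]
  {r Λ C κ ρ M T τ : ℝ} {D : Z → StrongDual ℝ Z} {H : Z → Z →L[ℝ] StrongDual ℝ Z}
  {L m : ℝ → StrongDual ℝ Z} {V : ℝ → ℝ} {R : Z → ℝ} {z₀ : Z} {t : ℕ → ℝ} {y : ℕ → Z} {N : ℕ}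

/-- `y` solves the implicit incremental scheme `0 ∈ ∂R(y_{k+1} - y_k) + D(y_{k+1}) - L(t_{k+1})`
on a grid of step size at most `τ`, with increments bounded by the time steps; the inclusion is
expressed by stability and a lower bound of the dissipated power. -/
structure IsIncremental (T : ℝ) (z₀ : Z) (L : ℝ → StrongDual ℝ Z) (D : Z → StrongDual ℝ Z)
    (R : Z → ℝ) (τ : ℝ) (N : ℕ) (t : ℕ → ℝ) (y : ℕ → Z) : Prop where
  t_zero : t 0 = 0
  t_last : t N = T
  t_lt : ∀ k < N, t k < t (k + 1)
  t_step : ∀ k < N, t (k + 1) - t k ≤ τ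
  init : y 0 = z₀
  norm_step_le : ∀ k < N, ‖y (k + 1) - y k‖ ≤ t (k + 1) - t k
  stable : ∀ k ≤ N, ∀ w, (L (t k) - D (y k)) w ≤ R w
  power : ∀ k < N, R (y (k + 1) - y k) ≤ (L (t (k + 1)) - D (y (k + 1))) (y (k + 1) - y k)

/-- `L` is `M`-Lipschitz on `[0,T]` with a derivative `m` of bounded variation, the variation
function being `V`. -/
structure IsLoad (T M : ℝ) (L m : ℝ → StrongDual ℝ Z) (V : ℝ → ℝ) : Prop where
  lipschitz : ∀ s ∈ Icc 0 T, ∀ t ∈ Icc 0 T, ‖L s - L t‖ ≤ M * |s - t|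
  monotoneOn : MonotoneOn V (Icc 0 T)
  norm_taylor_le : ∀ s ∈ Icc 0 T, ∀ t ∈ Icc 0 T, s ≤ t → ∀ c ∈ Icc s t,
    ‖L t - L s - (t - s) • m c‖ ≤ (t - s) * (V t - V s)

/-- The difference quotients of the grid function `x` on the grid `t`. -/
noncomputable def diffQuotient {E : Type*} [NormedAddCommGroup E] [NormedSpace ℝ E] (t : ℕ → ℝ)
    (x : ℕ → E) (k : ℕ) : E :=
  (t (k + 1) - t k)⁻¹ • (x (k + 1) - x k)

/-- The driving force `L - D(y)` at the grid points. -/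
def gridForce (L : ℝ → StrongDual ℝ Z) (D : Z → StrongDual ℝ Z) (t : ℕ → ℝ) (y : ℕ → Z) (k : ℕ) :
    StrongDual ℝ Z :=
  L (t k) - D (y k)

/-- The change of the driving force in the `k`-th step, tested with the increment of `y`; it is
the defect in the power balance of the interpolated scheme. -/
def powerDefect (L : ℝ → StrongDual ℝ Z) (D : Z → StrongDual ℝ Z) (t : ℕ → ℝ) (y : ℕ → Z) (k : ℕ) :
    ℝ :=
  (gridForce L D t y (k + 1) - gridForce L D t y k) (y (k + 1) - y k)

theorem IsEnergyDeriv.hessian_apply_le_half_add (hD : IsEnergyDeriv r Λ C κ D H) (x u v : Z) :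
    H x v u ≤ H x v v / 2 + H x u u / 2 := by
  have hnonneg := (mul_nonneg hD.pos.le (sq_nonneg ‖v - u‖)).trans (hD.coercive x (v - u))
  have hsymm := hD.symm x u v
  simp only [map_sub, _root_.sub_apply] at hnonneg
  linarith

theorem IsEnergyDeriv.force_increment_le (hD : IsEnergyDeriv r Λ C κ D H) {x x' v u : Z} {h : ℝ}
    (hh : 0 ≤ h) (hx : ‖x‖ ≤ r) (hx' : ‖x'‖ ≤ r) (hv : x' - x = h • v) (hv1 : ‖v‖ ≤ 1)
    (hu1 : ‖u‖ ≤ 1) (l : StrongDual ℝ Z) (hu : (h • l - (D x' - D x)) u ≤ 0) :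
    (h • l - (D x' - D x)) v ≤
      h * (l v - l u - H x' v v / 2 + H x u u / 2 + 3 * C * h) := by
  have hnorm : ‖x' - x‖ ≤ h := by
    rw [hv, norm_smul, Real.norm_of_nonneg hh]
    exact mul_le_of_le_one_right hh hv1
  have htaylor : h * H x v (v - u) ≤ (D x' - D x) (v - u) + C * h ^ 2 * 2 := by
    have hrem : C * ‖x - x'‖ ^ 2 * ‖u - v‖ ≤ C * h ^ 2 * 2 := by
      rw [norm_sub_rev x]
      exact mul_le_mul (mul_le_mul_of_nonneg_left (pow_le_pow_left₀ (norm_nonneg _) hnorm 2)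
        hD.nonneg) (by linarith [_root_.norm_sub_le u v]) (norm_nonneg _)
        (mul_nonneg hD.nonneg (sq_nonneg h))
    have hle := (hD.hessian_apply_le hx hx' (u - v)).trans (add_le_add_right hrem _)
    rw [← neg_sub x' x, hv] at hle
    simp only [map_neg, map_smul, map_sub, _root_.neg_apply, _root_.smul_apply, _root_.sub_apply,
      smul_eq_mul] at hle ⊢
    linarith
  have hyoung := hD.hessian_apply_le_half_add x u v
  have hhess : H x' v v - H x v v ≤ C * h := by
    have hle := bilin_apply_self_le (H x' - H x) v
    have hLip := (hD.lipschitz x' x hx' hx).trans (mul_le_mul_of_nonneg_left hnorm hD.nonneg)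
    have hsq := mul_le_mul hLip (pow_le_one₀ (norm_nonneg v) hv1 (n := 2)) (by positivity)
      (mul_nonneg hD.nonneg hh)
    simp only [_root_.sub_apply] at hle
    linarith
  have hrate := mul_le_mul_of_nonneg_left (add_le_add hyoung hhess) hh
  have hslack := mul_nonneg hD.nonneg (sq_nonneg h)
  simp only [map_sub, _root_.sub_apply, _root_.smul_apply, smul_eq_mul] at htaylor hu ⊢
  nlinarith

theorem smul_diffQuotient {E : Type*} [NormedAddCommGroup E] [NormedSpace ℝ E] (x : ℕ → E) {k : ℕ}
    (hk : t k < t (k + 1)) : (t (k + 1) - t k) • diffQuotient t x k = x (k + 1) - x k := by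
  rw [diffQuotient, smul_inv_smul₀ (sub_pos.2 hk).ne']

theorem norm_diffQuotient_le {E : Type*} [NormedAddCommGroup E] [NormedSpace ℝ E] {x : ℕ → E}
    {k : ℕ} (hk : t k < t (k + 1)) {c : ℝ} (hx : ‖x (k + 1) - x k‖ ≤ (t (k + 1) - t k) * c) :
    ‖diffQuotient t x k‖ ≤ c := by
  rw [diffQuotient, norm_smul, norm_inv, Real.norm_of_nonneg (sub_pos.2 hk).le,
    inv_mul_le_iff₀ (sub_pos.2 hk)]
  exact hx

namespace IsIncremental

variable {k : ℕ}

theorem mem_Icc (h : IsIncremental T z₀ L D R τ N t y) (hk : k ≤ N) : t k ∈ Icc 0 T := by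
  rw [← h.t_zero, ← h.t_last]
  exact ⟨grid_le h.t_lt k.zero_le hk, grid_le h.t_lt hk le_rfl⟩

theorem norm_le (h : IsIncremental T z₀ L D R τ N t y) (hk : k ≤ N) : ‖y k‖ ≤ ‖z₀‖ + T := by
  have hgrowth : ∀ k ≤ N, ‖y k‖ ≤ ‖z₀‖ + t k := by
    intro k
    induction k with
    | zero => intro _; rw [h.init, h.t_zero, add_zero]
    | succ k ih =>
      intro hk
      linarith [ih (by omega), h.norm_step_le k hk,
        norm_le_norm_add_norm_sub' (y (k + 1)) (y k)]
  linarith [hgrowth k hk, (h.mem_Icc hk).2]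

theorem variation_le (h : IsIncremental T z₀ L D R τ N t y) (hL : IsLoad T M L m V) {i j : ℕ}
    (hij : i ≤ j) (hj : j ≤ N) : V (t i) ≤ V (t j) :=
  hL.monotoneOn (h.mem_Icc (hij.trans hj)) (h.mem_Icc hj) (grid_le h.t_lt hij hj)

theorem norm_diffQuotient_le_one (h : IsIncremental T z₀ L D R τ N t y) (hk : k < N) :
    ‖diffQuotient t y k‖ ≤ 1 :=
  norm_diffQuotient_le (h.t_lt k hk) ((h.norm_step_le k hk).trans_eq (mul_one _).symm)

theorem norm_diffQuotient_load_le (h : IsIncremental T z₀ L D R τ N t y) (hL : IsLoad T M L m V)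
    (hk : k < N) : ‖diffQuotient t (L ∘ t) k‖ ≤ M := by
  refine norm_diffQuotient_le (h.t_lt k hk) ?_
  have := hL.lipschitz _ (h.mem_Icc hk) _ (h.mem_Icc hk.le)
  rwa [abs_of_pos (sub_pos.2 (h.t_lt k hk)), mul_comm] at this

theorem norm_diffQuotient_load_sub_le (h : IsIncremental T z₀ L D R τ N t y)
    (hL : IsLoad T M L m V) (hk : k < N) {c : ℝ} (hc : c ∈ Icc (t k) (t (k + 1))) :
    ‖diffQuotient t (L ∘ t) k - m c‖ ≤ V (t (k + 1)) - V (t k) := by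
  have hpos := sub_pos.2 (h.t_lt k hk)
  have hfactor : diffQuotient t (L ∘ t) k - m c =
      (t (k + 1) - t k)⁻¹ • (L (t (k + 1)) - L (t k) - (t (k + 1) - t k) • m c) := by
    rw [smul_sub, inv_smul_smul₀ hpos.ne']
    rfl
  rw [hfactor, norm_smul, norm_inv, Real.norm_of_nonneg hpos.le, inv_mul_le_iff₀ hpos]
  exact hL.norm_taylor_le _ (h.mem_Icc hk.le) _ (h.mem_Icc hk) (h.t_lt k hk).le c hc

theorem diffQuotient_load_sub_apply_le (h : IsIncremental T z₀ L D R τ N t y)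
    (hL : IsLoad T M L m V) (hk : k + 1 < N) {v : Z} (hv : ‖v‖ ≤ 1) :
    (diffQuotient t (L ∘ t) k - diffQuotient t (L ∘ t) (k + 1)) v ≤ V (t (k + 2)) - V (t k) := by
  have hleft := h.norm_diffQuotient_load_sub_le hL (Nat.lt_of_succ_lt hk)
    (right_mem_Icc.2 (h.t_lt k (Nat.lt_of_succ_lt hk)).le)
  have hright := h.norm_diffQuotient_load_sub_le hL hk (left_mem_Icc.2 (h.t_lt (k + 1) hk).le)
  refine (dual_apply_le _ _).trans ((mul_le_of_le_one_right (norm_nonneg _) hv).trans ?_)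
  rw [← sub_sub_sub_cancel_right _ _ (m (t (k + 1)))]
  exact (norm_sub_le _ _).trans (by linarith)

theorem powerDefect_nonneg (h : IsIncremental T z₀ L D R τ N t y) (hk : k < N) :
    0 ≤ powerDefect L D t y k := by
  rw [powerDefect, _root_.sub_apply, sub_nonneg]
  exact (h.stable k hk.le _).trans (h.power k hk)

theorem gridForce_sub_apply_diffQuotient_nonpos (hR : IsSublinear ρ R)
    (h : IsIncremental T z₀ L D R τ N t y) (hk : k + 1 < N) :
    (gridForce L D t y (k + 2) - gridForce L D t y (k + 1)) (diffQuotient t y k) ≤ 0 := by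
  have hk' := Nat.lt_of_succ_lt hk
  have hpos := inv_pos.2 (sub_pos.2 (h.t_lt k hk'))
  rw [_root_.sub_apply, sub_nonpos]
  refine (h.stable (k + 2) hk _).trans ?_
  rw [diffQuotient, hR.homogeneous _ hpos, map_smul, smul_eq_mul]
  exact mul_le_mul_of_nonneg_left (h.power k hk') hpos.le

theorem powerDefect_div_sq_le (hD : IsEnergyDeriv (‖z₀‖ + T) Λ C κ D H)
    (h : IsIncremental T z₀ L D R τ N t y) (hk : k < N) {u : Z} (hu1 : ‖u‖ ≤ 1)
    (hu : (gridForce L D t y (k + 1) - gridForce L D t y k) u ≤ 0) :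
    powerDefect L D t y k / (t (k + 1) - t k) ^ 2 ≤
      diffQuotient t (L ∘ t) k (diffQuotient t y k) - diffQuotient t (L ∘ t) k u
        - H (y (k + 1)) (diffQuotient t y k) (diffQuotient t y k) / 2 + H (y k) u u / 2
        + 3 * C * (t (k + 1) - t k) := by
  have hpos := sub_pos.2 (h.t_lt k hk)
  have hforce : gridForce L D t y (k + 1) - gridForce L D t y k =
      (t (k + 1) - t k) • diffQuotient t (L ∘ t) k - (D (y (k + 1)) - D (y k)) := by
    rw [smul_diffQuotient _ (h.t_lt k hk), gridForce, gridForce]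
    simp only [Function.comp_apply]
    abel
  have hle := hD.force_increment_le hpos.le (h.norm_le hk.le) (h.norm_le hk)
    (smul_diffQuotient y (h.t_lt k hk)).symm (h.norm_diffQuotient_le_one hk) hu1
    (diffQuotient t (L ∘ t) k) (hforce ▸ hu)
  rw [powerDefect, ← smul_diffQuotient y (h.t_lt k hk), map_smul, hforce, smul_eq_mul, sq,
    mul_div_mul_left _ _ hpos.ne', div_le_iff₀' hpos]
  exact hle

/-- The estimates of the single steps telescope when each is tested with the rate of the previous
step, on which the change of the force is nonpositive. -/
theorem sum_powerDefect_div_sq_le (hD : IsEnergyDeriv (‖z₀‖ + T) Λ C κ D H)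
    (hR : IsSublinear ρ R) (hL : IsLoad T M L m V) (h : IsIncremental T z₀ L D R τ N t y) :
    ∀ k < N, ∑ i ∈ Finset.range (k + 1), powerDefect L D t y i / (t (i + 1) - t i) ^ 2 ≤
      diffQuotient t (L ∘ t) k (diffQuotient t y k)
        - H (y (k + 1)) (diffQuotient t y k) (diffQuotient t y k) / 2
        + (V (t (k + 1)) + V (t k) - 2 * V (t 0)) + 3 * C * t (k + 1) := by
  intro k
  induction k with
  | zero =>
    intro hk
    have hstep := h.powerDefect_div_sq_le hD hk (u := 0) (by simp) (by simp)
    have hV := h.variation_le hL zero_le_one hk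
    simp only [_root_.map_zero, h.t_zero, zero_add] at hstep
    simp only [zero_add, Finset.sum_range_one, h.t_zero] at hV ⊢
    linarith
  | succ k ih =>
    intro hk
    have hk' := Nat.lt_of_succ_lt hk
    have hstep := h.powerDefect_div_sq_le hD hk (h.norm_diffQuotient_le_one hk')
      (h.gridForce_sub_apply_diffQuotient_nonpos hR hk)
    have hload := h.diffQuotient_load_sub_apply_le hL hk (h.norm_diffQuotient_le_one hk')
    rw [_root_.sub_apply] at hload
    rw [Finset.sum_range_succ]
    linarith [ih hk']

theorem sum_powerDefect_le (hD : IsEnergyDeriv (‖z₀‖ + T) Λ C κ D H) (hR : IsSublinear ρ R)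
    (hL : IsLoad T M L m V) (h : IsIncremental T z₀ L D R τ N t y) (hN : 0 < N) :
    ∑ k ∈ Finset.range N, powerDefect L D t y k ≤
      (M + 2 * (V T - V 0) + 3 * C * T) * τ ^ 2 := by
  obtain ⟨n, rfl⟩ := Nat.exists_eq_succ_of_ne_zero hN.ne'
  have hn := n.lt_succ_self
  have hterm : ∀ k ∈ Finset.range (n + 1), powerDefect L D t y k ≤
      τ ^ 2 * (powerDefect L D t y k / (t (k + 1) - t k) ^ 2) := by
    intro k hk
    have hk' := Finset.mem_range.1 hk
    have hpos := sub_pos.2 (h.t_lt k hk')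
    rw [← mul_div_assoc, le_div_iff₀ (by positivity), mul_comm]
    exact mul_le_mul_of_nonneg_right (pow_le_pow_left₀ hpos.le (h.t_step k hk') 2)
      (h.powerDefect_nonneg hk')
  have hload : diffQuotient t (L ∘ t) n (diffQuotient t y n) ≤ M :=
    (dual_apply_le _ _).trans ((mul_le_of_le_one_right (norm_nonneg _)
      (h.norm_diffQuotient_le_one hn)).trans (h.norm_diffQuotient_load_le hL hn))
  have hhess := (mul_nonneg hD.pos.le (sq_nonneg ‖diffQuotient t y n‖)).trans
    (hD.coercive (y (n + 1)) _)
  have hV := h.variation_le hL n.le_succ le_rfl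
  have hsum := h.sum_powerDefect_div_sq_le hD hR hL n hn
  rw [h.t_last] at hV
  rw [h.t_zero, h.t_last] at hsum
  calc ∑ k ∈ Finset.range (n + 1), powerDefect L D t y k
      ≤ ∑ k ∈ Finset.range (n + 1), τ ^ 2 * (powerDefect L D t y k / (t (k + 1) - t k) ^ 2) :=
        Finset.sum_le_sum hterm
    _ = (∑ k ∈ Finset.range (n + 1), powerDefect L D t y k / (t (k + 1) - t k) ^ 2) * τ ^ 2 := by
        rw [← Finset.mul_sum, mul_comm]
    _ ≤ (M + 2 * (V T - V 0) + 3 * C * T) * τ ^ 2 :=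
        mul_le_mul_of_nonneg_right (by linarith) (sq_nonneg τ)

end IsIncremental

/-- A bound, on the `k`-th grid cell, for the distance of the interpolated driving force to the
driving force of the interpolated states. -/
def forceDefect (C : ℝ) (V : ℝ → ℝ) (t : ℕ → ℝ) (k : ℕ) : ℝ :=
  2 * ((t (k + 1) - t k) * (V (t (k + 1)) - V (t k))) + 2 * (C * (t (k + 1) - t k) ^ 2)

/-- The increment on the `k`-th grid cell of the defect function of the interpolated scheme. -/
def cellDefect (C : ℝ) (V : ℝ → ℝ) (L : ℝ → StrongDual ℝ Z) (D : Z → StrongDual ℝ Z) (t : ℕ → ℝ)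
    (y : ℕ → Z) (k : ℕ) : ℝ :=
  (t (k + 1) - t k) * forceDefect C V t k + powerDefect L D t y k

/-- The accumulated defect of the interpolated scheme at the grid points. -/
def gridDefect (C : ℝ) (V : ℝ → ℝ) (L : ℝ → StrongDual ℝ Z) (D : Z → StrongDual ℝ Z) (t : ℕ → ℝ)
    (y : ℕ → Z) (n : ℕ) : ℝ :=
  ∑ k ∈ Finset.range n, cellDefect C V L D t y k

theorem gridDefect_succ_sub (k : ℕ) :
    gridDefect C V L D t y (k + 1) - gridDefect C V L D t y k = cellDefect C V L D t y k := by
  rw [gridDefect, gridDefect, Finset.sum_range_succ, add_sub_cancel_left]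

namespace IsIncremental

variable {k : ℕ}

theorem forceDefect_nonneg (hC : 0 ≤ C) (hL : IsLoad T M L m V)
    (h : IsIncremental T z₀ L D R τ N t y) (hk : k < N) : 0 ≤ forceDefect C V t k := by
  have hd := sub_pos.2 (h.t_lt k hk)
  have hV := sub_nonneg.2 (h.variation_le hL k.le_succ hk)
  unfold forceDefect
  positivity

theorem cellDefect_nonneg (hC : 0 ≤ C) (hL : IsLoad T M L m V)
    (h : IsIncremental T z₀ L D R τ N t y) (hk : k < N) : 0 ≤ cellDefect C V L D t y k :=
  add_nonneg (mul_nonneg (sub_pos.2 (h.t_lt k hk)).le (h.forceDefect_nonneg hC hL hk))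
    (h.powerDefect_nonneg hk)

theorem forceDefect_le (hC : 0 ≤ C) (hL : IsLoad T M L m V)
    (h : IsIncremental T z₀ L D R τ N t y) (hk : k < N) :
    forceDefect C V t k ≤ (2 * (V T - V 0) + 2 * C * T) * τ := by
  have hd := (sub_pos.2 (h.t_lt k hk)).le
  have hdT : t (k + 1) - t k ≤ T := by linarith [(h.mem_Icc hk.le).1, (h.mem_Icc hk).2]
  have hV0 := h.variation_le hL k.zero_le hk.le
  have hVT := h.variation_le hL (j := N) hk le_rfl
  rw [h.t_zero] at hV0
  rw [h.t_last] at hVT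
  have hV : V (t (k + 1)) - V (t k) ≤ V T - V 0 := by linarith
  have hload := mul_le_mul (h.t_step k hk) hV
    (sub_nonneg.2 (h.variation_le hL k.le_succ hk)) (hd.trans (h.t_step k hk))
  have hstate := mul_le_mul_of_nonneg_left
    (mul_le_mul (h.t_step k hk) hdT hd (hd.trans (h.t_step k hk))) hC
  rw [← sq] at hstate
  unfold forceDefect
  linarith

theorem sum_forceDefect_le (hC : 0 ≤ C) (hL : IsLoad T M L m V)
    (h : IsIncremental T z₀ L D R τ N t y) :
    ∑ k ∈ Finset.range N, (t (k + 1) - t k) * forceDefect C V t k ≤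
      (2 * (V T - V 0) + 2 * C * T) * τ ^ 2 := by
  have hterm : ∀ k ∈ Finset.range N, (t (k + 1) - t k) * forceDefect C V t k ≤
      τ ^ 2 * (2 * (V (t (k + 1)) - V (t k)) + 2 * C * (t (k + 1) - t k)) := by
    intro k hk
    have hk' := Finset.mem_range.1 hk
    have hd := (sub_pos.2 (h.t_lt k hk')).le
    have hV := sub_nonneg.2 (h.variation_le hL k.le_succ hk')
    calc (t (k + 1) - t k) * forceDefect C V t k
        = (t (k + 1) - t k) ^ 2 * (2 * (V (t (k + 1)) - V (t k)) + 2 * C * (t (k + 1) - t k)) := by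
          unfold forceDefect
          ring
      _ ≤ _ := mul_le_mul_of_nonneg_right (pow_le_pow_left₀ hd (h.t_step k hk') 2) (by positivity)
  refine (Finset.sum_le_sum hterm).trans_eq ?_
  rw [← Finset.mul_sum, Finset.sum_add_distrib, ← Finset.mul_sum, ← Finset.mul_sum,
    Finset.sum_range_sub (fun k => V (t k)), Finset.sum_range_sub, h.t_zero, h.t_last]
  ring

theorem pos_of_pos (hT : 0 < T) (h : IsIncremental T z₀ L D R τ N t y) : 0 < N :=
  Nat.pos_of_ne_zero fun h0 => hT.ne (by rw [← h.t_zero, ← h.t_last, h0])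

theorem gridDefect_le (hD : IsEnergyDeriv (‖z₀‖ + T) Λ C κ D H) (hR : IsSublinear ρ R)
    (hT : 0 < T) (hL : IsLoad T M L m V) (h : IsIncremental T z₀ L D R τ N t y) (hk : k ≤ N) :
    gridDefect C V L D t y k ≤ (M + 4 * (V T - V 0) + 5 * C * T) * τ ^ 2 := by
  have hmono : gridDefect C V L D t y k ≤ gridDefect C V L D t y N :=
    Finset.sum_le_sum_of_subset_of_nonneg (Finset.range_subset_range.2 hk) fun i hi _ =>
      h.cellDefect_nonneg hD.nonneg hL (Finset.mem_range.1 hi)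
  refine hmono.trans ?_
  simp only [gridDefect, cellDefect, Finset.sum_add_distrib]
  linarith [h.sum_forceDefect_le hD.nonneg hL,
    h.sum_powerDefect_le hD hR hL (h.pos_of_pos hT)]

theorem norm_interp_load_sub_le (hL : IsLoad T M L m V) (h : IsIncremental T z₀ L D R τ N t y)
    (hk : k < N) {s : ℝ} (hs : s ∈ Icc (t k) (t (k + 1))) :
    ‖interp t N (L ∘ t) s - L s‖ ≤ 2 * ((t (k + 1) - t k) * (V (t (k + 1)) - V (t k))) := by
  have hd := sub_pos.2 (h.t_lt k hk)
  have hsT : s ∈ Icc 0 T := Icc_subset_Icc (h.mem_Icc hk.le).1 (h.mem_Icc hk).2 hs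
  have hcell := hL.norm_taylor_le _ (h.mem_Icc hk.le) _ (h.mem_Icc hk) (h.t_lt k hk).le (t k)
    (left_mem_Icc.2 (h.t_lt k hk).le)
  have hpart := hL.norm_taylor_le _ (h.mem_Icc hk.le) _ hsT hs.1 (t k) (left_mem_Icc.2 hs.1)
  rw [interp_of_mem h.t_lt _ hk hs]
  refine norm_affine_sub_le (grid_ratio_mem h.t_lt hk hs) hcell ?_
  rw [smul_smul, div_mul_cancel₀ _ hd.ne']
  exact hpart.trans (mul_le_mul (sub_le_sub_right hs.2 _)
    (sub_le_sub_right (hL.monotoneOn hsT (h.mem_Icc hk) hs.2) _)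
    (sub_nonneg.2 (hL.monotoneOn (h.mem_Icc hk.le) hsT hs.1)) hd.le)

theorem norm_interp_deriv_sub_le (hD : IsEnergyDeriv (‖z₀‖ + T) Λ C κ D H)
    (h : IsIncremental T z₀ L D R τ N t y) (hk : k < N) {s : ℝ} (hs : s ∈ Icc (t k) (t (k + 1))) :
    ‖interp t N (D ∘ y) s - D (interp t N y s)‖ ≤ 2 * (C * (t (k + 1) - t k) ^ 2) := by
  have hsq : ‖y (k + 1) - y k‖ ^ 2 ≤ (t (k + 1) - t k) ^ 2 :=
    pow_le_pow_left₀ (norm_nonneg _) (h.norm_step_le k hk) 2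
  have hθ := grid_ratio_mem h.t_lt hk hs
  have hcell := (hD.norm_taylor_le (h.norm_le hk) (h.norm_le hk.le)).trans
    (mul_le_mul_of_nonneg_left hsq hD.nonneg)
  rw [interp_of_mem h.t_lt _ hk hs, interp_of_mem h.t_lt _ hk hs]
  refine norm_affine_sub_le hθ hcell ?_
  set θ := (s - t k) / (t (k + 1) - t k)
  have hball : ‖y k + θ • (y (k + 1) - y k)‖ ≤ ‖z₀‖ + T :=
    mem_closedBall_zero_iff.1 ((convex_closedBall (0 : Z) (‖z₀‖ + T)).add_smul_sub_mem
      (mem_closedBall_zero_iff.2 (h.norm_le hk.le)) (mem_closedBall_zero_iff.2 (h.norm_le hk)) hθ)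
  have hpart := hD.norm_taylor_le hball (h.norm_le hk.le)
  rw [add_sub_cancel_left, map_smul, norm_smul, mul_pow] at hpart
  refine hpart.trans (mul_le_mul_of_nonneg_left ?_ hD.nonneg)
  exact (mul_le_of_le_one_left (sq_nonneg _)
    (pow_le_one₀ (norm_nonneg _) ((Real.norm_of_nonneg hθ.1).trans_le hθ.2))).trans hsq

theorem norm_interp_gridForce_sub_le (hD : IsEnergyDeriv (‖z₀‖ + T) Λ C κ D H)
    (hL : IsLoad T M L m V) (h : IsIncremental T z₀ L D R τ N t y) (hk : k < N) {s : ℝ}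
    (hs : s ∈ Icc (t k) (t (k + 1))) :
    ‖interp t N (gridForce L D t y) s - (L s - D (interp t N y s))‖ ≤ forceDefect C V t k := by
  have hsplit : interp t N (gridForce L D t y) s - (L s - D (interp t N y s)) =
      (interp t N (L ∘ t) s - L s) - (interp t N (D ∘ y) s - D (interp t N y s)) := by
    simp only [interp_of_mem h.t_lt _ hk hs, gridForce, Function.comp_apply, smul_sub]
    abel
  rw [hsplit]
  exact (norm_sub_le _ _).trans
    (add_le_add (h.norm_interp_load_sub_le hL hk hs) (h.norm_interp_deriv_sub_le hD hk hs))

theorem interp_gridDefect_sub (h : IsIncremental T z₀ L D R τ N t y) (hk : k < N) {s u : ℝ}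
    (hs : s ∈ Icc (t k) (t (k + 1))) (hu : u ∈ Icc (t k) (t (k + 1))) :
    interp t N (gridDefect C V L D t y) u - interp t N (gridDefect C V L D t y) s =
      (u - s) * forceDefect C V t k + (u - s) / (t (k + 1) - t k) * powerDefect L D t y k := by
  have hd := (sub_pos.2 (h.t_lt k hk)).ne'
  rw [interp_sub_of_mem h.t_lt _ hk hu hs, gridDefect_succ_sub, cellDefect, smul_eq_mul]
  field_simp

theorem dissipation_interp_sub_le (hR : IsSublinear ρ R) (h : IsIncremental T z₀ L D R τ N t y)
    (hk : k < N) {s u : ℝ} (hs : s ∈ Icc (t k) (t (k + 1))) (hu : u ∈ Icc (t k) (t (k + 1)))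
    (hsu : s < u) :
    R (interp t N y u - interp t N y s) ≤
      interp t N (gridForce L D t y) s (interp t N y u - interp t N y s)
        + (u - s) / (t (k + 1) - t k) * powerDefect L D t y k := by
  have hc := div_pos (sub_pos.2 hsu) (sub_pos.2 (h.t_lt k hk))
  have hθ := mul_nonneg (grid_ratio_mem h.t_lt hk hs).1 (h.powerDefect_nonneg hk)
  have hpower : R (y (k + 1) - y k) ≤
      gridForce L D t y k (y (k + 1) - y k) + powerDefect L D t y k :=
    (h.power k hk).trans_eq (by simp only [powerDefect, gridForce, _root_.sub_apply]; ring)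
  rw [interp_sub_of_mem h.t_lt y hk hu hs, interp_of_mem h.t_lt _ hk hs, hR.homogeneous _ hc,
    map_smul, smul_eq_mul, _root_.add_apply, _root_.smul_apply, smul_eq_mul, ← mul_add]
  refine mul_le_mul_of_nonneg_left ?_ hc.le
  rw [← powerDefect]
  linarith

theorem isApproxSolution (hD : IsEnergyDeriv (‖z₀‖ + T) Λ C κ D H) (hR : IsSublinear ρ R)
    (hT : 0 < T) (hL : IsLoad T M L m V) (h : IsIncremental T z₀ L D R τ N t y) :
    IsApproxSolution T z₀ L D R ((2 * (V T - V 0) + 2 * C * T) * τ)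
      ((M + 4 * (V T - V 0) + 5 * C * T) * τ ^ 2) (interp t N y)
      (interp t N (gridForce L D t y)) (interp t N (gridDefect C V L D t y)) := by
  have hIcc : Icc (t 0) (t N) = Icc 0 T := by rw [h.t_zero, h.t_last]
  have hN := h.pos_of_pos hT
  have hcell : ∀ s ∈ Ico 0 T, ∃ k < N, s ∈ Ico (t k) (t (k + 1)) := fun s hs =>
    exists_cell (by rwa [h.t_zero, h.t_last])
  constructor
  · rw [← h.t_zero, interp_left h.t_lt y hN, h.init]
  · exact hIcc ▸ lipschitzOnWith_one_interp h.t_lt h.norm_step_le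
  · have hconvex : Convex ℝ {f : StrongDual ℝ Z | ∀ w, f w ≤ R w} := by
      simp only [ofPred_forall]
      exact convex_iInter fun w =>
        convex_halfSpace_le (f := fun f : StrongDual ℝ Z => f w) ⟨fun _ _ => rfl, fun _ _ => rfl⟩ _
    exact fun s hs => interp_mem_of_convex h.t_lt hN hconvex h.stable (hIcc ▸ hs)
  · intro s hs
    obtain ⟨k, hk, hsk⟩ := exists_closed_cell h.t_lt hN (hIcc.symm ▸ hs)
    exact (h.norm_interp_gridForce_sub_le hD hL hk hsk).trans (h.forceDefect_le hD.nonneg hL hk)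
  · exact (continuous_interp _ _ _).continuousOn
  · rw [← h.t_zero, interp_left h.t_lt _ hN]
    simp only [gridDefect, Finset.sum_range_zero, h.t_zero]
  · intro s hs
    rw [← hIcc] at hs
    exact interp_mem_of_convex h.t_lt hN
      (convex_Iic ((M + 4 * (V T - V 0) + 5 * C * T) * τ ^ 2))
      (fun k hk => h.gridDefect_le hD hR hT hL hk) hs
  · intro s hs
    obtain ⟨k, hk, hsk⟩ := hcell s hs
    filter_upwards [eventually_right_mem_Icc hsk] with u ⟨hsu, huk⟩
    rw [h.interp_gridDefect_sub hk (Ico_subset_Icc_self hsk) huk, mul_comm]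
    have := mul_le_mul_of_nonneg_left
      (h.norm_interp_gridForce_sub_le hD hL hk (Ico_subset_Icc_self hsk)) (sub_pos.2 hsu).le
    exact le_add_of_le_of_nonneg this (mul_nonneg
      (div_pos (sub_pos.2 hsu) (sub_pos.2 (h.t_lt k hk))).le (h.powerDefect_nonneg hk))
  · intro s hs ε hε
    obtain ⟨k, hk, hsk⟩ := hcell s hs
    filter_upwards [eventually_right_mem_Icc hsk] with u ⟨hsu, huk⟩
    rw [h.interp_gridDefect_sub hk (Ico_subset_Icc_self hsk) huk]
    have := h.dissipation_interp_sub_le hR hk (Ico_subset_Icc_self hsk) huk hsu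
    have := mul_nonneg (sub_pos.2 hsu).le (h.forceDefect_nonneg hD.nonneg hL hk)
    have := mul_pos hε (sub_pos.2 hsu)
    linarith

end IsIncremental

end Incremental

section Load

theorem IsSobolevDeriv.norm_taylor_le {E : Type*} [NormedAddCommGroup E] [NormedSpace ℝ E]
    [CompleteSpace E] {T : ℝ} {u g : ℝ → E} (h : IsSobolevDeriv 1 T u g) {s t M : ℝ}
    (hs : s ∈ Icc 0 T) (ht : t ∈ Icc 0 T) (hst : s ≤ t) (c : E)
    (hM : ∀ x ∈ Icc s t, ‖g x - c‖ ≤ M) : ‖u t - u s - (t - s) • c‖ ≤ (t - s) * M := by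
  rw [h.sub_eq hs ht, ← intervalIntegral.integral_const,
    ← intervalIntegral.integral_sub (h.intervalIntegrable hs ht) intervalIntegrable_const,
    mul_comm, ← abs_of_nonneg (sub_nonneg.2 hst)]
  exact intervalIntegral.norm_integral_le_of_norm_le_const fun x hx =>
    hM x (Ioc_subset_Icc_self (by rwa [uIoc_of_le hst] at hx))

variable {Z V : Type*} [NormedAddCommGroup Z] [NormedSpace ℝ Z]
  [NormedAddCommGroup V] [InnerProductSpace ℝ V]

theorem norm_comp_embedding_le {ι : Z →L[ℝ] V} (hι : ∀ z, ‖ι z‖ ≤ ‖z‖) (f : StrongDual ℝ V) :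
    ‖f.comp ι‖ ≤ ‖f‖ :=
  ContinuousLinearMap.opNorm_le_bound _ (norm_nonneg _) fun z =>
    (f.le_opNorm _).trans (mul_le_mul_of_nonneg_left (hι z) (norm_nonneg _))

theorem norm_sub_le_variationOnFromTo {E : Type*} [NormedAddCommGroup E] {T : ℝ} {m : ℝ → E}
    (hm : BoundedVariationOn m (Icc 0 T)) {s t : ℝ} (hs : s ∈ Icc 0 T) (ht : t ∈ Icc 0 T)
    (hst : s ≤ t) {x c : ℝ} (hx : x ∈ Icc s t) (hc : c ∈ Icc s t) :
    ‖m x - m c‖ ≤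
      variationOnFromTo m (Icc 0 T) 0 t - variationOnFromTo m (Icc 0 T) 0 s := by
  have hmem : ∀ x ∈ Icc s t, x ∈ Icc 0 T ∩ Icc s t := fun x hx =>
    ⟨Icc_subset_Icc hs.1 ht.2 hx, hx⟩
  have h0 : (0 : ℝ) ∈ Icc 0 T := left_mem_Icc.2 (hs.1.trans hs.2)
  rw [← variationOnFromTo.add hm.locallyBoundedVariationOn h0 hs ht, add_sub_cancel_left,
    variationOnFromTo.eq_of_le _ _ hst, ← dist_eq_norm]
  exact (hm.mono inter_subset_left).dist_le (hmem x hx) (hmem c hc)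

theorem exists_isLoad {ι : Z →L[ℝ] V} (hι : ∀ z, ‖ι z‖ ≤ ‖z‖) {T : ℝ} (hT : 0 ≤ T)
    {ℓ : ℝ → StrongDual ℝ V} {M : ℝ}
    (hLip : ∀ s ∈ Icc 0 T, ∀ t ∈ Icc 0 T, ‖ℓ s - ℓ t‖ ≤ M * |s - t|) (hBV : IsLoadBV T ℓ) :
    ∃ (m : ℝ → StrongDual ℝ Z) (W : ℝ → ℝ), IsLoad T M (fun t => (ℓ t).comp ι) m W := by
  obtain ⟨m, hm, hvar⟩ := hBV
  have hm₁ : IsSobolevDeriv 1 T ℓ m := ⟨hm.memLp.mono_exponent le_top, hm.eq_primitive⟩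
  refine ⟨fun t => (m t).comp ι, variationOnFromTo m (Icc 0 T) 0, ?_, ?_, ?_⟩
  · intro s hs t ht
    rw [← ContinuousLinearMap.sub_comp]
    exact (norm_comp_embedding_le hι _).trans (hLip s hs t ht)
  · exact variationOnFromTo.monotoneOn hvar.locallyBoundedVariationOn (left_mem_Icc.2 hT)
  · intro s hs t ht hst c hc
    have hcomp : (ℓ t).comp ι - (ℓ s).comp ι - (t - s) • (m c).comp ι =
        (ℓ t - ℓ s - (t - s) • m c).comp ι := rfl
    rw [hcomp]
    exact (norm_comp_embedding_le hι _).trans (hm₁.norm_taylor_le hs ht hst (m c) fun x hx =>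
      norm_sub_le_variationOnFromTo hvar hs ht hst hx hc)

end Load

/-! ### Dissipation potentials and the semilinear energy -/

section Dissipation

variable {Z V X : Type*} [NormedAddCommGroup Z] [InnerProductSpace ℝ Z]
  [NormedAddCommGroup V] [InnerProductSpace ℝ V] [NormedAddCommGroup X] [NormedSpace ℝ X]
  {ι : Z →L[ℝ] V} {R : V → ℝ} {ρ : ℝ}

theorem IsDissipation.exists_isSublinear {j : V →L[ℝ] X} (hR : IsDissipation j R) :
    ∃ ρ, IsSublinear ρ R := by
  obtain ⟨_, ρ, -, -, hbound⟩ := hR.bounded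
  refine ⟨ρ, hR.nonneg, hR.homogeneous, fun u v => ?_, fun v => (hbound v).2⟩
  have hmid := hR.convex.2 (mem_univ u) (mem_univ v) (one_half_pos (α := ℝ)).le one_half_pos.le
    (add_halves 1)
  rw [← smul_add, hR.homogeneous _ one_half_pos, smul_eq_mul, smul_eq_mul] at hmid
  linarith

theorem IsSublinear.comp_embedding (hι : ∀ z, ‖ι z‖ ≤ ‖z‖) (hR : IsSublinear ρ R) :
    IsSublinear |ρ| fun z => R (ι z) where
  nonneg v := hR.nonneg _
  homogeneous c hc v := by rw [map_smul, hR.homogeneous c hc]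
  subadditive u v := by rw [map_add]; exact hR.subadditive _ _
  growth v := (hR.growth _).trans
    (mul_le_mul (le_abs_self ρ) (hι v) (norm_nonneg _) (abs_nonneg ρ))

theorem IsSublinear.mem_subdifferential_iff (hR : IsSublinear ρ R) {v : V} {ξ : StrongDual ℝ V} :
    ξ ∈ subdifferential R v ↔ (∀ w, ξ w ≤ R w) ∧ R v ≤ ξ v := by
  refine ⟨fun hξ => ⟨fun w => ?_, ?_⟩, fun ⟨hle, hv⟩ w => ?_⟩
  · have := hξ (v + w)
    rw [add_sub_cancel_left] at this
    linarith [hR.subadditive v w]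
  · have := hξ 0
    rw [hR.map_zero, zero_sub, map_neg] at this
    linarith
  · rw [map_sub]
    linarith [hle w, hv]

theorem IsSublinear.exists_extension (hR : IsSublinear ρ R) {g : StrongDual ℝ Z}
    (hg : ∀ w, g w ≤ R (ι w)) : ∃ ξ : StrongDual ℝ V, (∀ v, ξ v ≤ R v) ∧ ξ.comp ι = g := by
  obtain ⟨s, hs⟩ := (ι : Z →ₗ[ℝ] V).rangeRestrict.exists_rightInverse_of_surjective
    (LinearMap.range_rangeRestrict _)
  let l : V →ₗ.[ℝ] ℝ := ⟨LinearMap.range (ι : Z →ₗ[ℝ] V), (g : Z →ₗ[ℝ] ℝ).comp s⟩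
  have hιs : ∀ x : l.domain, ι (s x) = x := fun x =>
    congrArg Subtype.val (LinearMap.congr_fun hs x)
  obtain ⟨f, hfl, hfR⟩ := exists_extension_of_le_sublinear l R hR.homogeneous hR.subadditive
    fun x => (hg (s x)).trans_eq (congrArg R (hιs x))
  have hker : ∀ w, ι w = 0 → g w ≤ 0 := fun w hw => by
    have := hg w
    rwa [hw, hR.map_zero] at this
  refine ⟨f.mkContinuous ρ (hR.norm_le_of_le hfR), hfR, ?_⟩
  ext w
  let x : l.domain := ⟨ι w, LinearMap.mem_range_self _ w⟩
  have hdiff : ι (w - s x) = 0 := by rw [map_sub, hιs, sub_self]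
  have hdiff' : ι (s x - w) = 0 := by rw [← neg_sub, map_neg, hdiff, neg_zero]
  have h₁ := hker _ hdiff
  have h₂ := hker _ hdiff'
  rw [map_sub] at h₁ h₂
  exact (hfl x).trans (by linarith : g (s x) = g w)

theorem IsSublinear.inclusion_iff (hR : IsSublinear ρ R) {I : Z → ℝ} {v z : Z} :
    Inclusion ι R I v z ↔
      (∀ w, (-fderiv ℝ I z) w ≤ R (ι w)) ∧ R (ι v) ≤ (-fderiv ℝ I z) v := by
  simp only [Inclusion, hR.mem_subdifferential_iff, add_eq_zero_iff_eq_neg]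
  constructor
  · rintro ⟨ξ, ⟨hle, hv⟩, hξ⟩
    exact hξ ▸ ⟨fun w => hle (ι w), hv⟩
  · rintro ⟨hle, hv⟩
    obtain ⟨ξ, hξR, hξ⟩ := hR.exists_extension hle
    exact ⟨ξ, ⟨hξR, hv.trans_eq (DFunLike.congr_fun hξ v).symm⟩, hξ⟩

end Dissipation

section Energy

variable {Z V : Type*} [NormedAddCommGroup Z] [InnerProductSpace ℝ Z]
  [NormedAddCommGroup V] [InnerProductSpace ℝ V]

/-- The derivative of the time-independent part `½⟨Az,z⟩ + F(z)` of the energy. -/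
noncomputable def energyDeriv (A : Z →L[ℝ] StrongDual ℝ Z) (F : Z → ℝ) (z : Z) : StrongDual ℝ Z :=
  A z + fderiv ℝ F z

/-- The second derivative of the energy, which does not depend on time. -/
noncomputable def energyHessian (A : Z →L[ℝ] StrongDual ℝ Z) (F : Z → ℝ) (z : Z) :
    Z →L[ℝ] StrongDual ℝ Z :=
  A + fderiv ℝ (fderiv ℝ F) z

variable {ι : Z →L[ℝ] V} {A : Z →L[ℝ] StrongDual ℝ Z} {F : Z → ℝ} {ℓ : ℝ → StrongDual ℝ V}

theorem hasFDerivAt_energy (hA : ∀ x y, A x y = A y x) (hF : Differentiable ℝ F) (t : ℝ) (z : Z) :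
    HasFDerivAt (energy ι A F ℓ t) (energyDeriv A F z - (ℓ t).comp ι) z := by
  have hquad : HasFDerivAt (fun z => A z z) ((A z).comp (ContinuousLinearMap.id ℝ Z)
      + A.flip z) z := A.hasFDerivAt.clm_apply (hasFDerivAt_id z)
  refine (((hquad.const_mul (1 / 2)).add (hF z).hasFDerivAt).sub
    ((ℓ t).comp ι).hasFDerivAt).congr_fderiv ?_
  ext w
  simp only [energyDeriv, _root_.sub_apply, _root_.add_apply, _root_.smul_apply,
    ContinuousLinearMap.comp_apply, ContinuousLinearMap.flip_apply, ContinuousLinearMap.id_apply,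
    hA w z, smul_eq_mul]
  ring

theorem hasFDerivAt_energyDeriv (hF : ContDiff ℝ 2 F) (z : Z) :
    HasFDerivAt (energyDeriv A F) (energyHessian A F z) z := by
  have hF' : ContDiff ℝ 1 (fderiv ℝ F) := hF.fderiv_right (by norm_num)
  exact A.hasFDerivAt.add (hF'.differentiable one_ne_zero z).hasFDerivAt

theorem fderiv_fderiv_energy (hA : ∀ x y, A x y = A y x) (hF : ContDiff ℝ 2 F) (t : ℝ) (z : Z) :
    fderiv ℝ (fderiv ℝ (energy ι A F ℓ t)) z = energyHessian A F z := by
  have hfderiv : fderiv ℝ (energy ι A F ℓ t) = fun z => energyDeriv A F z - (ℓ t).comp ι :=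
    funext fun z => (hasFDerivAt_energy hA (hF.differentiable two_ne_zero) t z).fderiv
  rw [hfderiv]
  exact ((hasFDerivAt_energyDeriv hF z).sub_const _).fderiv

theorem energyHessian_sub (x y : Z) : energyHessian A F x - energyHessian A F y =
    fderiv ℝ (fderiv ℝ F) x - fderiv ℝ (fderiv ℝ F) y := by
  rw [energyHessian, energyHessian]
  abel

theorem energyHessian_symm (hA : ∀ x y, A x y = A y x) (hF : ContDiff ℝ 2 F) (z u v : Z) :
    energyHessian A F z u v = energyHessian A F z v u := by
  have hsymm : IsSymmSndFDerivAt ℝ F z :=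
    hF.contDiffAt.isSymmSndFDerivAt (by simp only [minSmoothness_of_isRCLikeNormedField, le_refl])
  simp only [energyHessian, _root_.add_apply, hA u v, hsymm.eq u v]

theorem norm_le_of_quadratic_le {B : Z →L[ℝ] StrongDual ℝ Z} (hB : ∀ u v, B u v = B v u) {c : ℝ}
    (hc : 0 ≤ c) (h : ∀ v, |B v v| ≤ c * ‖v‖ ^ 2) : ‖B‖ ≤ c := by
  have hpolar : ∀ u v, B u v ≤ c * ((‖u‖ ^ 2 + ‖v‖ ^ 2) / 2) := by
    intro u v
    have hexpand : 4 * B u v = B (u + v) (u + v) - B (u - v) (u - v) := by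
      simp only [map_add, map_sub, _root_.add_apply, _root_.sub_apply, hB v u]
      ring
    have hpar : c * ‖u + v‖ ^ 2 + c * ‖u - v‖ ^ 2 = c * (2 * (‖u‖ ^ 2 + ‖v‖ ^ 2)) := by
      rw [← mul_add, parallelogram_law_with_norm ℝ]
    linarith [(abs_le.1 (h (u + v))).2, (abs_le.1 (h (u - v))).1]
  refine ContinuousLinearMap.opNorm_le_of_unit_norm hc fun u hu =>
    ContinuousLinearMap.opNorm_le_of_unit_norm hc fun v hv => abs_le.2 ⟨?_, ?_⟩
  · have := hpolar (-u) v
    rw [norm_neg, hu, hv, map_neg, _root_.neg_apply] at this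
    linarith
  · have := hpolar u v
    rw [hu, hv] at this
    linarith

theorem exists_lipschitz_hessian (hA : ∀ x y, A x y = A y x) (hF : ContDiff ℝ 2 F) {t : ℝ}
    (h : IsC21loc (energy ι A F ℓ t)) {r : ℝ} (hr : 0 ≤ r) :
    ∃ C, 0 ≤ C ∧ ∀ x y : Z, ‖x‖ ≤ r → ‖y‖ ≤ r →
      ‖fderiv ℝ (fderiv ℝ F) x - fderiv ℝ (fderiv ℝ F) y‖ ≤ C * ‖x - y‖ := by
  obtain ⟨C, hC, hquad⟩ := h (r + 1) (by linarith)
  simp only [fderiv_fderiv_energy hA hF] at hquad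
  have hmem : ∀ z : Z, ‖z‖ ≤ r → z ∈ Metric.ball (0 : Z) (r + 1) := fun z hz =>
    mem_ball_zero_iff.2 (by linarith)
  refine ⟨C, hC, fun x y hx hy => ?_⟩
  rw [← energyHessian_sub (A := A)]
  refine norm_le_of_quadratic_le (fun u v => ?_) (by positivity) fun v => abs_le.2 ⟨?_, ?_⟩
  · simp only [_root_.sub_apply, energyHessian_symm hA hF _ u v]
  · have := hquad y (hmem y hy) x (hmem x hx) v
    rw [← neg_sub, _root_.neg_apply, _root_.neg_apply, norm_sub_rev] at this
    linarith
  · exact hquad x (hmem x hx) y (hmem y hy) v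

theorem isEnergyDeriv (hA : ∀ x y, A x y = A y x) (hF : ContDiff ℝ 2 F) {t r C κ : ℝ}
    (hκ : 0 < κ) (hr : 0 ≤ r) (hC : 0 ≤ C) (hCF : ∀ x y : Z, ‖x‖ ≤ r → ‖y‖ ≤ r →
      ‖fderiv ℝ (fderiv ℝ F) x - fderiv ℝ (fderiv ℝ F) y‖ ≤ C * ‖x - y‖)
    (hconv : IsUniformlyConvex κ (energy ι A F ℓ t)) :
    IsEnergyDeriv r (‖energyHessian A F 0‖ + C * r) C κ (energyDeriv A F)
      (energyHessian A F) where
  pos := hκ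
  nonneg := hC
  hasFDerivAt := hasFDerivAt_energyDeriv hF
  symm := energyHessian_symm hA hF
  coercive x v := (hconv x v).trans_eq (by rw [fderiv_fderiv_energy hA hF])
  bound x hx := by
    have hlip := hCF x 0 hx (by rwa [norm_zero])
    rw [← energyHessian_sub (A := A), sub_zero] at hlip
    linarith [norm_le_norm_add_norm_sub' (energyHessian A F x) (energyHessian A F 0),
      mul_le_mul_of_nonneg_left hx hC]
  lipschitz x y hx hy := by
    rw [energyHessian_sub]
    exact hCF x y hx hy

end Energy

section Minimization

variable {Z : Type*} [NormedAddCommGroup Z] [NormedSpace ℝ Z]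

theorem add_sq_norm_le_of_strongly_monotone {I : Z → ℝ} {g : Z → StrongDual ℝ Z} {κ : ℝ}
    (hI : ∀ z, HasFDerivAt I (g z) z)
    (hg : ∀ x y, κ * ‖x - y‖ ^ 2 ≤ (g x - g y) (x - y)) (x y : Z) :
    I y + g y (x - y) + κ / 2 * ‖x - y‖ ^ 2 ≤ I x := by
  set w := x - y with hw
  let φ : ℝ → ℝ := fun s => I (y + s • w) - s * g y w - κ / 2 * ‖w‖ ^ 2 * s ^ 2
  have hφ : ∀ s, HasDerivAt φ (g (y + s • w) w - g y w - κ * s * ‖w‖ ^ 2) s := by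
    intro s
    have hline : HasDerivAt (fun s : ℝ => y + s • w) w s := by
      simpa only [id_eq, one_smul] using ((hasDerivAt_id s).smul_const w).const_add y
    have hI' : HasDerivAt (fun s : ℝ => I (y + s • w)) (g (y + s • w) w) s :=
      (hI (y + s • w)).comp_hasDerivAt s hline
    have hlin : HasDerivAt (fun s : ℝ => s * g y w) (g y w) s := by
      simpa only [id_eq, one_mul] using (hasDerivAt_id s).mul_const (g y w)
    refine ((hI'.sub hlin).sub ((hasDerivAt_pow 2 s).const_mul (κ / 2 * ‖w‖ ^ 2))).congr_deriv ?_
    push_cast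
    ring
  have hmono : MonotoneOn φ (Icc 0 1) := by
    refine monotoneOn_of_deriv_nonneg (convex_Icc 0 1)
      (fun s _ => (hφ s).continuousAt.continuousWithinAt)
      (fun s _ => (hφ s).differentiableAt.differentiableWithinAt) fun s hs => ?_
    rw [interior_Icc] at hs
    rw [(hφ s).deriv]
    have hgs := hg (y + s • w) y
    rw [add_sub_cancel_left, map_smul, norm_smul, Real.norm_of_nonneg hs.1.le, smul_eq_mul,
      _root_.sub_apply] at hgs
    refine nonneg_of_mul_nonneg_right ?_ hs.1
    linarith
  have hle := hmono (left_mem_Icc.2 zero_le_one) (right_mem_Icc.2 zero_le_one) zero_le_one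
  have hend : y + w = x := by rw [hw, add_sub_cancel]
  simp only [φ, zero_smul, add_zero, one_smul, hend] at hle
  linarith

theorem strongConvexOn_of_strongly_monotone {I : Z → ℝ} {g : Z → StrongDual ℝ Z} {κ : ℝ}
    (hI : ∀ z, HasFDerivAt I (g z) z)
    (hg : ∀ x y, κ * ‖x - y‖ ^ 2 ≤ (g x - g y) (x - y)) : StrongConvexOn univ κ I := by
  refine ⟨convex_univ, fun x _ y _ a b ha hb hab => ?_⟩
  obtain rfl : b = 1 - a := by linarith
  set z := a • x + (1 - a) • y with hz
  have hxz : x - z = (1 - a) • (x - y) := by rw [hz]; module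
  have hyz : y - z = -a • (x - y) := by rw [hz]; module
  have hx := mul_le_mul_of_nonneg_left (add_sq_norm_le_of_strongly_monotone hI hg x z) ha
  have hy := mul_le_mul_of_nonneg_left (add_sq_norm_le_of_strongly_monotone hI hg y z) hb
  rw [hxz, map_smul, norm_smul, mul_pow, Real.norm_eq_abs, sq_abs, smul_eq_mul] at hx
  rw [hyz, map_smul, norm_smul, mul_pow, Real.norm_eq_abs, sq_abs, smul_eq_mul] at hy
  simp only [smul_eq_mul]
  linarith

theorem bddBelow_range_of_strongly_monotone {I : Z → ℝ} {g : Z → StrongDual ℝ Z} {κ : ℝ}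
    (hκ : 0 < κ) (hI : ∀ z, HasFDerivAt I (g z) z)
    (hg : ∀ x y, κ * ‖x - y‖ ^ 2 ≤ (g x - g y) (x - y)) : BddBelow (range I) := by
  refine ⟨I 0 - ‖g 0‖ ^ 2 / (2 * κ), ?_⟩
  rintro _ ⟨x, rfl⟩
  have hfirst := add_sq_norm_le_of_strongly_monotone hI hg x 0
  have hdual := neg_le_of_abs_le ((g 0).le_opNorm (x - 0))
  have hsq : ‖g 0‖ ^ 2 / (2 * κ) + κ / 2 * ‖x - 0‖ ^ 2 - ‖g 0‖ * ‖x - 0‖ =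
      (‖g 0‖ - κ * ‖x - 0‖) ^ 2 / (2 * κ) := by
    field_simp
    ring
  have : 0 ≤ (‖g 0‖ - κ * ‖x - 0‖) ^ 2 / (2 * κ) := by positivity
  linarith

theorem sq_norm_sub_le_of_strongConvexOn {f : Z → ℝ} {S : Set Z} {m b : ℝ}
    (hf : StrongConvexOn S m f) (hb : ∀ z ∈ S, b ≤ f z) {x y : Z} (hx : x ∈ S) (hy : y ∈ S) :
    m / 8 * ‖x - y‖ ^ 2 ≤ ((f x - b) + (f y - b)) / 2 := by
  have hhalf : (0 : ℝ) ≤ 1 / 2 := one_half_pos.le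
  have hmid := hf.2 hx hy hhalf hhalf (add_halves 1)
  have := hb _ (hf.1 hx hy hhalf hhalf (add_halves 1))
  simp only [smul_eq_mul] at hmid
  linarith

theorem exists_isMinOn_of_strongConvexOn [CompleteSpace Z] {f : Z → ℝ} {S : Set Z} {m : ℝ}
    (hm : 0 < m) (hf : StrongConvexOn S m f) (hS : IsClosed S) (hne : S.Nonempty)
    (hcont : ContinuousOn f S) (hbdd : BddBelow (f '' S)) : ∃ x ∈ S, IsMinOn f S x := by
  obtain ⟨u, hanti, hu, huS⟩ := exists_seq_tendsto_sInf (hne.image f) hbdd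
  choose x hxS hxu using huS
  set b := sInf (f '' S)
  have hb : ∀ z ∈ S, b ≤ f z := fun z hz => csInf_le hbdd (mem_image_of_mem f hz)
  have hcauchy : CauchySeq x := by
    refine cauchySeq_of_le_tendsto_0 (fun n => √(8 / m * (u n - b))) (fun i k n hi hk => ?_) ?_
    · have hsq := sq_norm_sub_le_of_strongConvexOn hf hb (hxS i) (hxS k)
      rw [hxu, hxu] at hsq
      rw [dist_eq_norm]
      refine Real.le_sqrt_of_sq_le ?_
      calc ‖x i - x k‖ ^ 2 = 8 / m * (m / 8 * ‖x i - x k‖ ^ 2) := by field_simp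
        _ ≤ 8 / m * (u n - b) :=
          mul_le_mul_of_nonneg_left (by linarith [hanti hi, hanti hk]) (by positivity)
    · simpa only [sub_self, mul_zero, Real.sqrt_zero] using
        ((hu.sub_const b).const_mul (8 / m)).sqrt
  obtain ⟨a, ha⟩ := cauchySeq_tendsto_of_complete hcauchy
  have haS := hS.mem_of_tendsto ha (Eventually.of_forall hxS)
  have hfa : Tendsto (fun n => f (x n)) atTop (𝓝 (f a)) :=
    (hcont a haS).tendsto.comp (tendsto_nhdsWithin_iff.2 ⟨ha, Eventually.of_forall hxS⟩)
  simp only [hxu] at hfa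
  exact ⟨a, haS, fun z hz => (tendsto_nhds_unique hfa hu).trans_le (hb z hz)⟩

variable {V : Type*} [NormedAddCommGroup V] [NormedSpace ℝ V] {ι : Z →L[ℝ] V} {R : Z → ℝ}
  {ρ τ : ℝ}

theorem IsSublinear.convexOn (hR : IsSublinear ρ R) : ConvexOn ℝ univ R := by
  refine convexOn_iff_forall_pos.2 ⟨convex_univ, fun u _ v _ a b ha hb _ => ?_⟩
  rw [smul_eq_mul, smul_eq_mul, ← hR.homogeneous a ha, ← hR.homogeneous b hb]
  exact hR.subadditive _ _

theorem convex_closed_tube (ι : Z →L[ℝ] V) (τ : ℝ) (x : Z) : Convex ℝ {w | ‖ι (w - x)‖ ≤ τ} := by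
  have hball : {w | ‖ι (w - x)‖ ≤ τ} = ι ⁻¹' Metric.closedBall (ι x) τ := by
    ext w
    rw [mem_preimage, mem_closedBall_iff_norm, ← map_sub, mem_ofPred_eq]
  rw [hball]
  exact (convex_closedBall (ι x) τ).is_linear_preimage ι.isBoundedLinearMap.toIsLinearMap

theorem exists_local_minimizer [CompleteSpace Z] {I : Z → ℝ} {g : Z → StrongDual ℝ Z} {κ : ℝ}
    (hκ : 0 < κ) (hI : ∀ z, HasFDerivAt I (g z) z)
    (hg : ∀ x y, κ * ‖x - y‖ ^ 2 ≤ (g x - g y) (x - y)) (hR : IsSublinear ρ R) (hτ : 0 ≤ τ)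
    (x : Z) : ∃ x', ‖ι (x' - x)‖ ≤ τ ∧
      ∀ w, ‖ι (w - x)‖ ≤ τ → I x' + R (x' - x) ≤ I w + R (w - x) := by
  have hcont : Continuous I := continuous_iff_continuousAt.2 fun z => (hI z).continuousAt
  have hRx : ConvexOn ℝ univ fun w => R (w - x) := by
    simpa only [sub_eq_add_neg, preimage_univ, Function.comp_def] using
      hR.convexOn.translate_left (-x)
  have hsum : StrongConvexOn univ κ fun w => I w + R (w - x) := by
    have := (strongConvexOn_of_strongly_monotone hI hg).add hRx.uniformConvexOn_zero
    rwa [add_zero] at this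
  obtain ⟨b, hb⟩ := bddBelow_range_of_strongly_monotone hκ hI hg
  have hS := convex_closed_tube ι τ x
  obtain ⟨x', hx', hmin⟩ := exists_isMinOn_of_strongConvexOn hκ
    ⟨hS, fun u _ v _ => hsum.2 (mem_univ u) (mem_univ v)⟩
    (isClosed_le (by fun_prop) continuous_const)
    ⟨x, by simpa only [sub_self, _root_.map_zero, norm_zero, mem_ofPred_eq]⟩
    (hcont.add (hR.continuous.comp (continuous_id.sub continuous_const))).continuousOn
    ⟨b, forall_mem_image.2 fun w _ => (hb (mem_range_self w)).trans
      (le_add_of_nonneg_right (hR.nonneg _))⟩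
  exact ⟨x', hx', fun w hw => hmin hw⟩

variable {I : Z → ℝ} {g : StrongDual ℝ Z} {x x' : Z}

theorem dissipation_le_of_local_minimizer (hR : IsSublinear ρ R) (hI : HasFDerivAt I g x')
    (hx' : ‖ι (x' - x)‖ ≤ τ)
    (hmin : ∀ w, ‖ι (w - x)‖ ≤ τ → I x' + R (x' - x) ≤ I w + R (w - x)) :
    R (x' - x) ≤ (-g) (x' - x) := by
  have hslope := (hI.hasLineDerivAt (-(x' - x))).tendsto_slope_zero_right
  rw [map_neg] at hslope
  refine ge_of_tendsto hslope ?_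
  filter_upwards [Ioo_mem_nhdsGT (zero_lt_one' ℝ)] with s hs
  have hs1 : 0 < 1 - s := sub_pos.2 hs.2
  have hshift : x' + s • -(x' - x) - x = (1 - s) • (x' - x) := by module
  have hadm : ‖ι (x' + s • -(x' - x) - x)‖ ≤ τ := by
    rw [hshift, map_smul, norm_smul, Real.norm_of_nonneg hs1.le]
    exact (mul_le_of_le_one_left (norm_nonneg _) (by linarith [hs.1])).trans hx'
  have hcompare := hmin _ hadm
  rw [hshift, hR.homogeneous _ hs1] at hcompare
  rw [smul_eq_mul, le_inv_mul_iff₀ hs.1]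
  linarith

theorem stable_of_local_minimizer (hR : IsSublinear ρ R) (hI : HasFDerivAt I g x')
    (hx' : ‖ι (x' - x)‖ < τ)
    (hmin : ∀ w, ‖ι (w - x)‖ ≤ τ → I x' + R (x' - x) ≤ I w + R (w - x)) (u : Z) :
    (-g) u ≤ R u := by
  have hslope := (hI.hasLineDerivAt u).tendsto_slope_zero_right
  rw [_root_.neg_apply, neg_le]
  refine ge_of_tendsto hslope ?_
  have hcont : Continuous fun s : ℝ => ‖ι (x' + s • u - x)‖ := by fun_prop
  have hadm : ∀ᶠ s : ℝ in 𝓝[>] 0, ‖ι (x' + s • u - x)‖ < τ :=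
    nhdsWithin_le_nhds (hcont.continuousAt.eventually_lt_const
      (by simpa only [zero_smul, add_zero] using hx'))
  filter_upwards [hadm, self_mem_nhdsWithin] with s hs (hs0 : 0 < s)
  have hcompare := hmin _ hs.le
  have hsub := hR.subadditive (x' - x) (s • u)
  rw [hR.homogeneous _ hs0] at hsub
  rw [add_sub_right_comm] at hcompare
  rw [smul_eq_mul, le_inv_mul_iff₀ hs0]
  linarith

end Minimization

/-! ### The local minimization scheme -/

section Interpolant

variable {E : Type*} [NormedAddCommGroup E] [NormedSpace ℝ E] {s t : ℕ → ℝ} {N : ℕ} {r : ℝ}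

theorem interp_sub_interp (t : ℕ → ℝ) (N : ℕ) (x y : ℕ → E) (r : ℝ) :
    interp t N x r - interp t N y r = interp t N (fun k => x k - y k) r := by
  simp only [interp, add_sub_add_comm, ← Finset.sum_sub_distrib, ← smul_sub, sub_sub_sub_comm]

theorem norm_interp_sub_le (ht : ∀ k < N, t k < t (k + 1)) (hN : 0 < N) {x y : ℕ → E} {τ : ℝ}
    (hxy : ∀ k ≤ N, ‖x k - y k‖ ≤ τ) (hr : r ∈ Icc (t 0) (t N)) :
    ‖interp t N x r - interp t N y r‖ ≤ τ := by
  rw [interp_sub_interp, ← mem_closedBall_zero_iff]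
  exact interp_mem_of_convex ht hN (convex_closedBall 0 τ)
    (fun k hk => mem_closedBall_zero_iff.2 (hxy k hk)) hr

theorem interp_self (ht : ∀ k < N, t k < t (k + 1)) (hN : 0 < N) (hr : r ∈ Icc (t 0) (t N)) :
    interp t N t r = r := by
  obtain ⟨k, hk, hrk⟩ := exists_closed_cell ht hN hr
  rw [interp_of_mem ht t hk hrk, smul_eq_mul, div_mul_cancel₀ _ (sub_pos.2 (ht k hk)).ne',
    add_sub_cancel]

theorem interp_interp (hs : ∀ k < N, s k < s (k + 1)) (ht : ∀ k < N, t k < t (k + 1))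
    (hN : 0 < N) (x : ℕ → E) (hr : r ∈ Icc (s 0) (s N)) :
    interp t N x (interp s N t r) = interp s N x r := by
  obtain ⟨k, hk, hrk⟩ := exists_closed_cell hs hN hr
  have hθ := grid_ratio_mem hs hk hrk
  have hmem : interp s N t r ∈ Icc (t k) (t (k + 1)) := by
    rw [interp_of_mem hs t hk hrk]
    exact (convex_Icc _ _).add_smul_sub_mem (left_mem_Icc.2 (ht k hk).le)
      (right_mem_Icc.2 (ht k hk).le) hθ
  rw [interp_of_mem ht x hk hmem, interp_of_mem hs t hk hrk, interp_of_mem hs x hk hrk,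
    add_sub_cancel_left, smul_eq_mul, mul_div_cancel_right₀ _ (sub_pos.2 (ht k hk)).ne']

theorem mapsTo_interp (hs : ∀ k < N, s k < s (k + 1)) (ht : ∀ k < N, t k < t (k + 1))
    (hN : 0 < N) : MapsTo (interp s N t) (Icc (s 0) (s N)) (Icc (t 0) (t N)) := fun _ hr =>
  interp_mem_of_convex hs hN (convex_Icc _ _)
    (fun k hk => ⟨grid_le ht k.zero_le hk, grid_le ht hk le_rfl⟩) hr

theorem bijOn_interp (hs : ∀ k < N, s k < s (k + 1)) (ht : ∀ k < N, t k < t (k + 1))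
    (hN : 0 < N) : BijOn (interp s N t) (Icc (s 0) (s N)) (Icc (t 0) (t N)) :=
  InvOn.bijOn (f' := interp t N s)
    ⟨fun _ hr => (interp_interp hs ht hN s hr).trans (interp_self hs hN hr),
      fun _ hr => (interp_interp ht hs hN t hr).trans (interp_self ht hN hr)⟩
    (mapsTo_interp hs ht hN) (mapsTo_interp ht hs hN)

theorem strictMonoOn_interp (hs : ∀ k < N, s k < s (k + 1)) (ht : ∀ k < N, t k < t (k + 1))
    (hN : 0 < N) : StrictMonoOn (interp s N t) (Icc (s 0) (s N)) := by
  have hs0N := grid_le hs N.zero_le le_rfl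
  refine (continuous_interp s N t).continuousOn.strictMonoOn_of_injOn_Icc hs0N ?_
    (bijOn_interp hs ht hN).injOn
  rw [interp_left hs t hN]
  exact (mapsTo_interp hs ht hN (right_mem_Icc.2 hs0N)).1

variable {τ : ℝ}

theorem mul_lt_succ_mul (hτ : 0 < τ) (k : ℕ) : (k : ℝ) * τ < (k + 1 : ℕ) * τ :=
  mul_lt_mul_of_pos_right (Nat.cast_lt.2 k.lt_succ_self) hτ

theorem affineInterpolant_of_mem (hτ : 0 < τ) (x : ℕ → E) {k : ℕ}
    (hr : r ∈ Icc (k * τ) ((k + 1 : ℕ) * τ)) :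
    affineInterpolant τ x r = x k + ((r - k * τ) / τ) • (x (k + 1) - x k) := by
  rcases hr.2.eq_or_lt with rfl | hlt
  · have hone : ((k + 1 : ℕ) * τ - k * τ) / τ = 1 := by
      rw [← sub_mul, mul_div_cancel_right₀ _ hτ.ne']
      push_cast
      ring
    rw [affineInterpolant, mul_div_cancel_right₀ _ hτ.ne', Nat.floor_natCast, sub_self, zero_div,
      zero_smul, add_zero, hone, one_smul, add_sub_cancel]
  · have hfloor : ⌊r / τ⌋₊ = k := by
      rw [Nat.floor_eq_iff (div_nonneg ((by positivity : 0 ≤ k * τ).trans hr.1) hτ.le),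
        le_div_iff₀ hτ, div_lt_iff₀ hτ]
      exact ⟨hr.1, by exact_mod_cast hlt⟩
    rw [affineInterpolant, hfloor]

theorem eqOn_affineInterpolant_interp (hτ : 0 < τ) (x : ℕ → E) (hN : 0 < N) :
    EqOn (affineInterpolant τ x) (interp (fun k => k * τ) N x) (Icc 0 (N * τ)) := by
  intro r hr
  obtain ⟨k, hk, hrk⟩ := exists_closed_cell (t := fun k => k * τ)
    (fun k _ => mul_lt_succ_mul hτ k) hN (by rwa [Nat.cast_zero, zero_mul])
  have hstep : ((k + 1 : ℕ) * τ - k * τ) = τ := by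
    push_cast
    ring
  rw [interp_of_mem (fun k _ => mul_lt_succ_mul hτ k) x hk hrk, affineInterpolant_of_mem hτ x hrk,
    hstep]

theorem bijOn_affineInterpolant (hτ : 0 < τ) (ht : ∀ k < N, t k < t (k + 1)) (hN : 0 < N) :
    BijOn (affineInterpolant τ t) (Icc 0 (N * τ)) (Icc (t 0) (t N)) := by
  have hbij := bijOn_interp (s := fun k => k * τ) (fun k _ => mul_lt_succ_mul hτ k) ht hN
  rw [Nat.cast_zero, zero_mul] at hbij
  exact hbij.congr (eqOn_affineInterpolant_interp hτ t hN).symm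

theorem strictMonoOn_affineInterpolant (hτ : 0 < τ) (ht : ∀ k < N, t k < t (k + 1))
    (hN : 0 < N) : StrictMonoOn (affineInterpolant τ t) (Icc 0 (N * τ)) := by
  have hmono := strictMonoOn_interp (s := fun k => k * τ) (fun k _ => mul_lt_succ_mul hτ k) ht hN
  rw [Nat.cast_zero, zero_mul] at hmono
  exact hmono.congr (eqOn_affineInterpolant_interp hτ t hN).symm

variable {Z : Type*} [NormedAddCommGroup Z] [InnerProductSpace ℝ Z] {T : ℝ}

theorem retransformed_eq_interp (hτ : 0 < τ) (hN : 0 < finalIndex T t)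
    (ht : ∀ k < finalIndex T t, t k < t (k + 1)) (z : ℕ → Z)
    (hr : r ∈ Icc (t 0) (t (finalIndex T t))) :
    retransformed T τ z t r = interp t (finalIndex T t) z r := by
  have himage := (bijOn_affineInterpolant hτ ht hN).surjOn hr
  have hmem := Function.invFunOn_mem himage
  have heq := Function.invFunOn_eq himage
  rw [eqOn_affineInterpolant_interp hτ t hN hmem] at heq
  rw [retransformed, artificialInterval, eqOn_affineInterpolant_interp hτ z hN hmem]
  nth_rewrite 2 [← heq]
  rw [interp_interp (fun k _ => mul_lt_succ_mul hτ k) ht hN z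
    (by rwa [Nat.cast_zero, zero_mul])]

end Interpolant

section Scheme

theorem exists_eq_of_min_add_le {t : ℕ → ℝ} {c T : ℝ} (hc : 0 < c) (ht : ∀ k, t k ≤ T)
    (hstep : ∀ k, min (t k + c) T ≤ t (k + 1)) : ∃ k, t k = T := by
  by_contra! hne
  have hlt : ∀ k, t k < T := fun k => (ht k).lt_of_ne (hne k)
  have hadd : ∀ k, t k + c ≤ t (k + 1) := fun k =>
    (min_le_iff.1 (hstep k)).resolve_right (hlt (k + 1)).not_ge
  have hlow : ∀ k : ℕ, t 0 + k * c ≤ t k := by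
    intro k
    induction k with
    | zero => simp only [Nat.cast_zero, zero_mul, add_zero, le_refl]
    | succ k ih => push_cast; linarith [hadd k]
  obtain ⟨k, hk⟩ := exists_nat_gt ((T - t 0) / c)
  rw [div_lt_iff₀ hc] at hk
  linarith [hlow k, hlt k]

variable {Z V : Type*} [NormedAddCommGroup Z] [InnerProductSpace ℝ Z]
  [NormedAddCommGroup V] [InnerProductSpace ℝ V] {ι : Z →L[ℝ] V} {R : V → ℝ} {I : ℝ → Z → ℝ}
  {T M κ ρ τ : ℝ} {z₀ : Z} {L : ℝ → StrongDual ℝ Z} {D : Z → StrongDual ℝ Z}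

/-- The standing assumptions of the incremental scheme. The Lipschitz constant `M` of the load is
smaller than the convexity modulus `κ` of the energy, so that the state moves more slowly than the
time. -/
structure IsSubcritical (ι : Z →L[ℝ] V) (R : V → ℝ) (I : ℝ → Z → ℝ) (T : ℝ) (z₀ : Z) (M κ ρ : ℝ)
    (L : ℝ → StrongDual ℝ Z) (D : Z → StrongDual ℝ Z) : Prop where
  pos : 0 < T
  lt : M < κ
  norm_le : ∀ z, ‖ι z‖ ≤ ‖z‖
  hasFDerivAt : ∀ t z, HasFDerivAt (I t) (D z - L t) z
  monotone : ∀ x y, κ * ‖x - y‖ ^ 2 ≤ (D x - D y) (x - y)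
  lipschitz : ∀ s ∈ Icc 0 T, ∀ t ∈ Icc 0 T, ‖L s - L t‖ ≤ M * |s - t|
  sublinear : IsSublinear ρ fun z => R (ι z)
  init : ∀ w, (L 0 - D z₀) w ≤ R (ι w)

/-- The situation of the scheme after a step: the time is `t`, while the state `x` is stable for
the load at the previous time `s`, at most one step size earlier. -/
structure IsDelayedStable (T τ : ℝ) (L : ℝ → StrongDual ℝ Z) (D : Z → StrongDual ℝ Z) (R : Z → ℝ)
    (s t : ℝ) (x : Z) : Prop where
  nonneg : 0 ≤ s
  le : s ≤ t
  le_final : t ≤ T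
  delay_le : t - s ≤ τ
  stable : ∀ w, (L s - D x) w ≤ R w

theorem nonneg_of_norm_sub_le {E : Type*} [NormedAddCommGroup E] {f : ℝ → E} (hT : 0 < T)
    (hf : ∀ s ∈ Icc 0 T, ∀ t ∈ Icc 0 T, ‖f s - f t‖ ≤ M * |s - t|) : 0 ≤ M := by
  have h0T := (norm_nonneg _).trans (hf T (right_mem_Icc.2 hT.le) 0 (left_mem_Icc.2 hT.le))
  rw [sub_zero, abs_of_pos hT] at h0T
  exact nonneg_of_mul_nonneg_left h0T hT

namespace IsSubcritical

theorem nonneg (hE : IsSubcritical ι R I T z₀ M κ ρ L D) : 0 ≤ M :=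
  nonneg_of_norm_sub_le hE.pos hE.lipschitz

theorem modulus_pos (hE : IsSubcritical ι R I T z₀ M κ ρ L D) : 0 < κ :=
  hE.nonneg.trans_lt hE.lt

theorem exists_isLocalMinScheme [CompleteSpace Z] (hE : IsSubcritical ι R I T z₀ M κ ρ L D)
    (hτ : 0 ≤ τ) : ∃ (z : ℕ → Z) (t : ℕ → ℝ), IsLocalMinScheme ι R I T z₀ τ z t := by
  have hmin : ∀ t x, ∃ x', ‖ι (x' - x)‖ ≤ τ ∧ ∀ w, ‖ι (w - x)‖ ≤ τ →
      I t x' + R (ι (x' - x)) ≤ I t w + R (ι (w - x)) := fun t =>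
    exists_local_minimizer hE.modulus_pos (hE.hasFDerivAt t)
      (fun x y => by simpa only [sub_sub_sub_cancel_right] using hE.monotone x y) hE.sublinear hτ
  choose next hnext using hmin
  let state : ℕ → Z × ℝ := fun k => Nat.rec (z₀, 0)
    (fun _ p => (next p.2 p.1, min (p.2 + τ - ‖ι (next p.2 p.1 - p.1)‖) T)) k
  exact ⟨fun k => (state k).1, fun k => (state k).2, rfl, rfl,
    fun k => hnext (state k).2 (state k).1, fun _ => rfl⟩

theorem norm_sub_le (hE : IsSubcritical ι R I T z₀ M κ ρ L D) {s t : ℝ} {x x' : Z}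
    (hx : IsDelayedStable T τ L D (fun z => R (ι z)) s t x) (hx' : ‖ι (x' - x)‖ ≤ τ)
    (hmin : ∀ w, ‖ι (w - x)‖ ≤ τ → I t x' + R (ι (x' - x)) ≤ I t w + R (ι (w - x))) :
    κ * ‖x' - x‖ ≤ M * (t - s) := by
  have hpower := dissipation_le_of_local_minimizer (R := fun z => R (ι z)) hE.sublinear
    (hE.hasFDerivAt t x') hx' hmin
  have hforce : (D x' - D x) (x' - x) ≤ (L t - L s) (x' - x) := by
    have := (hx.stable (x' - x)).trans hpower
    simp only [_root_.sub_apply, _root_.neg_apply] at this ⊢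
    linarith
  have hload : ‖L t - L s‖ ≤ M * (t - s) := by
    simpa only [abs_of_nonneg (sub_nonneg.2 hx.le)] using hE.lipschitz t
      ⟨hx.nonneg.trans hx.le, hx.le_final⟩ s ⟨hx.nonneg, hx.le.trans hx.le_final⟩
  rcases (norm_nonneg (x' - x)).eq_or_lt with hzero | hpos
  · rw [← hzero, mul_zero]
    exact mul_nonneg hE.nonneg (sub_nonneg.2 hx.le)
  · refine le_of_mul_le_mul_right ?_ hpos
    calc κ * ‖x' - x‖ * ‖x' - x‖ = κ * ‖x' - x‖ ^ 2 := by ring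
      _ ≤ (L t - L s) (x' - x) := (hE.monotone x' x).trans hforce
      _ ≤ ‖L t - L s‖ * ‖x' - x‖ := dual_apply_le _ _
      _ ≤ M * (t - s) * ‖x' - x‖ := by gcongr

end IsSubcritical

namespace IsLocalMinScheme

variable {z : ℕ → Z} {t : ℕ → ℝ} {s : ℝ} {k : ℕ}

theorem norm_sub_le (hE : IsSubcritical ι R I T z₀ M κ ρ L D)
    (h : IsLocalMinScheme ι R I T z₀ τ z t)
    (hk : IsDelayedStable T τ L D (fun z => R (ι z)) s (t k) (z k)) :
    ‖z (k + 1) - z k‖ ≤ M / κ * τ := by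
  rw [div_mul_eq_mul_div, le_div_iff₀' hE.modulus_pos]
  exact (hE.norm_sub_le hk (h.mem_argmin k).1 (h.mem_argmin k).2).trans
    (mul_le_mul_of_nonneg_left hk.delay_le hE.nonneg)

theorem isDelayedStable_succ (hE : IsSubcritical ι R I T z₀ M κ ρ L D) (hτ : 0 < τ)
    (h : IsLocalMinScheme ι R I T z₀ τ z t)
    (hk : IsDelayedStable T τ L D (fun z => R (ι z)) s (t k) (z k)) :
    IsDelayedStable T τ L D (fun z => R (ι z)) (t k) (t (k + 1)) (z (k + 1)) := by
  have hslow : ‖ι (z (k + 1) - z k)‖ < τ :=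
    ((hE.norm_le _).trans (h.norm_sub_le hE hk)).trans_lt
      (mul_lt_of_lt_one_left hτ ((div_lt_one hE.modulus_pos).2 hE.lt))
  have hadvance := h.t_update k
  refine ⟨hk.nonneg.trans hk.le, hadvance ▸ le_min (by linarith) hk.le_final,
    hadvance ▸ min_le_right _ _, ?_, fun w => ?_⟩
  · have := hadvance.trans_le (min_le_left _ _)
    linarith [norm_nonneg (ι (z (k + 1) - z k))]
  · simpa only [neg_sub] using stable_of_local_minimizer (R := fun z => R (ι z)) hE.sublinear
      (hE.hasFDerivAt (t k) (z (k + 1))) hslow (h.mem_argmin k).2 w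

theorem isDelayedStable (hE : IsSubcritical ι R I T z₀ M κ ρ L D) (hτ : 0 < τ)
    (h : IsLocalMinScheme ι R I T z₀ τ z t) (k : ℕ) :
    IsDelayedStable T τ L D (fun z => R (ι z)) (t (k - 1)) (t k) (z k) := by
  induction k with
  | zero =>
    rw [Nat.zero_sub, h.t_zero, h.z_zero]
    exact ⟨le_rfl, le_rfl, hE.pos.le, (sub_self _).trans_le hτ.le, hE.init⟩
  | succ k ih => exact h.isDelayedStable_succ hE hτ ih

theorem min_add_le_t_succ (hE : IsSubcritical ι R I T z₀ M κ ρ L D) (hτ : 0 < τ)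
    (h : IsLocalMinScheme ι R I T z₀ τ z t) (k : ℕ) :
    min (t k + (1 - M / κ) * τ) T ≤ t (k + 1) := by
  rw [h.t_update k]
  refine min_le_min_right T ?_
  linarith [(hE.norm_le _).trans (h.norm_sub_le hE (h.isDelayedStable hE hτ k))]

theorem isIncremental (hE : IsSubcritical ι R I T z₀ M κ ρ L D) (hτ : 0 < τ)
    (h : IsLocalMinScheme ι R I T z₀ τ z t) :
    IsIncremental T z₀ L D (fun z => R (ι z)) τ (finalIndex T t) t fun k => z (k + 1) := by
  have hκ := hE.modulus_pos
  have hstable := h.isDelayedStable hE hτ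
  have hstep : ∀ k, κ * ‖z (k + 1) - z k‖ ≤ M * (t k - t (k - 1)) := fun k =>
    hE.norm_sub_le (hstable k) (h.mem_argmin k).1 (h.mem_argmin k).2
  have hgain : 0 < (1 - M / κ) * τ := mul_pos (sub_pos.2 ((div_lt_one hκ).2 hE.lt)) hτ
  have hadvance := h.min_add_le_t_succ hE hτ
  refine
    { t_zero := h.t_zero
      t_last := Nat.sInf_mem (exists_eq_of_min_add_le hgain (fun k => (hstable k).le_final)
        hadvance)
      t_lt := fun k hk => ?_
      t_step := fun k _ => (hstable (k + 1)).delay_le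
      init := ?_
      norm_step_le := fun k _ => ?_
      stable := fun k _ => (hstable (k + 1)).stable
      power := fun k _ => ?_ }
  · have hkT : t k < T := (hstable k).le_final.lt_of_ne (Nat.notMem_of_lt_sInf hk)
    exact (lt_min (lt_add_of_pos_right _ hgain) hkT).trans_le (hadvance k)
  · have hfirst := hstep 0
    rw [Nat.zero_sub, sub_self, mul_zero, h.z_zero] at hfirst
    exact sub_eq_zero.1 (norm_le_zero_iff.1 (nonpos_of_mul_nonpos_right hfirst hκ))
  · exact le_of_mul_le_mul_left ((hstep (k + 1)).trans
      (mul_le_mul_of_nonneg_right hE.lt.le (sub_nonneg.2 (hstable (k + 1)).le))) hκ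
  · simpa only [neg_sub] using dissipation_le_of_local_minimizer (R := fun z => R (ι z))
      hE.sublinear (hE.hasFDerivAt (t (k + 1)) (z (k + 2))) (h.mem_argmin (k + 1)).1
      (h.mem_argmin (k + 1)).2

end IsLocalMinScheme

end Scheme

/-! ### Error estimate -/

section ErrorEstimate

variable {Z V : Type*} [NormedAddCommGroup Z] [InnerProductSpace ℝ Z] {Λ C κ M ρ T τ : ℝ}
  {D : Z → StrongDual ℝ Z} {H : Z → Z →L[ℝ] StrongDual ℝ Z} {L m : ℝ → StrongDual ℝ Z}
  {W : ℝ → ℝ} {z₀ : Z}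

/-- The constant `K` of the error estimate `‖z_τ - z‖ ≤ K τ`, for a load with Lipschitz constant
`M` whose derivative has total variation `v`, and a Hessian with Lipschitz constant `C`. The
summand `1` is due to the shift of the discrete solution by one step. -/
noncomputable def errorConstant (κ M C T v : ℝ) : ℝ :=
  √(6 * Real.exp (6 * C / κ * T) / κ * (M + 4 * v + 5 * C * T)) + 1

theorem errorConstant_pos (κ M C T v : ℝ) : 0 < errorConstant κ M C T v :=
  add_pos_of_nonneg_of_pos (Real.sqrt_nonneg _) one_pos

theorem IsIncremental.norm_interp_sub_le {R : Z → ℝ} {N : ℕ} {t : ℕ → ℝ} {x : ℕ → Z} {y : ℝ → Z}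
    {σ : ℝ → StrongDual ℝ Z} {η : ℝ} {B : ℝ → ℝ} (hD : IsEnergyDeriv (‖z₀‖ + T) Λ C κ D H)
    (hR : IsSublinear ρ R) (hT : 0 < T) (hL : IsLoad T M L m W) (hτ : 0 ≤ τ)
    (h : IsIncremental T z₀ L D R τ N t x) (hy : IsApproxSolution T z₀ L D R η 0 y σ B) {r : ℝ}
    (hr : r ∈ Icc 0 T) :
    ‖interp t N x r - y r‖ ≤
      √(6 * Real.exp (6 * C / κ * T) / κ * (M + 4 * (W T - W 0) + 5 * C * T)) * τ := by
  have hsq := (h.isApproxSolution hD hR hT hL).sq_norm_sub_le hD hy hr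
  rw [add_zero, ← mul_assoc] at hsq
  have hsqrt := Real.le_sqrt_of_sq_le hsq
  rwa [Real.sqrt_mul' _ (sq_nonneg τ), Real.sqrt_sq hτ] at hsqrt

variable [NormedAddCommGroup V] [InnerProductSpace ℝ V] {ι : Z →L[ℝ] V} {R : V → ℝ}
  {I : ℝ → Z → ℝ}

theorem IsLocalMinScheme.norm_retransformed_sub_le {z : ℕ → Z} {t : ℕ → ℝ} {y : ℝ → Z}
    {σ : ℝ → StrongDual ℝ Z} {η : ℝ} {B : ℝ → ℝ} (hE : IsSubcritical ι R I T z₀ M κ ρ L D)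
    (hD : IsEnergyDeriv (‖z₀‖ + T) Λ C κ D H) (hL : IsLoad T M L m W) (hτ : 0 < τ)
    (h : IsLocalMinScheme ι R I T z₀ τ z t)
    (hy : IsApproxSolution T z₀ L D (fun z => R (ι z)) η 0 y σ B) {r : ℝ} (hr : r ∈ Icc 0 T) :
    ‖retransformed T τ z t r - y r‖ ≤ errorConstant κ M C T (W T - W 0) * τ := by
  have hinc := h.isIncremental hE hτ
  have hN := hinc.pos_of_pos hE.pos
  have hgrid : r ∈ Icc (t 0) (t (finalIndex T t)) := by rwa [hinc.t_zero, hinc.t_last]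
  have hstep : ∀ k ≤ finalIndex T t, ‖z k - z (k + 1)‖ ≤ τ := fun k _ => by
    rw [norm_sub_rev]
    exact (h.norm_sub_le hE (h.isDelayedStable hE hτ k)).trans
      (mul_le_of_le_one_left hτ.le ((div_lt_one hE.modulus_pos).2 hE.lt).le)
  rw [retransformed_eq_interp hτ hN hinc.t_lt z hgrid]
  have hshift := norm_interp_sub_le hinc.t_lt hN hstep hgrid
  have herror := hinc.norm_interp_sub_le hD hE.sublinear hE.pos hL hτ.le hy hr
  rw [errorConstant, add_mul, one_mul, add_comm]
  exact (norm_sub_le_norm_sub_add_norm_sub _ _ _).trans (add_le_add hshift herror)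

theorem IsApproxSolution.eqOn {R : Z → ℝ} {y₁ y₂ : ℝ → Z} {σ₁ σ₂ : ℝ → StrongDual ℝ Z}
    {η₁ η₂ : ℝ} {B₁ B₂ : ℝ → ℝ} (hD : IsEnergyDeriv (‖z₀‖ + T) Λ C κ D H)
    (h₁ : IsApproxSolution T z₀ L D R η₁ 0 y₁ σ₁ B₁)
    (h₂ : IsApproxSolution T z₀ L D R η₂ 0 y₂ σ₂ B₂) : EqOn y₁ y₂ (Icc 0 T) := by
  intro t ht
  have hsq := h₁.sq_norm_sub_le hD h₂ ht
  rw [add_zero, mul_zero] at hsq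
  exact sub_eq_zero.1 (norm_eq_zero.1 (pow_eq_zero_iff two_ne_zero |>.1
    (hsq.antisymm (sq_nonneg _))))

namespace IsSubcritical

theorem isDifferentialSolution_iff (hE : IsSubcritical ι R I T z₀ M κ ρ L D) {ρ' : ℝ}
    (hR : IsSublinear ρ' R) {y : ℝ → Z} :
    IsDifferentialSolution ι R I T z₀ y ↔ IsStrongSolution T z₀ L D (fun z => R (ι z)) y := by
  simp only [IsDifferentialSolution, IsStrongSolution, hR.inclusion_iff,
    (hE.hasFDerivAt _ _).fderiv, neg_sub]

theorem isApproxSolution [CompleteSpace Z] (hE : IsSubcritical ι R I T z₀ M κ ρ L D)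
    (hD : IsEnergyDeriv (‖z₀‖ + T) Λ C κ D H) {y : ℝ → Z}
    (hy : IsStrongSolution T z₀ L D (fun z => R (ι z)) y) :
    IsApproxSolution T z₀ L D (fun z => R (ι z)) 0 0 y (fun t => L t - D (y t)) 0 :=
  hy.isApproxSolution hD hE.sublinear hE.pos fun s hs t ht => (hE.lipschitz s hs t ht).trans
    (mul_le_mul_of_nonneg_right hE.lt.le (abs_nonneg _))

theorem exists_isStrongSolution [CompleteSpace Z] (hE : IsSubcritical ι R I T z₀ M κ ρ L D)
    (hD : IsEnergyDeriv (‖z₀‖ + T) Λ C κ D H) (hL : IsLoad T M L m W) :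
    ∃ z, IsStrongSolution T z₀ L D (fun z => R (ι z)) z := by
  have hstep : ∀ n : ℕ, (0 : ℝ) < 1 / (n + 1) := fun n => Nat.one_div_pos_of_nat
  have hlim : Tendsto (fun n : ℕ => (1 : ℝ) / (n + 1)) atTop (𝓝 0) :=
    tendsto_one_div_add_atTop_nhds_zero_nat
  refine RIS.exists_isStrongSolution
    (η := fun n => (2 * (W T - W 0) + 2 * C * T) * (1 / ((n : ℝ) + 1)))
    (β := fun n => (M + 4 * (W T - W 0) + 5 * C * T) * (1 / ((n : ℝ) + 1)) ^ 2)
    hD hE.sublinear hE.pos.le hE.lipschitz hE.nonneg ?_ ?_ fun n => ?_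
  · simpa only [mul_zero] using hlim.const_mul (2 * (W T - W 0) + 2 * C * T)
  · simpa only [zero_pow two_ne_zero, mul_zero] using
      (hlim.pow 2).const_mul (M + 4 * (W T - W 0) + 5 * C * T)
  · obtain ⟨z, t, h⟩ := hE.exists_isLocalMinScheme (hstep n).le
    exact ⟨_, _, _, (h.isIncremental hE (hstep n)).isApproxSolution hD hE.sublinear hE.pos hL⟩

end IsSubcritical

theorem tendstoUniformlyOn_of_norm_sub_le_mul {α E : Type*} [NormedAddCommGroup E]
    {f : ℝ → α → E} {g : α → E} {S : Set α} {K : ℝ}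
    (h : ∀ τ, 0 < τ → ∀ x ∈ S, ‖f τ x - g x‖ ≤ K * τ) : TendstoUniformlyOn f g (𝓝[>] 0) S := by
  refine Metric.tendstoUniformlyOn_iff.2 fun ε hε => ?_
  have hlim : Tendsto (fun τ : ℝ => K * τ) (𝓝[>] 0) (𝓝 0) :=
    tendsto_nhdsWithin_of_tendsto_nhds ((continuous_const_mul K).tendsto' 0 0 (mul_zero K))
  filter_upwards [hlim.eventually_lt_const hε, self_mem_nhdsWithin] with τ hτε hτ x hx
  rw [dist_comm, dist_eq_norm]
  exact (h τ hτ x hx).trans_lt hτε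

/-- `A` drops out of differences of Hessians, so a single admissible `A` provides the constant. -/
theorem exists_uniform_lipschitz_hessian (ι : Z →L[ℝ] V) (ℓ : ℝ → StrongDual ℝ V) {F : Z → ℝ}
    (hF : ContDiff ℝ 2 F) (t : ℝ) {r : ℝ} (hr : 0 ≤ r) :
    ∃ C, 0 ≤ C ∧ ∀ A : Z →L[ℝ] StrongDual ℝ Z, (∀ x y, A x y = A y x) →
      IsC21loc (energy ι A F ℓ t) → ∀ x y : Z, ‖x‖ ≤ r → ‖y‖ ≤ r →
        ‖fderiv ℝ (fderiv ℝ F) x - fderiv ℝ (fderiv ℝ F) y‖ ≤ C * ‖x - y‖ := by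
  by_cases h : ∃ A : Z →L[ℝ] StrongDual ℝ Z,
      (∀ x y, A x y = A y x) ∧ IsC21loc (energy ι A F ℓ t)
  · obtain ⟨A, hA, hreg⟩ := h
    obtain ⟨C, hC, hlip⟩ := exists_lipschitz_hessian hA hF hreg hr
    exact ⟨C, hC, fun _ _ _ => hlip⟩
  · exact ⟨0, le_rfl, fun A hA hreg => (h ⟨A, hA, hreg⟩).elim⟩

theorem isSubcritical_energy {A : Z →L[ℝ] StrongDual ℝ Z} {F : Z → ℝ} {ℓ : ℝ → StrongDual ℝ V}
    (hι : ∀ z, ‖ι z‖ ≤ ‖z‖) (hT : 0 < T) (hMκ : M < κ)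
    (hlip : ∀ s ∈ Icc 0 T, ∀ t ∈ Icc 0 T, ‖(ℓ s).comp ι - (ℓ t).comp ι‖ ≤ M * |s - t|)
    (hA : ∀ x y, A x y = A y x) (hF : Differentiable ℝ F)
    (hmono : ∀ x y,
      κ * ‖x - y‖ ^ 2 ≤ (energyDeriv A F x - energyDeriv A F y) (x - y))
    (hR : IsSublinear ρ R) (hinit : Inclusion ι R (energy ι A F ℓ 0) 0 z₀) :
    IsSubcritical ι R (energy ι A F ℓ) T z₀ M κ |ρ| (fun t => (ℓ t).comp ι)
      (energyDeriv A F) where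
  pos := hT
  lt := hMκ
  norm_le := hι
  hasFDerivAt := hasFDerivAt_energy hA hF
  monotone := hmono
  lipschitz := hlip
  sublinear := hR.comp_embedding hι
  init := by
    simpa only [(hasFDerivAt_energy hA hF 0 z₀).fderiv, neg_sub] using (hR.inclusion_iff.1 hinit).1

end ErrorEstimate

end RIS

theorem theorem3p9_general
    {Z V : Type*}
    [NormedAddCommGroup Z] [InnerProductSpace ℝ Z] [CompleteSpace Z]
    [NormedAddCommGroup V] [InnerProductSpace ℝ V]
    (ι : Z →L[ℝ] V) (hι : ∀ z, ‖ι z‖ ≤ ‖z‖)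
    (T : ℝ) (hT : 0 < T)
    (F : Z → ℝ) (hF : ContDiff ℝ 2 F)
    (κ M : ℝ) (hMκ : M < κ)
    (ℓ : ℝ → StrongDual ℝ V)
    (hℓLip : ∀ s ∈ Icc 0 T, ∀ t ∈ Icc 0 T, ‖ℓ s - ℓ t‖ ≤ M * |s - t|)
    (hℓBV : RIS.IsLoadBV T ℓ)
    (z₀ : Z) :
    ∃ K : ℝ, 0 < K ∧
      ∀ A : Z →L[ℝ] StrongDual ℝ Z, (∀ x y, A x y = A y x) →
      ∀ (R : V → ℝ) (ρ : ℝ), RIS.IsSublinear ρ R →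
      RIS.IsC21loc (RIS.energy ι A F ℓ 0) →
      RIS.IsUniformlyConvex κ (RIS.energy ι A F ℓ 0) →
      RIS.Inclusion ι R (RIS.energy ι A F ℓ 0) 0 z₀ →
      ∃ z : ℝ → Z, RIS.IsDifferentialSolution ι R (RIS.energy ι A F ℓ) T z₀ z ∧
        (∀ y : ℝ → Z, RIS.IsDifferentialSolution ι R (RIS.energy ι A F ℓ) T z₀ y →
          EqOn y z (Icc 0 T)) ∧
        (∀ τ : ℝ, 0 < τ → ∃ (zk : ℕ → Z) (tk : ℕ → ℝ),
          RIS.IsLocalMinScheme ι R (RIS.energy ι A F ℓ) T z₀ τ zk tk) ∧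
        (∀ τ : ℝ, 0 < τ → ∀ (zk : ℕ → Z) (tk : ℕ → ℝ),
          RIS.IsLocalMinScheme ι R (RIS.energy ι A F ℓ) T z₀ τ zk tk →
            tk (RIS.finalIndex T tk) = T ∧
            StrictMonoOn (RIS.affineInterpolant τ tk) (RIS.artificialInterval T τ tk) ∧
            BijOn (RIS.affineInterpolant τ tk) (RIS.artificialInterval T τ tk) (Icc 0 T) ∧
            ∀ t ∈ Icc 0 T, ‖RIS.retransformed T τ zk tk t - z t‖ ≤ K * τ) ∧
        (∀ (zk : ℝ → ℕ → Z) (tk : ℝ → ℕ → ℝ),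
          (∀ τ : ℝ, 0 < τ →
            RIS.IsLocalMinScheme ι R (RIS.energy ι A F ℓ) T z₀ τ (zk τ) (tk τ)) →
          TendstoUniformlyOn (fun τ => RIS.retransformed T τ (zk τ) (tk τ)) z
            (𝓝[>] 0) (Icc 0 T)) := by
  have hκ : 0 < κ := (RIS.nonneg_of_norm_sub_le hT hℓLip).trans_lt hMκ
  have hr : 0 ≤ ‖z₀‖ + T := by positivity
  obtain ⟨m, W, hL⟩ := RIS.exists_isLoad hι hT.le hℓLip hℓBV
  obtain ⟨C, hC, hCF⟩ := RIS.exists_uniform_lipschitz_hessian ι ℓ hF 0 hr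
  refine ⟨RIS.errorConstant κ M C T (W T - W 0), RIS.errorConstant_pos _ _ _ _ _,
    fun A hA R ρ hR hreg hconv hinit => ?_⟩
  have hD := RIS.isEnergyDeriv hA hF hκ hr hC (hCF A hA hreg) hconv
  have hE := RIS.isSubcritical_energy hι hT hMκ hL.lipschitz hA (hF.differentiable two_ne_zero)
    hD.monotone hR hinit
  obtain ⟨z, hz⟩ := hE.exists_isStrongSolution hD hL
  have hz₀ := hE.isApproxSolution hD hz
  refine ⟨z, (hE.isDifferentialSolution_iff hR).2 hz, fun y hy => ?_,
    fun τ hτ => hE.exists_isLocalMinScheme hτ.le, fun τ hτ zk tk h => ?_, fun zk tk h => ?_⟩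
  · exact (hE.isApproxSolution hD ((hE.isDifferentialSolution_iff hR).1 hy)).eqOn hD hz₀
  · have hinc := h.isIncremental hE hτ
    have hN := hinc.pos_of_pos hT
    have hbij := RIS.bijOn_affineInterpolant hτ hinc.t_lt hN
    rw [hinc.t_zero, hinc.t_last] at hbij
    exact ⟨hinc.t_last, RIS.strictMonoOn_affineInterpolant hτ hinc.t_lt hN, hbij,
      fun _ ht => h.norm_retransformed_sub_le hE hD hL hτ hz₀ ht⟩
  · exact RIS.tendstoUniformlyOn_of_norm_sub_le_mul fun τ hτ t ht =>
      (h τ hτ).norm_retransformed_sub_le hE hD hL hτ hz₀ ht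

theorem theorem3p9
    {Z V X : Type*}
    [NormedAddCommGroup Z] [InnerProductSpace ℝ Z] [CompleteSpace Z]
    [NormedAddCommGroup V] [InnerProductSpace ℝ V] [CompleteSpace V]
    [NormedAddCommGroup X] [NormedSpace ℝ X] [CompleteSpace X]
    (ι : Z →L[ℝ] V) (hι : RIS.IsCompactDenseEmbedding ι)
    (j : V →L[ℝ] X) (hj : Function.Injective j)
    (T : ℝ) (hT : 0 < T)
    (F : Z → ℝ) (hF : RIS.IsLowerOrder ι F)
    (α κ δ M : ℝ) (hα : 0 < α) (hκ : 0 < κ) (hδ : 0 < δ) (hδκ : δ ≤ κ)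
    (ℓ : ℝ → StrongDual ℝ V)
    (hℓLip : ∀ s ∈ Set.Icc 0 T, ∀ t ∈ Set.Icc 0 T, ‖ℓ s - ℓ t‖ ≤ (κ - δ) * |s - t|)
    (hℓBV : RIS.IsLoadBV T ℓ)
    (z₀ : Z) :
    -- the constant may depend on all of the above, but not on `A` beyond `α` and `‖A‖ = M`,
    -- not on `R`, and not on `τ`
    ∃ K : ℝ, 0 < K ∧
      ∀ A : Z →L[ℝ] StrongDual ℝ Z, RIS.IsCoerciveSymm α A → ‖A‖ = M →
      ∀ R : V → ℝ, RIS.IsDissipation j R →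
      (∀ t ∈ Set.Icc 0 T, RIS.IsC21loc (RIS.energy ι A F ℓ t)) →
      (∀ t ∈ Set.Icc 0 T, RIS.IsUniformlyConvex κ (RIS.energy ι A F ℓ t)) →
      -- the initial state is locally stable
      RIS.Inclusion ι R (RIS.energy ι A F ℓ 0) 0 z₀ →
      -- there is a differential solution `z`, unique on `[0,T]`
      ∃ z : ℝ → Z, RIS.IsDifferentialSolution ι R (RIS.energy ι A F ℓ) T z₀ z ∧
        (∀ y : ℝ → Z, RIS.IsDifferentialSolution ι R (RIS.energy ι A F ℓ) T z₀ y →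
          Set.EqOn y z (Set.Icc 0 T)) ∧
        -- the scheme is solvable for every step size
        (∀ τ : ℝ, 0 < τ → ∃ (zk : ℕ → Z) (tk : ℕ → ℝ),
          RIS.IsLocalMinScheme ι R (RIS.energy ι A F ℓ) T z₀ τ zk tk) ∧
        -- for all iterates, the final time is reached, the back-transformation exists,
        -- and the error estimate holds
        (∀ τ : ℝ, 0 < τ → ∀ (zk : ℕ → Z) (tk : ℕ → ℝ),
          RIS.IsLocalMinScheme ι R (RIS.energy ι A F ℓ) T z₀ τ zk tk →
            tk (RIS.finalIndex T tk) = T ∧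
            StrictMonoOn (RIS.affineInterpolant τ tk) (RIS.artificialInterval T τ tk) ∧
            Set.BijOn (RIS.affineInterpolant τ tk) (RIS.artificialInterval T τ tk)
              (Set.Icc 0 T) ∧
            ∀ t ∈ Set.Icc 0 T, ‖RIS.retransformed T τ zk tk t - z t‖ ≤ K * τ) ∧
        -- convergence of the discrete solutions as the step size tends to zero
        (∀ (zk : ℝ → ℕ → Z) (tk : ℝ → ℕ → ℝ),
          (∀ τ : ℝ, 0 < τ →
            RIS.IsLocalMinScheme ι R (RIS.energy ι A F ℓ) T z₀ τ (zk τ) (tk τ)) →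
          TendstoUniformlyOn (fun τ => RIS.retransformed T τ (zk τ) (tk τ)) z
            (𝓝[>] 0) (Set.Icc 0 T)) := by
  obtain ⟨K, hK, h⟩ := theorem3p9_general ι hι.norm_le T hT F hF.contDiff κ (κ - δ)
    (sub_lt_self κ hδ) ℓ hℓLip hℓBV z₀
  have h0 : (0 : ℝ) ∈ Icc 0 T := left_mem_Icc.2 hT.le
  exact ⟨K, hK, fun A hA _ R hR hreg hconv => hR.exists_isSublinear.elim fun ρ hρ =>
    h A hA.symm R ρ hρ (hreg 0 h0) (hconv 0 h0)⟩
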